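/- Let $L^2=L^2(\mathbb R)$ and $H^s=H^s(\mathbb R)\subset L^2$ consist of real-valued functions, with $\|f\|_s=\|(1+\xi^2)^{s/2}\hat f(\xi)\|_{L^2}$ ($\hat f$ being the unitary Fourier transform in which $\partial_x$ has the symbol $i\xi$), let $\Lambda^{-2}=(1-\partial_x^2)^{-1}$, let $f^{(j)}=\partial_x^jf$, and set $\|(u,v)\|_3=\|u\|_3+\|v\|_3$. Let $\alpha,\beta\in\mathbb R$ and put $F(u,v)=(F_1(u,v),F_2(u,v))$, where $$F_1(u,v)=-\beta uu_x-\Lambda^{-2}\partial_x\Big[-\alpha u+\tfrac{3-\beta}{2}u^2+\tfrac{\beta}{2}u_x^2+v+\tfrac12v^2\Big],\qquad F_2(u,v)=-u_x-(uv)_x .$$ For $\sigma\in\mathbb R$ and an integer $m\ge1$ put $$\Phi_{\sigma,m}(u,v)=\frac12\sum_{j=1}^{m+1}\frac{e^{2(j-1)\sigma}}{j!^2}\|u^{(j)}\|_2^2+\frac12\sum_{j=0}^{m}\frac{e^{2j\sigma}}{j!^2}\|v^{(j)}\|_2^2 .$$ **Proposition 3.6.** There exist positive constants $K_1,K_2,L_1,L_2,M_1,M_2,M_3$,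 depending only on $\alpha$ and $\beta$ (in particular independent of $u,v,\sigma$ and $m$), such that for all integers $m\ge1$, all $\sigma\in\mathbb R$ and all $(u,v)\in H^{m+4}\oplus H^{m+4}$ the following holds. One has $F(u,v)\in H^{m+2}\oplus H^{m+2}$; the function $\Phi_{\sigma,m}$ on $H^{m+4}\oplus H^{m+4}$ is Fréchet differentiable at $(u,v)$, and its derivative extends uniquely to a continuous linear functional $D\Phi_{\sigma,m}(u,v)$ on $H^{m+2}\oplus H^{m+2}$; and, with $\langle\cdot,\cdot\rangle$ denoting the pairing of $H^{m+2}\oplus H^{m+2}$ with its dual, $$\begin{aligned}|\langle F(u,v),D\Phi_{\sigma,m}(u,v)\rangle|\le{}&\big[K_1+K_2\|(u,v)\|_3\big]\Phi_{\sigma,m}(u,v)\\&+(L_1+L_2e^{\sigma})\,\Phi_{\sigma,m}(u,v)^{1/2}\,\partial_\sigma\Phi_{\sigma,m}(u,v)\\&+\big[M_1+(M_2+M_3e^{2\sigma})\|(u,v)\|_3\big]\,\partial_\sigma\Phi_{\sigma,m}(u,v).\end{aligned}$$ -/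

import Mathlib

open MeasureTheory FourierTransform
open scoped ContDiff ENNReal

noncomputable section

namespace CamassaHolm

/-- The space `L²(ℝ)` of real-valued square-integrable functions. -/
abbrev RealL2 : Type := Lp ℝ 2 (volume : Measure ℝ)

/-- The inclusion of the real-valued into the complex-valued square-integrable functions. -/
def toComplex : RealL2 →L[ℝ] Lp ℂ 2 (volume : Measure ℝ) :=
  Complex.ofRealCLM.compLpL 2 volume

/-- The Fourier transform `f̂(ξ) = ∫ e^{-2πixξ} f(x) dx` of a real-valued `L²` function, extended to
`L²` by Plancherel. -/
def fourierL2 (f : RealL2) : Lp ℂ 2 (volume : Measure ℝ) :=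
  𝓕 (toComplex f)

/-- The weight `(1 + (2πξ)²)^{s/2}`. With the factor `2π` in the Fourier transform, the operator
`Λ² = 1 - ∂ₓ²` has the symbol `1 + (2πξ)²`. -/
def weight (s : ℕ) (ξ : ℝ) : ℝ := (1 + (2 * Real.pi * ξ) ^ 2) ^ ((s : ℝ) / 2)

/-- The function `ξ ↦ (1 + (2πξ)²)^{s/2} f̂(ξ)`. -/
def weightedFourier (s : ℕ) (f : RealL2) (ξ : ℝ) : ℂ := (weight s ξ : ℂ) * fourierL2 f ξ

/-- The Sobolev norm `‖f‖_s = ‖(1 + (2πξ)²)^{s/2} f̂‖_{L²}`, meaningful for `f` in `H^s`. -/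
def sobolevNorm (s : ℕ) (f : RealL2) : ℝ :=
  (eLpNorm (weightedFourier s f) 2 volume).toReal

theorem weight_pos (s : ℕ) (ξ : ℝ) : 0 < weight s ξ := by
  unfold weight; positivity

theorem continuous_weight (s : ℕ) : Continuous (weight s) := by
  unfold weight
  exact Continuous.rpow_const (by fun_prop) fun ξ => Or.inl (by positivity)

theorem weight_mono {s t : ℕ} (h : s ≤ t) (ξ : ℝ) : weight s ξ ≤ weight t ξ := by
  unfold weight
  refine Real.rpow_le_rpow_of_exponent_le (by nlinarith [sq_nonneg (2 * Real.pi * ξ)]) ?_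
  have : (s : ℝ) ≤ t := by exact_mod_cast h
  linarith

theorem fourierL2_add (f g : RealL2) : fourierL2 (f + g) = fourierL2 f + fourierL2 g := by
  simp only [fourierL2, map_add, FourierTransform.fourier_add]

theorem fourierL2_smul (c : ℝ) (f : RealL2) : fourierL2 (c • f) = (c : ℂ) • fourierL2 f := by
  have h : toComplex (c • f) = (c : ℂ) • toComplex f := by
    rw [map_smul]
    ext1
    filter_upwards [Lp.coeFn_smul c (toComplex f), Lp.coeFn_smul (c : ℂ) (toComplex f)] with x h1 h2
    rw [h1, h2]
    simp
  simp only [fourierL2, h, FourierTransform.fourier_smul]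

theorem weightedFourier_add (s : ℕ) (f g : RealL2) :
    weightedFourier s (f + g) =ᵐ[volume] weightedFourier s f + weightedFourier s g := by
  filter_upwards [Lp.coeFn_add (fourierL2 f) (fourierL2 g)] with ξ h
  simp only [weightedFourier, fourierL2_add, h, Pi.add_apply, mul_add]

theorem weightedFourier_smul (s : ℕ) (c : ℝ) (f : RealL2) :
    weightedFourier s (c • f) =ᵐ[volume] c • weightedFourier s f := by
  filter_upwards [Lp.coeFn_smul (c : ℂ) (fourierL2 f)] with ξ h
  simp only [weightedFourier, fourierL2_smul, h, Pi.smul_apply, smul_eq_mul, Complex.real_smul]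
  ring

/-- `H^s` as a subspace of `L²`: those `f` for which `(1 + (2πξ)²)^{s/2} f̂` is in `L²`. -/
def sobolevSubmodule (s : ℕ) : Submodule ℝ RealL2 where
  carrier := {f | MemLp (weightedFourier s f) 2 volume}
  add_mem' {f g} hf hg := (memLp_congr_ae (weightedFourier_add s f g)).2 (hf.add hg)
  zero_mem' := by
    have h : weightedFourier s ((0 : ℝ) • (0 : RealL2)) =ᵐ[volume] 0 := by
      simpa using weightedFourier_smul s 0 0
    rw [zero_smul] at h
    exact (memLp_congr_ae h).2 MemLp.zero
  smul_mem' c f hf := (memLp_congr_ae (weightedFourier_smul s c f)).2 (hf.const_smul c)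

/-- The Sobolev space `H^s = H^s(ℝ)` of real-valued functions; it is a type of its own because its
norm is `‖·‖_s` and not the `L²` norm. -/
def Sobolev (s : ℕ) : Type := sobolevSubmodule s

namespace Sobolev

instance (s : ℕ) : AddCommGroup (Sobolev s) :=
  inferInstanceAs (AddCommGroup (sobolevSubmodule s))

instance (s : ℕ) : Module ℝ (Sobolev s) :=
  inferInstanceAs (Module ℝ (sobolevSubmodule s))

/-- The `L²` function underlying an element of `H^s`. -/
def val {s : ℕ} (f : Sobolev s) : RealL2 := Subtype.val f

theorem memLp {s : ℕ} (f : Sobolev s) : MemLp (weightedFourier s f.val) 2 volume :=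
  Subtype.property f

/-- The linear map `f ↦ (1 + (2πξ)²)^{s/2} f̂` from `H^s` to `L²`. -/
def toWeighted (s : ℕ) : Sobolev s →ₗ[ℝ] Lp ℂ 2 (volume : Measure ℝ) where
  toFun f := f.memLp.toLp
  map_add' f g := by
    rw [← MemLp.toLp_add]
    exact MemLp.toLp_congr _ _ (weightedFourier_add s f.val g.val)
  map_smul' c f := by
    rw [RingHom.id_apply, ← MemLp.toLp_const_smul]
    exact MemLp.toLp_congr _ _ (weightedFourier_smul s c f.val)

theorem toWeighted_injective (s : ℕ) : Function.Injective (toWeighted s) := by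
  rw [← LinearMap.ker_eq_bot, LinearMap.ker_eq_bot']
  intro f hf
  have h0 : weightedFourier s f.val =ᵐ[volume] 0 := (MemLp.toLp_eq_toLp_iff f.memLp
    (MemLp.zero (p := 2) (μ := (volume : Measure ℝ)) (ε := ℂ))).1 hf
  have h1 : fourierL2 f.val = 0 := by
    rw [Lp.eq_zero_iff_ae_eq_zero]
    filter_upwards [h0] with ξ h
    have hw : (weight s ξ : ℂ) ≠ 0 := by exact_mod_cast (weight_pos s ξ).ne'
    simpa [weightedFourier, hw] using h
  have h2 : toComplex f.val = 0 := by
    rw [← norm_eq_zero, ← Lp.norm_fourier_eq]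
    exact norm_eq_zero.2 h1
  have h3 : f.val = 0 := by
    rw [Lp.eq_zero_iff_ae_eq_zero] at h2 ⊢
    filter_upwards [h2, Complex.ofRealCLM.coeFn_compLp f.val] with x h h'
    have : ((f.val x : ℝ) : ℂ) = 0 := by
      rw [← Complex.ofRealCLM_apply, ← h']
      exact h
    exact_mod_cast this
  exact Subtype.ext h3

instance (s : ℕ) : NormedAddCommGroup (Sobolev s) :=
  NormedAddCommGroup.induced (Sobolev s) (Lp ℂ 2 (volume : Measure ℝ)) (toWeighted s)
    (toWeighted_injective s)

instance (s : ℕ) : NormedSpace ℝ (Sobolev s) :=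
  NormedSpace.induced ℝ (Sobolev s) (Lp ℂ 2 (volume : Measure ℝ)) (toWeighted s)

theorem norm_eq {s : ℕ} (f : Sobolev s) : ‖f‖ = sobolevNorm s f.val :=
  Lp.norm_toLp (weightedFourier s f.val) f.memLp

theorem norm_weightedFourier_le {s t : ℕ} (h : s ≤ t) (f : RealL2) (ξ : ℝ) :
    ‖weightedFourier s f ξ‖ ≤ ‖weightedFourier t f ξ‖ := by
  simp only [weightedFourier, norm_mul, Complex.norm_real, Real.norm_eq_abs,
    abs_of_pos (weight_pos _ ξ)]
  exact mul_le_mul_of_nonneg_right (weight_mono h ξ) (norm_nonneg _)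

theorem mem_of_le {s t : ℕ} (h : s ≤ t) (f : Sobolev t) : f.val ∈ sobolevSubmodule s :=
  f.memLp.mono
    ((Complex.continuous_ofReal.comp (continuous_weight s)).aestronglyMeasurable.mul
      (Lp.aestronglyMeasurable _))
    (Filter.Eventually.of_forall (norm_weightedFourier_le h f.val))

/-- The continuous inclusion `H^t ⊂ H^s` for `s ≤ t`. -/
def inclusion {s t : ℕ} (h : s ≤ t) : Sobolev t →L[ℝ] Sobolev s :=
  LinearMap.mkContinuous
    { toFun := fun f => (⟨f.val, mem_of_le h f⟩ : sobolevSubmodule s)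
      map_add' := fun _ _ => rfl
      map_smul' := fun _ _ => rfl } 1 fun f => by
    rw [one_mul, norm_eq, norm_eq]
    exact ENNReal.toReal_mono f.memLp.eLpNorm_lt_top.ne
      (eLpNorm_mono (norm_weightedFourier_le h f.val))

/-- The continuous inclusion `H^t ⊕ H^t ⊂ H^s ⊕ H^s` for `s ≤ t`. -/
def inclusion₂ {s t : ℕ} (h : s ≤ t) : (Sobolev t × Sobolev t) →L[ℝ] (Sobolev s × Sobolev s) :=
  (inclusion h).prodMap (inclusion h)

end Sobolev

/-- `g` is the derivative of `f` in the sense of (tempered) distributions. -/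
def IsDistribDeriv (f g : RealL2) : Prop :=
  TemperedDistribution.derivCLM ℂ (Lp.toTemperedDistribution (toComplex f)) =
    Lp.toTemperedDistribution (toComplex g)

open Classical in
/-- The distributional derivative `∂ₓ f`, for `f` in `L²` whose derivative is in `L²` (that is, for
`f` in `H¹`); the value is `0` otherwise. -/
def dx (f : RealL2) : RealL2 :=
  if h : ∃ g, IsDistribDeriv f g then h.choose else 0

/-- The derivative `f^{(j)}` of order `j`, for `f` in `H^j`. -/
def iterDx (j : ℕ) (f : RealL2) : RealL2 := dx^[j] f

open Classical in
/-- The pointwise product, for `f`, `g` in `L²` whose product is in `L²` (for instance when one of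
them is in `H¹`); the value is `0` otherwise. -/
def mul (f g : RealL2) : RealL2 :=
  if h : MemLp (fun x => f x * g x) 2 (volume : Measure ℝ) then h.toLp else 0

/-- `g = Λ⁻² f`, where `Λ⁻² = (1 - ∂ₓ²)⁻¹` is the Fourier multiplier with the symbol
`(1 + (2πξ)²)⁻¹`. -/
def IsLambdaInv (f g : RealL2) : Prop :=
  fourierL2 g =ᵐ[volume] fun ξ => ((1 + (2 * Real.pi * ξ) ^ 2 : ℝ) : ℂ)⁻¹ * fourierL2 f ξ

open Classical in
/-- The operator `Λ⁻² = (1 - ∂ₓ²)⁻¹` on `L²`. (A function `g` as required always exists, since the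
symbol is bounded and even.) -/
def lambdaInv (f : RealL2) : RealL2 :=
  if h : ∃ g, IsLambdaInv f g then h.choose else 0

/-- `F₁(u,v) = -β u uₓ - Λ⁻² ∂ₓ [-α u + (3-β)/2 u² + β/2 uₓ² + v + 1/2 v²]`. -/
def F₁ (α β : ℝ) (u v : RealL2) : RealL2 :=
  -(β • mul u (dx u)) -
    lambdaInv (dx (-(α • u) + ((3 - β) / 2) • mul u u + (β / 2) • mul (dx u) (dx u) + v
      + (1 / 2 : ℝ) • mul v v))

/-- `F₂(u,v) = -uₓ - (uv)ₓ`. -/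
def F₂ (u v : RealL2) : RealL2 := -dx u - dx (mul u v)

/-- `Φ⁽¹⁾_{σ,m}(u) = 1/2 ∑_{j=1}^{m+1} e^{2(j-1)σ} / j!² ‖u^{(j)}‖₂²`, with the `H²` norm. -/
def Phi₁ (σ : ℝ) (m : ℕ) (u : RealL2) : ℝ :=
  (1 / 2) * ∑ j ∈ Finset.Icc 1 (m + 1),
    Real.exp (2 * ((j : ℝ) - 1) * σ) / (j.factorial : ℝ) ^ 2 * sobolevNorm 2 (iterDx j u) ^ 2

/-- `Φ⁽²⁾_{σ,m}(v) = 1/2 ∑_{j=0}^{m} e^{2jσ} / j!² ‖v^{(j)}‖₂²`, with the `H²` norm. -/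
def Phi₂ (σ : ℝ) (m : ℕ) (v : RealL2) : ℝ :=
  (1 / 2) * ∑ j ∈ Finset.range (m + 1),
    Real.exp (2 * (j : ℝ) * σ) / (j.factorial : ℝ) ^ 2 * sobolevNorm 2 (iterDx j v) ^ 2

/-- The functional `Φ_{σ,m}(u,v) = Φ⁽¹⁾_{σ,m}(u) + Φ⁽²⁾_{σ,m}(v)`. -/
def Phi (σ : ℝ) (m : ℕ) (u v : RealL2) : ℝ := Phi₁ σ m u + Phi₂ σ m v

/-- The partial derivative `∂_σ Φ_{σ,m}(u,v)`. -/
def dσPhi (σ : ℝ) (m : ℕ) (u v : RealL2) : ℝ := deriv (fun τ => Phi τ m u v) σ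

/-- `‖(u,v)‖₃ = ‖u‖₃ + ‖v‖₃`, with the `H³` norms. -/
def norm₃ (u v : RealL2) : ℝ := sobolevNorm 3 u + sobolevNorm 3 v

/-- The functional `D` on `H^{m+2} ⊕ H^{m+2}` is the Fréchet derivative `DΦ_{σ,m}(U)` at the point
`U` of `H^{m+4} ⊕ H^{m+4}`: the restriction of `D` to `H^{m+4} ⊕ H^{m+4}` is the Fréchet derivative
at `U` of `Φ_{σ,m}` as a function on `H^{m+4} ⊕ H^{m+4}`. -/
def IsFrechetDerivPhi (σ : ℝ) (m : ℕ) (U : Sobolev (m + 4) × Sobolev (m + 4))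
    (D : (Sobolev (m + 2) × Sobolev (m + 2)) →L[ℝ] ℝ) : Prop :=
  HasFDerivAt (fun W : Sobolev (m + 4) × Sobolev (m + 4) => Phi σ m W.1.val W.2.val)
    (D.comp (Sobolev.inclusion₂ (Nat.add_le_add_left (by norm_num : 2 ≤ 4) m))) U

end CamassaHolm

end

noncomputable section

namespace CamassaHolm

open scoped ComplexConjugate

/-! ### Real-valued functions on the Fourier side -/

/-! Put `θ = e^σ`, `x_r = θ^r/(r+1)! ‖u^{(r+1)}‖₂` and `y_r = θ^r/r! ‖v^{(r)}‖₂`. Then `Φ = ½ ∑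
(x_r² + y_r²)` and `∂_σ Φ = ∑ r (x_r² + y_r²)`, so the claim is a trilinear estimate on sequences:
`⟨F, DΦ⟩` is the weighted sum over `r ≤ m` of the H² inner products of `u^{(r+1)}` with `F₁^{(r+1)}`
and of `v^{(r)}` with `F₂^{(r)}`, and each product in `F` is expanded by Leibniz.

The term in which all derivatives fall on the transported factor is integrated by parts
(`abs_inner₂_transport_le`) and loses no derivative. The terms with a factor `u`, `u_x` or `v` in
low norm are bounded by `‖(u,v)‖₃`; those with the binomial coefficient `r+1` give `∂_σ Φ` besides
`Φ`. The nonlocal term is harmless because `Λ⁻²∂ₓ` maps H¹ to H² (`sobolevNorm_lambdaInv_dx_le`).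

In the intermediate Leibniz terms, the tame product estimate `sobolevNorm_two_mul_le` leaves one
factor in H¹ only, and the H¹ norm of `f^{(k+1)}` is at most the H² norm of `f^{(k)}`. The
derivative saved in this way turns into a factor `θ` and, once the factorials absorb the binomial
coefficient, into a weight such as `(p+q+2)/(p+1)` in place of `r+1`. What remains is a sum of
products `x_r x_p x_q` with `p + q = r - 1` (or `p + q = r` without `θ`, from `v²`). Each is
dominated by `√r x_r · √q x_q · x_p/(p+1)`, and Cauchy–Schwarz with `∑ (p+1)⁻² < ∞` yields `Φ^{1/2}
∂_σ Φ` (`sum_mul_conv_le`).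

One product escapes: `p = q = 0`, `r = 1` in the derivatives of `u²` and `uₓ²`, where no factor `√q`
is available. One of its factors is bounded by `‖u‖₃`, which produces the term `e^{2σ} ‖(u,v)‖₃ ∂_σ
Φ`.

The derivative of `Φ` extends to `H^{m+2} ⊕ H^{m+2}` because one integration by parts moves a
derivative from the direction to the base point (`pairing`). The extension is unique since `H^{m+4}`
is dense in `H^{m+2}`. Everything rests on the identification of the distributional derivative with
the multiplier `2πiξ`. -/

theorem coeFn_toComplex (f : RealL2) : toComplex f =ᵐ[volume] fun x => (f x : ℂ) :=
  Complex.ofRealCLM.coeFn_compLp f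

theorem norm_toComplex (f : RealL2) : ‖toComplex f‖ = ‖f‖ := by
  rw [Lp.norm_def, Lp.norm_def]
  congr 1
  refine eLpNorm_congr_norm_ae ?_
  filter_upwards [coeFn_toComplex f] with x hx
  rw [hx, Complex.norm_real]

theorem inner_toComplex (f g : RealL2) : inner ℂ (toComplex f) (toComplex g) = (inner ℝ f g : ℝ) := by
  rw [L2.inner_def, L2.inner_def, ← integral_complex_ofReal]
  refine integral_congr_ae ?_
  filter_upwards [coeFn_toComplex f, coeFn_toComplex g] with x hf hg
  rw [hf, hg]
  simp

theorem norm_fourierL2 (f : RealL2) : ‖fourierL2 f‖ = ‖f‖ := by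
  rw [fourierL2, Lp.norm_fourier_eq, norm_toComplex]

theorem inner_fourierL2 (f g : RealL2) :
    inner ℂ (fourierL2 f) (fourierL2 g) = (inner ℝ f g : ℝ) := by
  rw [fourierL2, fourierL2, Lp.inner_fourier_eq, inner_toComplex]

theorem fourierL2_sub (f g : RealL2) : fourierL2 (f - g) = fourierL2 f - fourierL2 g := by
  have h : f - g = f + (-1 : ℝ) • g := by simp [sub_eq_add_neg]
  rw [h, fourierL2_add, fourierL2_smul]
  simp [sub_eq_add_neg]

theorem fourierL2_injective : Function.Injective fourierL2 := by
  intro f g h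
  rw [← sub_eq_zero, ← norm_eq_zero, ← norm_fourierL2, fourierL2_sub, h, sub_self, norm_zero]

/-- Pointwise complex conjugation on `L²`. -/
def conjL2 : Lp ℂ 2 (volume : Measure ℝ) →L[ℝ] Lp ℂ 2 (volume : Measure ℝ) :=
  (Complex.conjCLE : ℂ →L[ℝ] ℂ).compLpL 2 volume

theorem coeFn_conjL2 (f : Lp ℂ 2 (volume : Measure ℝ)) : conjL2 f =ᵐ[volume] fun x => conj (f x) :=
  (Complex.conjCLE : ℂ →L[ℝ] ℂ).coeFn_compLp f

/-- The reflection `x ↦ -x` on `L²`. -/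
def reflL2 : Lp ℂ 2 (volume : Measure ℝ) →ₗᵢ[ℝ] Lp ℂ 2 (volume : Measure ℝ) :=
  Lp.compMeasurePreservingₗᵢ ℝ Neg.neg (Measure.measurePreserving_neg volume)

theorem coeFn_reflL2 (f : Lp ℂ 2 (volume : Measure ℝ)) : reflL2 f =ᵐ[volume] fun x => f (-x) :=
  Lp.coeFn_compMeasurePreserving f (Measure.measurePreserving_neg volume)

/-- Both sides are continuous in `f`, so it suffices to treat Schwartz functions, where conjugation
passes under the Fourier integral and turns `ξ` into `-ξ`. -/
theorem fourier_conjL2 (f : Lp ℂ 2 (volume : Measure ℝ)) :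
    𝓕 (conjL2 f) = conjL2 (reflL2 (𝓕 f)) := by
  refine DenseRange.induction_on (p := fun f : Lp ℂ 2 (volume : Measure ℝ) =>
    𝓕 (conjL2 f) = conjL2 (reflL2 (𝓕 f)))
    (SchwartzMap.denseRange_toLpCLM (E := ℝ) (F := ℂ) (p := 2) (μ := volume)
      ENNReal.ofNat_ne_top) f ?_ ?_
  · refine isClosed_eq ?_ ?_
    · exact (Lp.fourierTransformₗᵢ ℝ ℂ).continuous.comp conjL2.continuous
    · exact conjL2.continuous.comp (reflL2.continuous.comp (Lp.fourierTransformₗᵢ ℝ ℂ).continuous)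
  · intro φ
    rw [SchwartzMap.toLpCLM_apply]
    have h1 : conjL2 (φ.toLp 2) =
        (SchwartzMap.postcompCLM (𝕜 := ℝ) (Complex.conjCLE : ℂ →L[ℝ] ℂ) φ).toLp 2 := by
      ext1
      filter_upwards [coeFn_conjL2 (φ.toLp 2), φ.coeFn_toLp 2,
        (SchwartzMap.postcompCLM (𝕜 := ℝ) (Complex.conjCLE : ℂ →L[ℝ] ℂ) φ).coeFn_toLp 2]
        with x h1 h2 h3
      rw [h1, h2, h3]
      simp
    rw [h1, SchwartzMap.toLp_fourier_eq, SchwartzMap.toLp_fourier_eq]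
    ext1
    have hneg := (Measure.measurePreserving_neg (volume : Measure ℝ)).quasiMeasurePreserving.ae
      ((𝓕 φ).coeFn_toLp 2 volume)
    filter_upwards [coeFn_conjL2 (reflL2 ((𝓕 φ).toLp 2)), coeFn_reflL2 ((𝓕 φ).toLp 2), hneg,
        (𝓕 (SchwartzMap.postcompCLM (𝕜 := ℝ) (Complex.conjCLE : ℂ →L[ℝ] ℂ) φ)).coeFn_toLp 2]
        with x h1 h2 h3 h4
    rw [h4, h1, h2, h3, SchwartzMap.fourier_coe, SchwartzMap.fourier_coe, Real.fourier_real_eq,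
      Real.fourier_real_eq, ← integral_conj]
    congr 1
    ext v
    simp [Circle.smul_def]

theorem fourierL2_neg_ae (f : RealL2) : ∀ᵐ ξ, fourierL2 f (-ξ) = conj (fourierL2 f ξ) := by
  have h : conjL2 (toComplex f) = toComplex f := by
    ext1
    filter_upwards [coeFn_conjL2 (toComplex f), coeFn_toComplex f] with x h1 h2
    rw [h1, h2, Complex.conj_ofReal]
  have h1 := fourier_conjL2 (toComplex f)
  rw [h] at h1
  change fourierL2 f = conjL2 (reflL2 (fourierL2 f)) at h1
  have h2 := coeFn_conjL2 (reflL2 (fourierL2 f))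
  rw [← h1] at h2
  filter_upwards [h2, coeFn_reflL2 (fourierL2 f)] with x h3 h4
  rw [h3, h4, Complex.conj_conj]

/-- Hermitian symmetry of `h` makes its inverse transform invariant under conjugation, hence real;
its real part is therefore the function sought. -/
theorem exists_fourierL2_eq (h : Lp ℂ 2 (volume : Measure ℝ))
    (hh : ∀ᵐ ξ, h (-ξ) = conj (h ξ)) : ∃ g : RealL2, fourierL2 g = h := by
  have h1 : conjL2 (reflL2 h) = h := by
    ext1
    filter_upwards [hh, coeFn_conjL2 (reflL2 h), coeFn_reflL2 h] with x h1 h2 h3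
    rw [h2, h3, h1, Complex.conj_conj]
  have h2 : conjL2 (𝓕⁻ h) = 𝓕⁻ h := by
    have h3 := fourier_conjL2 (𝓕⁻ h)
    rw [FourierTransform.fourier_fourierInv_eq, h1] at h3
    calc conjL2 (𝓕⁻ h) = 𝓕⁻ (𝓕 (conjL2 (𝓕⁻ h))) :=
          (FourierTransform.fourierInv_fourier_eq _).symm
      _ = 𝓕⁻ h := by rw [h3]
  refine ⟨Complex.reCLM.compLpL 2 volume (𝓕⁻ h), ?_⟩
  have h4 : toComplex (Complex.reCLM.compLpL 2 volume (𝓕⁻ h)) = 𝓕⁻ h := by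
    ext1
    have h5 := coeFn_conjL2 (𝓕⁻ h)
    rw [h2] at h5
    filter_upwards [coeFn_toComplex (Complex.reCLM.compLpL 2 volume (𝓕⁻ h)), h5,
      Complex.reCLM.coeFn_compLp (𝓕⁻ h)] with x h6 h7 h8
    rw [h6]
    refine Eq.trans ?_ (Complex.conj_eq_iff_re.1 h7.symm)
    congr 1
  rw [fourierL2, h4, FourierTransform.fourier_fourierInv_eq]

/-- A Fourier multiplier with a Hermitian symbol maps real-valued functions to real-valued ones. -/
theorem exists_fourierL2_eq_mul (f : RealL2) {M : ℝ → ℂ} (hM : ∀ ξ, M (-ξ) = conj (M ξ))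
    (hf : MemLp (fun ξ => M ξ * fourierL2 f ξ) 2 volume) :
    ∃ g : RealL2, fourierL2 g =ᵐ[volume] fun ξ => M ξ * fourierL2 f ξ := by
  obtain ⟨g, hg⟩ := exists_fourierL2_eq hf.toLp (by
    have hneg := (Measure.measurePreserving_neg (volume : Measure ℝ)).quasiMeasurePreserving.ae
      hf.coeFn_toLp
    filter_upwards [hneg, hf.coeFn_toLp, fourierL2_neg_ae f] with ξ h1 h2 h3
    rw [h1, h2, h3, hM, map_mul])
  exact ⟨g, hg ▸ hf.coeFn_toLp⟩

/-! ### The distributional derivative as a Fourier multiplier -/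

/-- The Fourier transform is injective on tempered distributions and turns `∂ₓ` into multiplication
by `2πiξ`. All later facts on `dx` are read off from this multiplier. -/
theorem isDistribDeriv_iff_fourierL2 (f g : RealL2) :
    IsDistribDeriv f g ↔
      fourierL2 g =ᵐ[volume] fun ξ => (2 * Real.pi * ξ : ℝ) * Complex.I * fourierL2 f ξ := by
  have key : IsDistribDeriv f g ↔ ∀ φ : SchwartzMap ℝ ℂ,
      ∫ ξ, φ ξ • ((2 * Real.pi * ξ : ℝ) * Complex.I * fourierL2 f ξ) =
        ∫ ξ, φ ξ • fourierL2 g ξ := by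
    have hd : TemperedDistribution.derivCLM ℂ (Lp.toTemperedDistribution (toComplex f)) =
        LineDeriv.lineDerivOp (1 : ℝ) (Lp.toTemperedDistribution (toComplex f)) := by
      ext φ
      rw [TemperedDistribution.derivCLM_apply_apply, TemperedDistribution.lineDerivOp_apply_apply]
      congr 2
    rw [IsDistribDeriv, hd, ← (FourierTransform.fourierEquiv ℂ
      (TemperedDistribution ℝ ℂ)).injective.eq_iff]
    change 𝓕 (LineDeriv.lineDerivOp (1 : ℝ) (Lp.toTemperedDistribution (toComplex f))) =
      𝓕 (Lp.toTemperedDistribution (toComplex g)) ↔ _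
    rw [TemperedDistribution.fourier_lineDerivOp_eq, Lp.fourier_toTemperedDistribution_eq,
      Lp.fourier_toTemperedDistribution_eq, DFunLike.ext_iff]
    refine forall_congr' fun φ => ?_
    have hg : (fun x : ℝ => ((inner ℝ x (1 : ℝ) : ℝ) : ℂ)).HasTemperateGrowth := by fun_prop
    have e : ((2 * Real.pi * Complex.I) • (TemperedDistribution.smulLeftCLM ℂ fun x : ℝ =>
        ((inner ℝ x (1 : ℝ) : ℝ) : ℂ)) (Lp.toTemperedDistribution (𝓕 (toComplex f)))) φ =
        ∫ ξ, φ ξ • ((2 * Real.pi * ξ : ℝ) * Complex.I * fourierL2 f ξ) := by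
      change (2 * Real.pi * Complex.I) • (TemperedDistribution.smulLeftCLM ℂ (fun x : ℝ =>
        ((inner ℝ x (1 : ℝ) : ℝ) : ℂ)) (Lp.toTemperedDistribution (𝓕 (toComplex f)))) φ = _
      rw [TemperedDistribution.smulLeftCLM_apply_apply, Lp.toTemperedDistribution_apply,
        ← integral_smul]
      congr 1
      ext ξ
      rw [SchwartzMap.smulLeftCLM_apply_apply hg]
      simp [fourierL2]
      ring
    rw [e, Lp.toTemperedDistribution_apply]
    rfl
  rw [key]
  constructor
  · intro h
    have hl : LocallyIntegrable (fourierL2 f) volume :=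
      (Lp.memLp (fourierL2 f)).locallyIntegrable (by norm_num)
    -- At this point `ξ f̂(ξ)` is only known to be locally integrable, so the two functions are
    -- compared through compactly supported smooth test functions.
    refine Filter.EventuallyEq.symm (ae_eq_of_integral_contDiff_smul_eq (μ := volume) ?_
      ((Lp.memLp (fourierL2 g)).locallyIntegrable (by norm_num)) fun φ hφ hc => ?_)
    · have hc : Continuous fun ξ : ℝ => ((2 * Real.pi * ξ : ℝ) : ℂ) * Complex.I := by fun_prop
      rw [← locallyIntegrableOn_univ] at hl ⊢
      exact hl.continuousOn_mul hc.continuousOn isOpen_univ.isLocallyClosed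
    · have h1 : HasCompactSupport (Complex.ofRealCLM ∘ φ) := hc.comp_left rfl
      have h2 : ContDiff ℝ ∞ (Complex.ofRealCLM ∘ φ) := by fun_prop
      simpa using h (h1.toSchwartzMap h2)
  · intro h φ
    refine integral_congr_ae ?_
    filter_upwards [h] with ξ h
    rw [h]

/-! ### Sobolev spaces and derivatives -/

theorem weight_sq (s : ℕ) (ξ : ℝ) : weight s ξ ^ 2 = (1 + (2 * Real.pi * ξ) ^ 2) ^ s := by
  rw [weight, ← Real.rpow_natCast, ← Real.rpow_mul (by positivity)]
  simp

theorem norm_weightedFourier_sq (s : ℕ) (f : RealL2) (ξ : ℝ) :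
    ‖weightedFourier s f ξ‖ ^ 2 = (1 + (2 * Real.pi * ξ) ^ 2) ^ s * ‖fourierL2 f ξ‖ ^ 2 := by
  rw [weightedFourier, norm_mul, mul_pow, Complex.norm_real, Real.norm_eq_abs, sq_abs, weight_sq]

theorem aestronglyMeasurable_weightedFourier (s : ℕ) (f : RealL2) :
    AEStronglyMeasurable (weightedFourier s f) volume :=
  (Complex.continuous_ofReal.comp (continuous_weight s)).aestronglyMeasurable.mul
    (Lp.aestronglyMeasurable _)

theorem mem_sobolev_iff {s : ℕ} {f : RealL2} : f ∈ sobolevSubmodule s ↔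
    Integrable (fun ξ => (1 + (2 * Real.pi * ξ) ^ 2) ^ s * ‖fourierL2 f ξ‖ ^ 2) volume := by
  change MemLp (weightedFourier s f) 2 volume ↔ _
  rw [memLp_two_iff_integrable_sq_norm (aestronglyMeasurable_weightedFourier s f)]
  simp only [norm_weightedFourier_sq]

theorem sobolevNorm_nonneg (s : ℕ) (f : RealL2) : 0 ≤ sobolevNorm s f := ENNReal.toReal_nonneg

theorem toReal_eLpNorm_sq {F : ℝ → ℂ} (hF : MemLp F 2 volume) :
    (eLpNorm F 2 volume).toReal ^ 2 = ∫ ξ, ‖F ξ‖ ^ 2 := by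
  rw [hF.eLpNorm_eq_integral_rpow_norm (by norm_num) (by norm_num),
    ENNReal.toReal_ofReal (by positivity), ← Real.rpow_natCast, ← Real.rpow_mul
      (integral_nonneg fun _ => by positivity)]
  simp

theorem sobolevNorm_sq {s : ℕ} {f : RealL2} (hf : f ∈ sobolevSubmodule s) :
    sobolevNorm s f ^ 2 =
      ∫ ξ, (1 + (2 * Real.pi * ξ) ^ 2) ^ s * ‖fourierL2 f ξ‖ ^ 2 := by
  rw [sobolevNorm, toReal_eLpNorm_sq hf]
  simp only [norm_weightedFourier_sq]

theorem mem_sobolev_zero (f : RealL2) : f ∈ sobolevSubmodule 0 := by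
  rw [mem_sobolev_iff]
  simpa using (memLp_two_iff_integrable_sq_norm (Lp.aestronglyMeasurable _)).1
    (Lp.memLp (fourierL2 f))

theorem sobolevNorm_zero (f : RealL2) : sobolevNorm 0 f = ‖f‖ := by
  rw [← norm_fourierL2, Lp.norm_def, sobolevNorm]
  congr 2
  ext ξ
  simp [weightedFourier, weight]

theorem mem_sobolev_of_le {s t : ℕ} (h : s ≤ t) {f : RealL2} (hf : f ∈ sobolevSubmodule t) :
    f ∈ sobolevSubmodule s :=
  Sobolev.mem_of_le h ⟨f, hf⟩

theorem sobolevNorm_mono {s t : ℕ} (h : s ≤ t) {f : RealL2} (hf : f ∈ sobolevSubmodule t) :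
    sobolevNorm s f ≤ sobolevNorm t f :=
  ENNReal.toReal_mono (MemLp.eLpNorm_lt_top hf).ne
      (eLpNorm_mono (Sobolev.norm_weightedFourier_le h f))

theorem IsDistribDeriv.unique {f g h : RealL2} (hg : IsDistribDeriv f g)
    (hh : IsDistribDeriv f h) : g = h := by
  rw [isDistribDeriv_iff_fourierL2] at hg hh
  exact fourierL2_injective (Lp.ext (hg.trans hh.symm))

theorem exists_isDistribDeriv {f : RealL2} (hf : f ∈ sobolevSubmodule 1) :
    ∃ g, IsDistribDeriv f g := by
  obtain ⟨g, hg⟩ := exists_fourierL2_eq_mul f (M := fun ξ => (2 * Real.pi * ξ : ℝ) * Complex.I)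
    (fun ξ => by rw [map_mul, Complex.conj_ofReal, Complex.conj_I, mul_neg, mul_neg,
      Complex.ofReal_neg, neg_mul]) (by
      refine MemLp.mono (g := weightedFourier 1 f) hf ?_ ?_
      · refine AEStronglyMeasurable.mul ?_ (Lp.aestronglyMeasurable _)
        exact Continuous.aestronglyMeasurable (by fun_prop)
      · refine Filter.Eventually.of_forall fun ξ => ?_
        refine le_of_sq_le_sq ?_ (norm_nonneg _)
        rw [norm_weightedFourier_sq]
        simp only [norm_mul, mul_pow, Complex.norm_real, Complex.norm_I, Real.norm_eq_abs, sq_abs,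
          pow_one]
        nlinarith [sq_nonneg ‖fourierL2 f ξ‖])
  exact ⟨g, (isDistribDeriv_iff_fourierL2 f g).2 hg⟩

theorem isDistribDeriv_dx {f : RealL2} (hf : f ∈ sobolevSubmodule 1) : IsDistribDeriv f (dx f) := by
  have h := exists_isDistribDeriv hf
  rw [dx, dif_pos h]
  exact h.choose_spec

theorem IsDistribDeriv.dx_eq {f g : RealL2} (h : IsDistribDeriv f g) : dx f = g := by
  have h' : ∃ g, IsDistribDeriv f g := ⟨g, h⟩
  rw [dx, dif_pos h']
  exact h'.choose_spec.unique h

/-- The weight splits as `(1+ξ²)^{s+1} = (1+ξ²)^s + (1+ξ²)^s ξ²` (with `2πξ` for `ξ`). This is how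
products are shown to lie in H^s: their derivative is computed first, and the regularity follows. -/
theorem IsDistribDeriv.mem_sobolev {f g : RealL2} {s : ℕ} (h : IsDistribDeriv f g)
    (hf : f ∈ sobolevSubmodule s) (hg : g ∈ sobolevSubmodule s) : f ∈ sobolevSubmodule (s + 1) := by
  rw [isDistribDeriv_iff_fourierL2] at h
  rw [mem_sobolev_iff] at *
  refine (hf.add hg).congr ?_
  filter_upwards [h] with ξ h
  simp only [Pi.add_apply, h, norm_mul, mul_pow, Complex.norm_real, Complex.norm_I,
    Real.norm_eq_abs, sq_abs]
  ring

theorem fourierL2_dx {f : RealL2} (hf : f ∈ sobolevSubmodule 1) :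
    fourierL2 (dx f) =ᵐ[volume] fun ξ => (2 * Real.pi * ξ : ℝ) * Complex.I * fourierL2 f ξ :=
  (isDistribDeriv_iff_fourierL2 _ _).1 (isDistribDeriv_dx hf)

theorem dx_mem_sobolev {s : ℕ} {f : RealL2} (hf : f ∈ sobolevSubmodule (s + 1)) :
    dx f ∈ sobolevSubmodule s := by
  have h := fourierL2_dx (mem_sobolev_of_le (Nat.le_add_left 1 s) hf)
  have hm := aestronglyMeasurable_weightedFourier s (dx f)
  rw [mem_sobolev_iff] at *
  refine hf.mono ?_ ?_
  · simp only [← norm_weightedFourier_sq]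
    exact hm.norm.pow 2
  · filter_upwards [h] with ξ h
    have hp : 0 < 1 + (2 * Real.pi * ξ) ^ 2 := by positivity
    rw [Real.norm_of_nonneg (mul_nonneg (pow_nonneg hp.le _) (sq_nonneg _)),
      Real.norm_of_nonneg (mul_nonneg (pow_nonneg hp.le _) (sq_nonneg _)), h,
      pow_succ (1 + (2 * Real.pi * ξ) ^ 2) s, mul_assoc (_ ^ s)]
    refine mul_le_mul_of_nonneg_left ?_ (pow_nonneg hp.le s)
    simp only [norm_mul, mul_pow, Complex.norm_real, Complex.norm_I, Real.norm_eq_abs, sq_abs]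
    nlinarith [sq_nonneg ‖fourierL2 f ξ‖]

theorem sobolevNorm_succ_sq {s : ℕ} {f : RealL2} (hf : f ∈ sobolevSubmodule (s + 1)) :
    sobolevNorm (s + 1) f ^ 2 = sobolevNorm s f ^ 2 + sobolevNorm s (dx f) ^ 2 := by
  have h0 := mem_sobolev_of_le (Nat.le_add_right s 1) hf
  have h1 := dx_mem_sobolev hf
  have h := fourierL2_dx (mem_sobolev_of_le (Nat.le_add_left 1 s) hf)
  rw [sobolevNorm_sq hf, sobolevNorm_sq h0, sobolevNorm_sq h1,
    ← integral_add (mem_sobolev_iff.1 h0) (mem_sobolev_iff.1 h1)]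
  refine integral_congr_ae ?_
  filter_upwards [h] with ξ h
  simp only [h, norm_mul, mul_pow, Complex.norm_real, Complex.norm_I, Real.norm_eq_abs, sq_abs]
  ring

theorem sobolevNorm_dx_le {s : ℕ} {f : RealL2} (hf : f ∈ sobolevSubmodule (s + 1)) :
    sobolevNorm s (dx f) ≤ sobolevNorm (s + 1) f := by
  refine le_of_sq_le_sq ?_ (sobolevNorm_nonneg _ _)
  rw [sobolevNorm_succ_sq hf]
  nlinarith [sq_nonneg (sobolevNorm s f)]

/-- An element of `sobolevSubmodule s` as an element of `Sobolev s`. -/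
def Sobolev.mk {s : ℕ} {f : RealL2} (hf : f ∈ sobolevSubmodule s) : Sobolev s := ⟨f, hf⟩

theorem sobolevNorm_add_le {s : ℕ} {f g : RealL2} (hf : f ∈ sobolevSubmodule s)
    (hg : g ∈ sobolevSubmodule s) :
    sobolevNorm s (f + g) ≤ sobolevNorm s f + sobolevNorm s g := by
  have := norm_add_le (Sobolev.mk hf) (Sobolev.mk hg)
  rwa [Sobolev.norm_eq, Sobolev.norm_eq, Sobolev.norm_eq] at this

theorem sobolevNorm_smul {s : ℕ} (c : ℝ) {f : RealL2} (hf : f ∈ sobolevSubmodule s) :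
    sobolevNorm s (c • f) = |c| * sobolevNorm s f := by
  have := norm_smul c (Sobolev.mk hf)
  rwa [Sobolev.norm_eq, Sobolev.norm_eq] at this

theorem dx_add {f g : RealL2} (hf : f ∈ sobolevSubmodule 1) (hg : g ∈ sobolevSubmodule 1) :
    dx (f + g) = dx f + dx g := by
  refine IsDistribDeriv.dx_eq ((isDistribDeriv_iff_fourierL2 _ _).2 ?_)
  rw [fourierL2_add, fourierL2_add]
  filter_upwards [fourierL2_dx hf, fourierL2_dx hg, Lp.coeFn_add (fourierL2 f) (fourierL2 g),
    Lp.coeFn_add (fourierL2 (dx f)) (fourierL2 (dx g))] with ξ h1 h2 h3 h4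
  rw [h3, h4, Pi.add_apply, Pi.add_apply, h1, h2, mul_add]

theorem dx_smul (c : ℝ) {f : RealL2} (hf : f ∈ sobolevSubmodule 1) :
    dx (c • f) = c • dx f := by
  refine IsDistribDeriv.dx_eq ((isDistribDeriv_iff_fourierL2 _ _).2 ?_)
  rw [fourierL2_smul, fourierL2_smul]
  filter_upwards [fourierL2_dx hf, Lp.coeFn_smul (c : ℂ) (fourierL2 f),
    Lp.coeFn_smul (c : ℂ) (fourierL2 (dx f))] with ξ h1 h3 h4
  rw [h3, h4, Pi.smul_apply, Pi.smul_apply, h1, smul_eq_mul, smul_eq_mul]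
  ring

/-- By Plancherel, since the symbol `2πiξ` is purely imaginary. There are no boundary terms to
discuss. -/
theorem inner_dx_left {f g : RealL2} (hf : f ∈ sobolevSubmodule 1) (hg : g ∈ sobolevSubmodule 1) :
    inner ℝ (dx f) g = -inner ℝ f (dx g) := by
  have h : inner ℂ (fourierL2 (dx f)) (fourierL2 g) = -inner ℂ (fourierL2 f) (fourierL2 (dx g)) := by
    rw [L2.inner_def, L2.inner_def, ← integral_neg]
    refine integral_congr_ae ?_
    filter_upwards [fourierL2_dx hf, fourierL2_dx hg] with ξ h1 h2
    rw [h1, h2]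
    simp only [RCLike.inner_apply, map_mul, Complex.conj_ofReal, Complex.conj_I]
    ring
  rw [inner_fourierL2, inner_fourierL2] at h
  exact_mod_cast h

theorem iterDx_zero (f : RealL2) : iterDx 0 f = f := rfl

theorem iterDx_succ (j : ℕ) (f : RealL2) : iterDx (j + 1) f = dx (iterDx j f) :=
  Function.iterate_succ_apply' dx j f

theorem iterDx_succ' (j : ℕ) (f : RealL2) : iterDx (j + 1) f = iterDx j (dx f) :=
  Function.iterate_succ_apply dx j f

theorem iterDx_mem_sobolev {s : ℕ} (j : ℕ) {f : RealL2} (hf : f ∈ sobolevSubmodule (s + j)) :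
    iterDx j f ∈ sobolevSubmodule s := by
  induction j generalizing f with
  | zero => exact hf
  | succ j ih => exact ih (dx_mem_sobolev hf)

theorem iterDx_add {j : ℕ} {f g : RealL2} (hf : f ∈ sobolevSubmodule j)
    (hg : g ∈ sobolevSubmodule j) : iterDx j (f + g) = iterDx j f + iterDx j g := by
  induction j generalizing f g with
  | zero => rfl
  | succ j ih =>
    rw [iterDx_succ', dx_add (mem_sobolev_of_le (by omega) hf) (mem_sobolev_of_le (by omega) hg),
      ih (dx_mem_sobolev hf) (dx_mem_sobolev hg)]
    rfl

theorem iterDx_smul {j : ℕ} (c : ℝ) {f : RealL2} (hf : f ∈ sobolevSubmodule j) :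
    iterDx j (c • f) = c • iterDx j f := by
  induction j generalizing f with
  | zero => rfl
  | succ j ih =>
    rw [iterDx_succ', dx_smul c (mem_sobolev_of_le (by omega) hf), ih (dx_mem_sobolev hf)]
    rfl

theorem sobolevNorm_iterDx_le {s : ℕ} (j : ℕ) {f : RealL2} (hf : f ∈ sobolevSubmodule (s + j)) :
    sobolevNorm s (iterDx j f) ≤ sobolevNorm (s + j) f := by
  induction j generalizing f with
  | zero => exact le_rfl
  | succ j ih =>
    exact (ih (dx_mem_sobolev hf)).trans (sobolevNorm_dx_le hf)

/-! ### The operator `Λ⁻²` -/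

theorem isLambdaInv_lambdaInv (f : RealL2) : IsLambdaInv f (lambdaInv f) := by
  have h : ∃ g, IsLambdaInv f g := by
    refine exists_fourierL2_eq_mul f (M := fun ξ => ((1 + (2 * Real.pi * ξ) ^ 2 : ℝ) : ℂ)⁻¹)
      (fun ξ => by rw [map_inv₀, Complex.conj_ofReal, mul_neg, neg_sq]) ?_
    refine (Lp.memLp (fourierL2 f)).mono ?_ (Filter.Eventually.of_forall fun ξ => ?_)
    · refine AEStronglyMeasurable.mul ?_ (Lp.aestronglyMeasurable _)
      refine Continuous.aestronglyMeasurable (Continuous.inv₀ (by fun_prop) fun ξ => ?_)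
      exact_mod_cast (by positivity : (1 + (2 * Real.pi * ξ) ^ 2) ≠ 0)
    · rw [norm_mul, norm_inv, Complex.norm_real, Real.norm_of_nonneg (by positivity)]
      refine mul_le_of_le_one_left (norm_nonneg _) (inv_le_one_of_one_le₀ ?_)
      nlinarith [sq_nonneg (2 * Real.pi * ξ)]
  rw [lambdaInv, dif_pos h]
  exact h.choose_spec

theorem norm_fourierL2_lambdaInv (f : RealL2) :
    ∀ᵐ ξ, (1 + (2 * Real.pi * ξ) ^ 2) * ‖fourierL2 (lambdaInv f) ξ‖ = ‖fourierL2 f ξ‖ := by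
  filter_upwards [isLambdaInv_lambdaInv f] with ξ h
  have : 0 < 1 + (2 * Real.pi * ξ) ^ 2 := by positivity
  rw [h, norm_mul, norm_inv, Complex.norm_real, Real.norm_of_nonneg (by positivity),
    mul_inv_cancel_left₀ this.ne']

theorem lambdaInv_mem_sobolev {s : ℕ} {f : RealL2} (hf : f ∈ sobolevSubmodule s) :
    lambdaInv f ∈ sobolevSubmodule (s + 2) := by
  rw [mem_sobolev_iff] at *
  refine hf.congr ?_
  filter_upwards [norm_fourierL2_lambdaInv f] with ξ h
  rw [← h]
  ring

theorem sobolevNorm_lambdaInv {s : ℕ} {f : RealL2} (hf : f ∈ sobolevSubmodule s) :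
    sobolevNorm (s + 2) (lambdaInv f) = sobolevNorm s f := by
  rw [← sq_eq_sq₀ (sobolevNorm_nonneg _ _) (sobolevNorm_nonneg _ _), sobolevNorm_sq hf,
    sobolevNorm_sq (lambdaInv_mem_sobolev hf)]
  refine integral_congr_ae ?_
  filter_upwards [norm_fourierL2_lambdaInv f] with ξ h
  rw [← h]
  ring

theorem lambdaInv_eq {f g : RealL2} (h : IsLambdaInv f g) : lambdaInv f = g :=
  fourierL2_injective (Lp.ext ((isLambdaInv_lambdaInv f).trans h.symm))

theorem lambdaInv_dx {f : RealL2} (hf : f ∈ sobolevSubmodule 1) :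
    lambdaInv (dx f) = dx (lambdaInv f) := by
  refine lambdaInv_eq ?_
  filter_upwards [isLambdaInv_lambdaInv f, fourierL2_dx hf, fourierL2_dx (mem_sobolev_of_le
    (by norm_num) (lambdaInv_mem_sobolev (mem_sobolev_zero f)))] with ξ h1 h2 h3
  rw [h3, h1, h2]
  ring

theorem iterDx_lambdaInv {j : ℕ} {f : RealL2} (hf : f ∈ sobolevSubmodule j) :
    iterDx j (lambdaInv f) = lambdaInv (iterDx j f) := by
  induction j generalizing f with
  | zero => rfl
  | succ j ih =>
    rw [iterDx_succ', ← lambdaInv_dx (mem_sobolev_of_le (by omega) hf), ih (dx_mem_sobolev hf)]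
    rfl

/-- `Λ⁻²` is an isometry from H^s onto its image in H^{s+2}, so `Λ⁻²∂ₓ` gains one derivative with
constant 1. -/
theorem sobolevNorm_lambdaInv_dx_le {f : RealL2} (hf : f ∈ sobolevSubmodule 1) :
    sobolevNorm 2 (lambdaInv (dx f)) ≤ sobolevNorm 1 f := by
  rw [sobolevNorm_lambdaInv (dx_mem_sobolev hf)]
  exact sobolevNorm_dx_le hf

/-! ### The embedding of `H¹` into the bounded functions -/

/-- The constant of the embedding of `H¹` into `L^∞`. -/
def embConst : ℝ := (∫ ξ : ℝ, (weight 1 ξ)⁻¹ ^ (2 : ℝ)) ^ (1 / (2 : ℝ))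

theorem embConst_nonneg : 0 ≤ embConst :=
  Real.rpow_nonneg (integral_nonneg fun ξ =>
    Real.rpow_nonneg (inv_nonneg.2 (weight_pos 1 ξ).le) _) _

theorem memLp_inv_weight_one : MemLp (fun ξ => (weight 1 ξ)⁻¹) 2 volume := by
  have hc : Continuous fun ξ => (weight 1 ξ)⁻¹ :=
    (continuous_weight 1).inv₀ fun ξ => (weight_pos 1 ξ).ne'
  rw [memLp_two_iff_integrable_sq_norm hc.aestronglyMeasurable]
  have h : Integrable (fun ξ : ℝ => (1 + (2 * Real.pi * ξ) ^ 2)⁻¹) volume :=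
    integrable_inv_one_add_sq.comp_mul_left' (by positivity)
  refine h.congr (Filter.Eventually.of_forall fun ξ => ?_)
  simp only [Real.norm_eq_abs, sq_abs, inv_pow, weight_sq, pow_one]

theorem norm_fourierL2_eq_mul (f : RealL2) (ξ : ℝ) :
    ‖fourierL2 f ξ‖ = (weight 1 ξ)⁻¹ * ‖weightedFourier 1 f ξ‖ := by
  have h := weight_pos 1 ξ
  rw [weightedFourier, norm_mul, Complex.norm_real, Real.norm_of_nonneg h.le,
    inv_mul_cancel_left₀ h.ne']

theorem integrable_fourierL2 {f : RealL2} (hf : f ∈ sobolevSubmodule 1) :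
    Integrable (fourierL2 f) volume := by
  rw [← integrable_norm_iff (Lp.aestronglyMeasurable _)]
  have h := memLp_inv_weight_one.integrable_mul (MemLp.norm (f := weightedFourier 1 f) hf)
  refine h.congr (Filter.Eventually.of_forall fun ξ => ?_)
  exact (norm_fourierL2_eq_mul f ξ).symm

theorem integral_norm_fourierL2_le {f : RealL2} (hf : f ∈ sobolevSubmodule 1) :
    ∫ ξ, ‖fourierL2 f ξ‖ ≤ embConst * sobolevNorm 1 f := by
  have h2 : ENNReal.ofReal 2 = 2 := by simp
  have h := integral_mul_le_Lp_mul_Lq_of_nonneg (μ := volume) Real.HolderConjugate.two_two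
    (f := fun ξ => (weight 1 ξ)⁻¹) (g := fun ξ => ‖weightedFourier 1 f ξ‖)
    (Filter.Eventually.of_forall fun ξ => inv_nonneg.2 (weight_pos 1 ξ).le)
    (Filter.Eventually.of_forall fun ξ => norm_nonneg _)
    (by rw [h2]; exact memLp_inv_weight_one)
    (by rw [h2]; exact MemLp.norm (f := weightedFourier 1 f) hf)
  simp only [← norm_fourierL2_eq_mul] at h
  refine h.trans (mul_le_mul_of_nonneg_left ?_ embConst_nonneg)
  have h3 : ∫ ξ, ‖weightedFourier 1 f ξ‖ ^ (2 : ℝ) = sobolevNorm 1 f ^ 2 := by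
    rw [sobolevNorm, toReal_eLpNorm_sq hf]
    simp
  rw [h3, ← Real.sqrt_eq_rpow, Real.sqrt_sq (sobolevNorm_nonneg _ _)]

/-- For `f` in H¹ the transform is integrable, so the inversion integral defines a continuous
function. It agrees with `f` because both give the same integrals against test functions, the
inverse transform being movable onto the test function. -/
theorem toComplex_eq_fourierInv {f : RealL2} (hf : f ∈ sobolevSubmodule 1) :
    toComplex f =ᵐ[volume] 𝓕⁻ (fourierL2 f : ℝ → ℂ) := by
  have hi := integrable_fourierL2 hf
  have hcont : Continuous (𝓕⁻ (fourierL2 f : ℝ → ℂ)) :=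
    VectorFourier.fourierIntegral_continuous Real.continuous_fourierChar
      (by simp only [LinearMap.neg_apply, innerₗ_apply_apply]; fun_prop) hi
  refine ae_eq_of_integral_contDiff_smul_eq (μ := volume)
    ((Lp.memLp (toComplex f)).locallyIntegrable (by norm_num)) hcont.locallyIntegrable
    fun φ hφ hc => ?_
  have h1 : HasCompactSupport (Complex.ofRealCLM ∘ φ) := hc.comp_left rfl
  have h2 : ContDiff ℝ ∞ (Complex.ofRealCLM ∘ φ) := by fun_prop
  set ψ : SchwartzMap ℝ ℂ := h1.toSchwartzMap h2 with hψ
  have hψφ : ∀ x, ψ x = (φ x : ℂ) := fun x => rfl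
  have e1 : Lp.toTemperedDistribution (toComplex f) ψ =
      Lp.toTemperedDistribution (fourierL2 f) (𝓕⁻ ψ) := by
    rw [← TemperedDistribution.fourierInv_apply, Lp.fourierInv_toTemperedDistribution_eq, fourierL2,
      FourierTransform.fourierInv_fourier_eq]
  rw [Lp.toTemperedDistribution_apply, Lp.toTemperedDistribution_apply] at e1
  have hL : (-innerₗ ℝ : ℝ →ₗ[ℝ] ℝ →ₗ[ℝ] ℝ).flip = -innerₗ ℝ := by
    ext; simp
  have e2 : ∫ ξ, 𝓕⁻ (ψ : ℝ → ℂ) ξ • fourierL2 f ξ = ∫ x, ψ x • 𝓕⁻ (fourierL2 f : ℝ → ℂ) x := by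
    have := VectorFourier.integral_fourierIntegral_smul_eq_flip (μ := (volume : Measure ℝ))
      (ν := (volume : Measure ℝ)) (L := (-innerₗ ℝ : ℝ →ₗ[ℝ] ℝ →ₗ[ℝ] ℝ))
      (f := (ψ : ℝ → ℂ)) (g := fourierL2 f) Real.continuous_fourierChar
      (by simp only [LinearMap.neg_apply, innerₗ_apply_apply]; fun_prop) ψ.integrable hi
    rw [hL] at this
    exact this
  rw [← SchwartzMap.fourierInv_coe, ← e1] at e2
  simpa [hψφ] using e2

theorem ae_abs_le {f : RealL2} (hf : f ∈ sobolevSubmodule 1) :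
    ∀ᵐ x, |f x| ≤ embConst * sobolevNorm 1 f := by
  filter_upwards [coeFn_toComplex f, toComplex_eq_fourierInv hf] with x h1 h2
  rw [h1] at h2
  rw [← Real.norm_eq_abs, ← Complex.norm_real, h2]
  exact (VectorFourier.norm_fourierIntegral_le_integral_norm _ _ _ _ _).trans
    (integral_norm_fourierL2_le hf)

/-! ### Products -/

theorem memLp_mul {f g : RealL2} (hf : f ∈ sobolevSubmodule 1) :
    MemLp (fun x => f x * g x) 2 (volume : Measure ℝ) := by
  refine (Lp.memLp g).of_le_mul (c := embConst * sobolevNorm 1 f)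
    ((Lp.aestronglyMeasurable f).mul (Lp.aestronglyMeasurable g)) ?_
  filter_upwards [ae_abs_le hf] with x hx
  rw [norm_mul]
  exact mul_le_mul_of_nonneg_right hx (norm_nonneg _)

theorem coeFn_mul {f g : RealL2} (hf : f ∈ sobolevSubmodule 1) :
    mul f g =ᵐ[volume] fun x => f x * g x := by
  rw [mul, dif_pos (memLp_mul hf)]
  exact MemLp.coeFn_toLp _

theorem mul_comm' (f g : RealL2) : mul f g = mul g f := by
  have h : (fun x => f x * g x) = fun x => g x * f x := funext fun x => _root_.mul_comm _ _
  unfold mul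
  rw [h]

theorem norm_mul_le' {f g : RealL2} (hf : f ∈ sobolevSubmodule 1) :
    ‖mul f g‖ ≤ embConst * sobolevNorm 1 f * ‖g‖ := by
  refine Lp.norm_le_mul_norm_of_ae_le_mul ?_
  filter_upwards [ae_abs_le hf, coeFn_mul (g := g) hf] with x hx h
  rw [h, norm_mul]
  exact mul_le_mul_of_nonneg_right hx (norm_nonneg _)

theorem inner_mul_left {f g h : RealL2} (hf : f ∈ sobolevSubmodule 1) :
    inner ℝ (mul f g) h = inner ℝ g (mul f h) := by
  rw [L2.inner_def, L2.inner_def]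
  refine integral_congr_ae ?_
  filter_upwards [coeFn_mul (g := g) hf, coeFn_mul (g := h) hf] with x h1 h2
  rw [h1, h2]
  simp only [RCLike.inner_apply, conj_trivial]
  ring

/-- As `f` and `g` are real-valued, a complex test function may be split into its real and imaginary
parts. The real form is convenient for the product rule. -/
theorem integral_schwartz_eq_iff (f g : RealL2) :
    IsDistribDeriv f g ↔ ∀ φ : SchwartzMap ℝ ℝ,
      ∫ x, φ x * g x = -∫ x, deriv φ x * f x := by
  have hint : ∀ (φ : SchwartzMap ℝ ℂ) (h : RealL2), Integrable (fun x => φ x * (h x : ℂ)) volume :=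
    fun φ h => (φ.memLp 2).integrable_mul (Lp.memLp h).ofReal
  have hC : IsDistribDeriv f g ↔ ∀ φ : SchwartzMap ℝ ℂ,
      ∫ x, φ x * (g x : ℂ) = -∫ x, deriv φ x * (f x : ℂ) := by
    rw [IsDistribDeriv, DFunLike.ext_iff]
    refine forall_congr' fun φ => ?_
    rw [TemperedDistribution.derivCLM_apply_apply, Lp.toTemperedDistribution_apply,
      Lp.toTemperedDistribution_apply, eq_comm]
    have e1 : ∫ x, φ x • toComplex g x = ∫ x, φ x * (g x : ℂ) := by
      refine integral_congr_ae ?_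
      filter_upwards [coeFn_toComplex g] with x h
      rw [h, smul_eq_mul]
    have e2 : ∫ x, (-SchwartzMap.derivCLM ℂ ℂ φ) x • toComplex f x =
        -∫ x, deriv φ x * (f x : ℂ) := by
      rw [← integral_neg]
      refine integral_congr_ae ?_
      filter_upwards [coeFn_toComplex f] with x h
      simp [h]
    rw [← e1, ← e2]
  rw [hC]
  constructor
  · intro h φ
    have := h (SchwartzMap.postcompCLM (𝕜 := ℝ) Complex.ofRealCLM φ)
    have hd : ∀ x, deriv (SchwartzMap.postcompCLM (𝕜 := ℝ) Complex.ofRealCLM φ) x =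
        ((deriv φ x : ℝ) : ℂ) := fun x => by
      have := (φ.differentiableAt (x := x)).hasDerivAt.ofReal_comp
      exact this.deriv
    simp only [hd, SchwartzMap.postcompCLM_apply, Complex.ofRealCLM_apply] at this
    rw [← Complex.ofReal_inj, Complex.ofReal_neg, ← integral_complex_ofReal,
      ← integral_complex_ofReal]
    push_cast
    exact this
  · intro h φ
    set φ₁ := SchwartzMap.postcompCLM (𝕜 := ℝ) Complex.reCLM φ
    set φ₂ := SchwartzMap.postcompCLM (𝕜 := ℝ) Complex.imCLM φ
    have hd1 : ∀ x, deriv φ₁ x = (deriv φ x).re := fun x =>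
      (Complex.reCLM.hasFDerivAt.comp_hasDerivAt x (φ.differentiableAt (x := x)).hasDerivAt).deriv
    have hd2 : ∀ x, deriv φ₂ x = (deriv φ x).im := fun x =>
      (Complex.imCLM.hasFDerivAt.comp_hasDerivAt x (φ.differentiableAt (x := x)).hasDerivAt).deriv
    have h1 := h φ₁
    have h2 := h φ₂
    have hi1 := hint φ g
    have hi2 := hint (SchwartzMap.derivCLM ℂ ℂ φ) f
    simp only [SchwartzMap.derivCLM_apply] at hi2
    apply Complex.ext
    · rw [Complex.neg_re]
      have a1 := integral_re hi1
      have a2 := integral_re hi2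
      simp only [RCLike.re_to_complex] at a1 a2
      rw [← a1, ← a2]
      simpa [hd1, φ₁] using h1
    · rw [Complex.neg_im]
      have a1 := integral_im hi1
      have a2 := integral_im hi2
      simp only [RCLike.im_to_complex] at a1 a2
      rw [← a1, ← a2]
      simpa [hd2, φ₂] using h2

theorem memLp_schwartz_mul (φ : SchwartzMap ℝ ℝ) (g : RealL2) :
    MemLp (fun x => φ x * g x) 2 (volume : Measure ℝ) := by
  refine (Lp.memLp g).of_le_mul (c := SchwartzMap.seminorm ℝ 0 0 φ)
    (φ.continuous.aestronglyMeasurable.mul (Lp.aestronglyMeasurable g)) ?_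
  refine Filter.Eventually.of_forall fun x => ?_
  rw [norm_mul]
  exact mul_le_mul_of_nonneg_right (φ.norm_le_seminorm ℝ x) (norm_nonneg _)

theorem isDistribDeriv_schwartz_mul (φ : SchwartzMap ℝ ℝ) {g : RealL2}
    (hg : g ∈ sobolevSubmodule 1) :
    IsDistribDeriv (memLp_schwartz_mul φ g).toLp
      ((memLp_schwartz_mul (SchwartzMap.derivCLM ℝ ℝ φ) g).toLp +
        (memLp_schwartz_mul φ (dx g)).toLp) := by
  rw [integral_schwartz_eq_iff]
  intro ψ
  -- The derivative of `g` is tested against the product `φ ψ`, itself a Schwartz function.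
  have h := (integral_schwartz_eq_iff g (dx g)).1 (isDistribDeriv_dx hg)
    (SchwartzMap.pairing (ContinuousLinearMap.mul ℝ ℝ) φ ψ)
  have hd : ∀ x, deriv (SchwartzMap.pairing (ContinuousLinearMap.mul ℝ ℝ) φ ψ) x =
      deriv φ x * ψ x + φ x * deriv ψ x := fun x => by
    have := (φ.differentiableAt (x := x)).hasDerivAt.mul (ψ.differentiableAt (x := x)).hasDerivAt
    refine Eq.trans ?_ this.deriv
    congr 1
  simp only [hd, SchwartzMap.pairing_apply_apply, ContinuousLinearMap.mul_apply'] at h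
  have i1 : Integrable (fun x => ψ x * (deriv φ x * g x)) volume :=
    (ψ.memLp 2).integrable_mul (memLp_schwartz_mul (SchwartzMap.derivCLM ℝ ℝ φ) g)
  have i2 : Integrable (fun x => ψ x * (φ x * dx g x)) volume :=
    (ψ.memLp 2).integrable_mul (memLp_schwartz_mul φ (dx g))
  have i3 : Integrable (fun x => deriv ψ x * (φ x * g x)) volume :=
    ((SchwartzMap.derivCLM ℝ ℝ ψ).memLp 2).integrable_mul (memLp_schwartz_mul φ g)
  have e1 : ∫ x, ψ x * ((memLp_schwartz_mul (SchwartzMap.derivCLM ℝ ℝ φ) g).toLp +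
        (memLp_schwartz_mul φ (dx g)).toLp : RealL2) x =
      ∫ x, (ψ x * (deriv φ x * g x) + ψ x * (φ x * dx g x)) := by
    refine integral_congr_ae ?_
    filter_upwards [Lp.coeFn_add (memLp_schwartz_mul (SchwartzMap.derivCLM ℝ ℝ φ) g).toLp
        (memLp_schwartz_mul φ (dx g)).toLp,
      (memLp_schwartz_mul (SchwartzMap.derivCLM ℝ ℝ φ) g).coeFn_toLp,
      (memLp_schwartz_mul φ (dx g)).coeFn_toLp] with x h1 h2 h3
    rw [h1, Pi.add_apply, h2, h3, SchwartzMap.derivCLM_apply]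
    ring
  have e2 : ∫ x, deriv ψ x * ((memLp_schwartz_mul φ g).toLp _ : RealL2) x =
      ∫ x, deriv ψ x * (φ x * g x) := by
    refine integral_congr_ae ?_
    filter_upwards [(memLp_schwartz_mul φ g).coeFn_toLp] with x h1
    rw [h1]
  have e3 : ∫ x, (deriv φ x * ψ x + φ x * deriv ψ x) * g x =
      ∫ x, (ψ x * (deriv φ x * g x) + deriv ψ x * (φ x * g x)) := by
    congr 1; ext x; ring
  have e4 : ∫ x, φ x * ψ x * dx g x = ∫ x, ψ x * (φ x * dx g x) := by
    congr 1; ext x; ring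
  rw [e3, e4, integral_add i1 i3] at h
  rw [e1, e2, integral_add i1 i2, h]
  ring

/-- For a test function `φ` the function `φ g` is in H¹ with the expected derivative, so `f` can be
integrated by parts against it. Thus the product rule for two H¹ functions comes from the rule with
one Schwartz factor, without approximation. -/
theorem isDistribDeriv_mul {f g : RealL2} (hf : f ∈ sobolevSubmodule 1)
    (hg : g ∈ sobolevSubmodule 1) :
    IsDistribDeriv (mul f g) (mul (dx f) g + mul f (dx g)) := by
  rw [integral_schwartz_eq_iff]
  intro φ
  have hd := isDistribDeriv_schwartz_mul φ hg
  have h := inner_dx_left hf (hd.mem_sobolev (mem_sobolev_zero _) (mem_sobolev_zero _))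
  rw [hd.dx_eq, inner_add_right, L2.inner_def, L2.inner_def, L2.inner_def] at h
  have e1 : ∫ x, φ x * (mul (dx f) g + mul f (dx g)) x =
      ∫ x, (g x * dx f x * φ x + φ x * dx g x * f x) := by
    refine integral_congr_ae ?_
    have hc := coeFn_mul (g := dx f) hg
    rw [mul_comm' g (dx f)] at hc
    filter_upwards [Lp.coeFn_add (mul (dx f) g) (mul f (dx g)), hc, coeFn_mul (g := dx g) hf]
      with x h1 h2 h3
    rw [h1, Pi.add_apply, h2, h3]
    ring
  have e2 : ∫ x, deriv φ x * mul f g x = ∫ x, deriv φ x * g x * f x := by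
    refine integral_congr_ae ?_
    filter_upwards [coeFn_mul (g := g) hf] with x h
    rw [h]
    ring
  have c1 : ∫ x, inner ℝ (dx f x) (((memLp_schwartz_mul φ g).toLp _ : RealL2) x) =
      ∫ x, g x * dx f x * φ x := by
    refine integral_congr_ae ?_
    filter_upwards [(memLp_schwartz_mul φ g).coeFn_toLp] with x h
    rw [h]
    simp only [RCLike.inner_apply, conj_trivial]
    ring
  have c2 : ∫ x, inner ℝ (f x) (((memLp_schwartz_mul (SchwartzMap.derivCLM ℝ ℝ φ) g).toLp _ : RealL2) x) =
      ∫ x, deriv φ x * g x * f x := by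
    refine integral_congr_ae ?_
    filter_upwards [(memLp_schwartz_mul (SchwartzMap.derivCLM ℝ ℝ φ) g).coeFn_toLp] with x h
    rw [h, SchwartzMap.derivCLM_apply]
    simp only [RCLike.inner_apply, conj_trivial]
  have c3 : ∫ x, inner ℝ (f x) (((memLp_schwartz_mul φ (dx g)).toLp _ : RealL2) x) =
      ∫ x, φ x * dx g x * f x := by
    refine integral_congr_ae ?_
    filter_upwards [(memLp_schwartz_mul φ (dx g)).coeFn_toLp] with x h
    rw [h]
    simp only [RCLike.inner_apply, conj_trivial]
  have i1 : Integrable (fun x => g x * dx f x * φ x) volume := by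
    refine ((Lp.memLp (dx f)).integrable_mul (memLp_schwartz_mul φ g)).congr
      (Filter.Eventually.of_forall fun x => ?_)
    simp only [Pi.mul_apply]
    ring
  have i2 : Integrable (fun x => φ x * dx g x * f x) volume :=
    (memLp_schwartz_mul φ (dx g)).integrable_mul (Lp.memLp f)
  rw [c1, c2, c3] at h
  rw [e1, e2, integral_add i1 i2, h]
  ring

theorem mul_mem_sobolev_one {f g : RealL2} (hf : f ∈ sobolevSubmodule 1)
    (hg : g ∈ sobolevSubmodule 1) : mul f g ∈ sobolevSubmodule 1 :=
  (isDistribDeriv_mul hf hg).mem_sobolev (mem_sobolev_zero _) (mem_sobolev_zero _)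

theorem dx_mul {f g : RealL2} (hf : f ∈ sobolevSubmodule 1) (hg : g ∈ sobolevSubmodule 1) :
    dx (mul f g) = mul (dx f) g + mul f (dx g) :=
  (isDistribDeriv_mul hf hg).dx_eq

theorem mul_mem_sobolev {s : ℕ} (hs : 1 ≤ s) {f g : RealL2} (hf : f ∈ sobolevSubmodule s)
    (hg : g ∈ sobolevSubmodule s) : mul f g ∈ sobolevSubmodule s := by
  induction s, hs using Nat.le_induction generalizing f g with
  | base => exact mul_mem_sobolev_one hf hg
  | succ s hs ih =>
    have hf' := mem_sobolev_of_le (Nat.le_succ s) hf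
    have hg' := mem_sobolev_of_le (Nat.le_succ s) hg
    exact (isDistribDeriv_mul (mem_sobolev_of_le hs hf') (mem_sobolev_of_le hs hg')).mem_sobolev
      (ih hf' hg') (add_mem (ih (dx_mem_sobolev hf) hg') (ih hf' (dx_mem_sobolev hg)))

/-! ### Product estimates -/

theorem sobolevNorm_succ_le {s : ℕ} {f : RealL2} (hf : f ∈ sobolevSubmodule (s + 1)) :
    sobolevNorm (s + 1) f ≤ sobolevNorm s f + sobolevNorm s (dx f) := by
  have h0 := sobolevNorm_nonneg s f
  have h1 := sobolevNorm_nonneg s (dx f)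
  refine le_of_sq_le_sq ?_ (by positivity)
  rw [sobolevNorm_succ_sq hf]
  nlinarith

theorem norm_le_sobolevNorm {s : ℕ} {f : RealL2} (hf : f ∈ sobolevSubmodule s) :
    ‖f‖ ≤ sobolevNorm s f := by
  rw [← sobolevNorm_zero]
  exact sobolevNorm_mono (Nat.zero_le s) hf

theorem sobolevNorm_one_mul_le {f g : RealL2} (hf : f ∈ sobolevSubmodule 1)
    (hg : g ∈ sobolevSubmodule 1) :
    sobolevNorm 1 (mul f g) ≤ 3 * embConst * (sobolevNorm 1 f * sobolevNorm 1 g) := by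
  have hm := mul_mem_sobolev_one hf hg
  have h := sobolevNorm_succ_le (s := 0) hm
  rw [sobolevNorm_zero, sobolevNorm_zero, dx_mul hf hg] at h
  have h0 := norm_add_le (mul (dx f) g) (mul f (dx g))
  have h1 := norm_mul_le' (g := g) hf
  have h2 := norm_mul_le' (g := dx g) hf
  have h3 := norm_mul_le' (g := dx f) hg
  rw [mul_comm' g] at h3
  have hfd : ‖dx f‖ ≤ sobolevNorm 1 f := by
    rw [← sobolevNorm_zero]; exact sobolevNorm_dx_le (s := 0) hf
  have hgd : ‖dx g‖ ≤ sobolevNorm 1 g := by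
    rw [← sobolevNorm_zero]; exact sobolevNorm_dx_le (s := 0) hg
  have hgn := norm_le_sobolevNorm hg
  have hc := embConst_nonneg
  have nf := sobolevNorm_nonneg 1 f
  have ng := sobolevNorm_nonneg 1 g
  have k1 := mul_le_mul_of_nonneg_left hgn (mul_nonneg hc nf)
  have k2 := mul_le_mul_of_nonneg_left hgd (mul_nonneg hc nf)
  have k3 := mul_le_mul_of_nonneg_left hfd (mul_nonneg hc ng)
  linarith

/-- Tame form of the algebra property: in each summand only one factor carries the H² norm. The H¹
norm on the other factor is what later lowers the order of a derivative by one. -/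
theorem sobolevNorm_two_mul_le {f g : RealL2} (hf : f ∈ sobolevSubmodule 2)
    (hg : g ∈ sobolevSubmodule 2) :
    sobolevNorm 2 (mul f g) ≤ 6 * embConst *
      (sobolevNorm 2 f * sobolevNorm 1 g + sobolevNorm 1 f * sobolevNorm 2 g) := by
  have hf1 := mem_sobolev_of_le one_le_two hf
  have hg1 := mem_sobolev_of_le one_le_two hg
  have hfd := dx_mem_sobolev hf
  have hgd := dx_mem_sobolev hg
  have h := sobolevNorm_succ_le (s := 1) (mul_mem_sobolev one_le_two hf hg)
  rw [dx_mul hf1 hg1] at h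
  have h0 := sobolevNorm_add_le (mul_mem_sobolev_one hfd hg1) (mul_mem_sobolev_one hf1 hgd)
  have h1 := sobolevNorm_one_mul_le hf1 hg1
  have h2 := sobolevNorm_one_mul_le hfd hg1
  have h3 := sobolevNorm_one_mul_le hf1 hgd
  have hc := embConst_nonneg
  have nf := sobolevNorm_nonneg 1 f
  have ng := sobolevNorm_nonneg 1 g
  have k1 := mul_le_mul_of_nonneg_right (sobolevNorm_mono one_le_two hf) ng
  have k2 := mul_le_mul_of_nonneg_right (sobolevNorm_dx_le (s := 1) hf) ng
  have k3 := mul_le_mul_of_nonneg_left (sobolevNorm_dx_le (s := 1) hg) nf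
  have p := mul_nonneg nf (sobolevNorm_nonneg 2 g)
  have k : sobolevNorm 1 f * sobolevNorm 1 g + sobolevNorm 1 (dx f) * sobolevNorm 1 g +
      sobolevNorm 1 f * sobolevNorm 1 (dx g) ≤
      2 * (sobolevNorm 2 f * sobolevNorm 1 g + sobolevNorm 1 f * sobolevNorm 2 g) := by
    simp only [Nat.reduceAdd] at k2 k3
    linarith
  have k' := mul_le_mul_of_nonneg_left k (mul_nonneg (by norm_num : (0 : ℝ) ≤ 3) hc)
  simp only [Nat.reduceAdd] at h
  linarith

theorem sobolevNorm_two_mul_le' {f g : RealL2} (hf : f ∈ sobolevSubmodule 2)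
    (hg : g ∈ sobolevSubmodule 2) :
    sobolevNorm 2 (mul f g) ≤ 12 * embConst * (sobolevNorm 2 f * sobolevNorm 2 g) := by
  have h := sobolevNorm_two_mul_le hf hg
  have k1 := mul_le_mul_of_nonneg_left (sobolevNorm_mono one_le_two hg) (sobolevNorm_nonneg 2 f)
  have k2 := mul_le_mul_of_nonneg_right (sobolevNorm_mono one_le_two hf) (sobolevNorm_nonneg 2 g)
  have k := mul_le_mul_of_nonneg_left (add_le_add k1 k2)
    (mul_nonneg (by norm_num : (0 : ℝ) ≤ 6) embConst_nonneg)
  linarith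

/-! ### The inner product of `H²` -/

/-- The inner product of `H²`. -/
def inner₂ (f g : RealL2) : ℝ :=
  inner ℝ f g + 2 * inner ℝ (dx f) (dx g) + inner ℝ (dx (dx f)) (dx (dx g))

theorem inner₂_self {f : RealL2} (hf : f ∈ sobolevSubmodule 2) :
    inner₂ f f = sobolevNorm 2 f ^ 2 := by
  rw [sobolevNorm_succ_sq (s := 1) hf,
    sobolevNorm_succ_sq (s := 0) (mem_sobolev_of_le one_le_two hf),
    sobolevNorm_succ_sq (s := 0) (dx_mem_sobolev hf), sobolevNorm_zero, sobolevNorm_zero,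
    sobolevNorm_zero, inner₂, real_inner_self_eq_norm_sq, real_inner_self_eq_norm_sq,
    real_inner_self_eq_norm_sq]
  ring

theorem norm_dx_le {f : RealL2} (hf : f ∈ sobolevSubmodule 2) : ‖dx f‖ ≤ sobolevNorm 2 f :=
  (norm_le_sobolevNorm (dx_mem_sobolev hf)).trans (sobolevNorm_dx_le hf)

theorem norm_dx_dx_le {f : RealL2} (hf : f ∈ sobolevSubmodule 2) :
    ‖dx (dx f)‖ ≤ sobolevNorm 2 f := by
  rw [← sobolevNorm_zero]
  exact (sobolevNorm_dx_le (s := 0) (dx_mem_sobolev hf)).trans (sobolevNorm_dx_le hf)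

theorem abs_inner_le_mul {f g : RealL2} {a b : ℝ} (hf : ‖f‖ ≤ a) (hg : ‖g‖ ≤ b) :
    |inner ℝ f g| ≤ a * b :=
  (abs_real_inner_le_norm f g).trans
    (mul_le_mul hf hg (norm_nonneg _) ((norm_nonneg _).trans hf))

theorem abs_inner₂_le {f g : RealL2} (hf : f ∈ sobolevSubmodule 2) (hg : g ∈ sobolevSubmodule 2) :
    |inner₂ f g| ≤ 4 * (sobolevNorm 2 f * sobolevNorm 2 g) := by
  have h0 := abs_inner_le_mul (norm_le_sobolevNorm hf) (norm_le_sobolevNorm hg)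
  have h1 := abs_inner_le_mul (norm_dx_le hf) (norm_dx_le hg)
  have h2 := abs_inner_le_mul (norm_dx_dx_le hf) (norm_dx_dx_le hg)
  rw [inner₂, abs_le]
  rw [abs_le] at h0 h1 h2
  constructor <;> linarith [h0.1, h0.2, h1.1, h1.2, h2.1, h2.2]

theorem inner₂_add_right {f g h : RealL2} (hg : g ∈ sobolevSubmodule 2)
    (hh : h ∈ sobolevSubmodule 2) : inner₂ f (g + h) = inner₂ f g + inner₂ f h := by
  rw [inner₂, dx_add (mem_sobolev_of_le one_le_two hg) (mem_sobolev_of_le one_le_two hh),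
    dx_add (dx_mem_sobolev hg) (dx_mem_sobolev hh), inner_add_right, inner_add_right,
    inner_add_right, inner₂, inner₂]
  ring

theorem inner₂_smul_right (c : ℝ) {f g : RealL2} (hg : g ∈ sobolevSubmodule 2) :
    inner₂ f (c • g) = c * inner₂ f g := by
  rw [inner₂, dx_smul c (mem_sobolev_of_le one_le_two hg), dx_smul c (dx_mem_sobolev hg),
    inner_smul_right, inner_smul_right, inner_smul_right, inner₂]
  ring

/-- Integrating `u (z²)' / 2` by parts moves the derivative from `z` to `u`. -/
theorem inner_mul_dx_self {u z : RealL2} (hu : u ∈ sobolevSubmodule 2)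
    (hz : z ∈ sobolevSubmodule 1) :
    inner ℝ z (mul u (dx z)) = -(1 / 2) * inner ℝ z (mul (dx u) z) := by
  have hu1 := mem_sobolev_of_le one_le_two hu
  have h := inner_dx_left (mul_mem_sobolev_one hu1 hz) hz
  rw [dx_mul hu1 hz, inner_add_left, inner_mul_left hu1, inner_mul_left hu1,
    inner_mul_left (dx_mem_sobolev hu), real_inner_comm (mul u z), inner_mul_left hu1] at h
  linarith

/-- Integration by parts in the transport term: no derivative of `w` of order three is needed. -/
theorem abs_inner₂_transport_le {u w : RealL2} (hu : u ∈ sobolevSubmodule 3)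
    (hw : w ∈ sobolevSubmodule 3) :
    |inner₂ w (mul u (dx w))| ≤ 10 * embConst * (sobolevNorm 3 u * sobolevNorm 2 w ^ 2) := by
  have hu2 := mem_sobolev_of_le (show 2 ≤ 3 by norm_num) hu
  have hu1 := mem_sobolev_of_le one_le_two hu2
  have hw2 := mem_sobolev_of_le (show 2 ≤ 3 by norm_num) hw
  have du2 : dx u ∈ sobolevSubmodule 2 := dx_mem_sobolev hu
  have du1 := mem_sobolev_of_le one_le_two du2
  have ddu1 : dx (dx u) ∈ sobolevSubmodule 1 := dx_mem_sobolev du2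
  have dw2 : dx w ∈ sobolevSubmodule 2 := dx_mem_sobolev hw
  have dw1 := mem_sobolev_of_le one_le_two dw2
  have ddw1 : dx (dx w) ∈ sobolevSubmodule 1 := dx_mem_sobolev dw2
  have e1 : dx (mul u (dx w)) = mul (dx u) (dx w) + mul u (dx (dx w)) := dx_mul hu1 dw1
  have e2 : dx (dx (mul u (dx w))) = (mul (dx (dx u)) (dx w) + mul (dx u) (dx (dx w))) +
      (mul (dx u) (dx (dx w)) + mul u (dx (dx (dx w)))) := by
    rw [e1, dx_add (mul_mem_sobolev_one du1 dw1) (mul_mem_sobolev_one hu1 ddw1), dx_mul du1 dw1,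
      dx_mul hu1 ddw1]
  set S := sobolevNorm 3 u with hS
  set W := sobolevNorm 2 w with hW
  have hc := embConst_nonneg
  have bound : ∀ {f g h : RealL2}, f ∈ sobolevSubmodule 1 → sobolevNorm 1 f ≤ S → ‖g‖ ≤ W →
      ‖h‖ ≤ W → |inner ℝ h (mul f g)| ≤ embConst * (S * W ^ 2) := by
    intro f g h hf hfS hg hh
    have h1 : ‖mul f g‖ ≤ embConst * S * W :=
      (norm_mul_le' hf).trans (mul_le_mul (mul_le_mul_of_nonneg_left hfS hc) hg (norm_nonneg _)
        (mul_nonneg hc (sobolevNorm_nonneg _ _)))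
    refine (abs_inner_le_mul hh h1).trans (le_of_eq ?_)
    ring
  have s0 : sobolevNorm 1 u ≤ S := sobolevNorm_mono (by norm_num) hu
  have s1 : sobolevNorm 1 (dx u) ≤ S :=
    (sobolevNorm_mono one_le_two du2).trans (sobolevNorm_dx_le (s := 2) hu)
  have s2 : sobolevNorm 1 (dx (dx u)) ≤ S :=
    (sobolevNorm_dx_le (s := 1) du2).trans (sobolevNorm_dx_le (s := 2) hu)
  have w0 : ‖w‖ ≤ W := norm_le_sobolevNorm hw2
  have w1 := norm_dx_le hw2
  have w2 := norm_dx_dx_le hw2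
  have b1 := bound hu1 s0 w1 w0
  have b2 := bound du1 s1 w1 w1
  have b3 := bound hu1 s0 w2 w1
  have b4 := bound ddu1 s2 w1 w2
  have b5 := bound du1 s1 w2 w2
  -- The only term with three derivatives of `w` is `⟨w'', u w'''⟩`; it becomes `-½ ⟨w'', u' w''⟩`,
  -- already covered by `b5`.
  have b6 := inner_mul_dx_self hu2 ddw1
  rw [inner₂, e2, e1]
  simp only [inner_add_right]
  rw [b6]
  rw [abs_le] at *
  constructor <;> linarith [b1.1, b1.2, b2.1, b2.2, b3.1, b3.2, b4.1, b4.2, b5.1, b5.2]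

/-! ### The Leibniz formula -/

theorem iterDx_mul_antidiagonal {n : ℕ} {f g : RealL2} (hf : f ∈ sobolevSubmodule (n + 1))
    (hg : g ∈ sobolevSubmodule (n + 1)) :
    iterDx n (mul f g) = ∑ ij ∈ Finset.HasAntidiagonal.antidiagonal n,
      n.choose ij.1 • mul (iterDx ij.1 f) (iterDx ij.2 g) := by
  induction n generalizing f g with
  | zero => simp [iterDx_zero]
  | succ n ih =>
    have hf' := mem_sobolev_of_le (Nat.le_succ (n + 1)) hf
    have hg' := mem_sobolev_of_le (Nat.le_succ (n + 1)) hg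
    have hf1 := mem_sobolev_of_le (Nat.le_add_left 1 n) hf'
    have hg1 := mem_sobolev_of_le (Nat.le_add_left 1 n) hg'
    rw [iterDx_succ', dx_mul hf1 hg1, iterDx_add
      (mem_sobolev_of_le n.le_succ (mul_mem_sobolev (by omega) (dx_mem_sobolev hf) hg'))
      (mem_sobolev_of_le n.le_succ (mul_mem_sobolev (by omega) hf' (dx_mem_sobolev hg))),
      ih (dx_mem_sobolev hf) hg', ih hf' (dx_mem_sobolev hg),
      Finset.sum_antidiagonal_choose_succ_nsmul (fun i j => mul (iterDx i f) (iterDx j g)),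
      add_comm]
    congr 1
    refine Finset.sum_congr rfl fun ij hij => ?_
    rw [Finset.HasAntidiagonal.mem_antidiagonal] at hij
    rw [← iterDx_succ', Nat.choose_symm_of_eq_add (show n = ij.2 + ij.1 by omega)]

/-- The two extreme Leibniz terms are split off because they need separate treatment: in the
transport terms the first one carries more derivatives than the estimate may use. -/
theorem iterDx_succ_mul {r : ℕ} {f g : RealL2} (hf : f ∈ sobolevSubmodule (r + 2))
    (hg : g ∈ sobolevSubmodule (r + 2)) :
    iterDx (r + 1) (mul f g) = mul f (iterDx (r + 1) g) + mul (iterDx (r + 1) f) g +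
      ∑ t ∈ Finset.range r, ((r + 1).choose (t + 1) : ℝ) •
        mul (iterDx (t + 1) f) (iterDx (r - t) g) := by
  rw [iterDx_mul_antidiagonal hf hg, Finset.Nat.sum_antidiagonal_eq_sum_range_succ_mk,
    Finset.sum_range_succ, Finset.sum_range_succ']
  simp only [Nat.choose_self, Nat.choose_zero_right, one_smul, iterDx_zero, Nat.sub_self,
    Nat.sub_zero, Nat.add_sub_add_right, Nat.cast_smul_eq_nsmul]
  abel

/-! ### Estimates of the derivatives of products -/

/-- Trades one Sobolev index for one derivative; this shift by one produces every gain in the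
Leibniz sums. -/
theorem sobolevNorm_one_iterDx_succ_le {k : ℕ} {f : RealL2} (hf : f ∈ sobolevSubmodule (k + 2)) :
    sobolevNorm 1 (iterDx (k + 1) f) ≤ sobolevNorm 2 (iterDx k f) := by
  rw [iterDx_succ]
  exact sobolevNorm_dx_le (iterDx_mem_sobolev k (mem_sobolev_of_le (by omega) hf))

theorem sobolevNorm_sum_smul_le {s r : ℕ} {a : ℕ → ℝ} {g : ℕ → RealL2} (ha : ∀ t, 0 ≤ a t)
    (hg : ∀ t < r, g t ∈ sobolevSubmodule s) :
    sobolevNorm s (∑ t ∈ Finset.range r, a t • g t) ≤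
      ∑ t ∈ Finset.range r, a t * sobolevNorm s (g t) := by
  induction r with
  | zero =>
    rw [Finset.sum_range_zero, Finset.sum_range_zero]
    have := sobolevNorm_smul 0 (zero_mem (sobolevSubmodule s))
    rw [zero_smul, abs_zero, zero_mul] at this
    exact this.le
  | succ r ih =>
    rw [Finset.sum_range_succ, Finset.sum_range_succ]
    have h1 : ∑ t ∈ Finset.range r, a t • g t ∈ sobolevSubmodule s :=
      sum_mem fun t ht => Submodule.smul_mem _ _ (hg t (by rw [Finset.mem_range] at ht; omega))
    have h2 := hg r (Nat.lt_succ_self r)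
    refine (sobolevNorm_add_le h1 (Submodule.smul_mem _ _ h2)).trans (add_le_add
      (ih fun t ht => hg t (by omega)) ?_)
    rw [sobolevNorm_smul _ h2, abs_of_nonneg (ha r)]

theorem sobolevNorm_one_iterDx_mul_self_le {r : ℕ} {f : RealL2}
    (hf : f ∈ sobolevSubmodule (r + 2)) :
    sobolevNorm 1 (iterDx (r + 1) (mul f f)) ≤ 3 * embConst *
      (2 * (sobolevNorm 1 f * sobolevNorm 1 (iterDx (r + 1) f)) +
        ∑ t ∈ Finset.range r, ((r + 1).choose (t + 1) : ℝ) *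
          (sobolevNorm 1 (iterDx (t + 1) f) * sobolevNorm 1 (iterDx (r - t) f))) := by
  have h1 : ∀ k ≤ r + 1, iterDx k f ∈ sobolevSubmodule 1 := fun k hk =>
    iterDx_mem_sobolev k (mem_sobolev_of_le (by omega) hf)
  have h0 : f ∈ sobolevSubmodule 1 := h1 0 (by omega)
  have hr := h1 (r + 1) le_rfl
  have hg : ∀ t < r, mul (iterDx (t + 1) f) (iterDx (r - t) f) ∈ sobolevSubmodule 1 := fun t ht =>
    mul_mem_sobolev_one (h1 _ (by omega)) (h1 _ (by omega))
  rw [iterDx_succ_mul hf hf]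
  have hs := sobolevNorm_sum_smul_le (a := fun t => ((r + 1).choose (t + 1) : ℝ))
    (fun t => Nat.cast_nonneg _) hg
  have hm := mul_mem_sobolev_one h0 hr
  have hm' := mul_mem_sobolev_one hr h0
  have b0 := sobolevNorm_add_le (add_mem hm hm') (sum_mem fun t ht => Submodule.smul_mem _
    ((r + 1).choose (t + 1) : ℝ) (hg t (Finset.mem_range.1 ht)))
  have b1 := sobolevNorm_add_le hm hm'
  have b2 := sobolevNorm_one_mul_le h0 hr
  have b3 := sobolevNorm_one_mul_le hr h0
  have b4 : ∑ t ∈ Finset.range r, ((r + 1).choose (t + 1) : ℝ) *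
        sobolevNorm 1 (mul (iterDx (t + 1) f) (iterDx (r - t) f)) ≤
      3 * embConst * ∑ t ∈ Finset.range r, ((r + 1).choose (t + 1) : ℝ) *
          (sobolevNorm 1 (iterDx (t + 1) f) * sobolevNorm 1 (iterDx (r - t) f)) := by
    rw [Finset.mul_sum]
    refine Finset.sum_le_sum fun t ht => ?_
    rw [Finset.mem_range] at ht
    have := mul_le_mul_of_nonneg_left (sobolevNorm_one_mul_le (h1 (t + 1) (by omega))
      (h1 (r - t) (by omega))) (Nat.cast_nonneg (α := ℝ) ((r + 1).choose (t + 1)))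
    linarith
  linarith

/-- The bound for the intermediate terms in the Leibniz formula for `u²` and `uₓ²`. -/
def leibnizSqBound (S : ℝ) (U : ℕ → ℝ) (r : ℕ) : ℝ :=
  if r = 1 then S * U 1
  else ∑ t ∈ Finset.range r, ((r + 1).choose (t + 1) : ℝ) * (U (t + 1) * U (r - t))

/-- For `r = 1` the only summand has both factors of order one, and its coefficient 2 is the factor
on the right. One of the two is bounded by `S`, since this is the product on which the convolution
estimate fails. For other `r` the factors are simply replaced by their bounds. -/
theorem sum_choose_le_leibnizSqBound {S : ℝ} {U a : ℕ → ℝ} {b : ℕ → ℝ} {r : ℕ}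
    (ha0 : ∀ t, 0 ≤ a t) (hU : ∀ t, 0 ≤ U t) (ha : ∀ t < r, a (t + 1) ≤ U (t + 1))
    (hb0 : ∀ t, 0 ≤ b t) (hb : ∀ t < r, b (r - t) ≤ U (r - t)) (hS : r = 1 → b 1 ≤ S)
    (hU1 : 0 ≤ S) :
    ∑ t ∈ Finset.range r, ((r + 1).choose (t + 1) : ℝ) * (a (t + 1) * b (r - t)) ≤
      2 * leibnizSqBound S U r := by
  rw [leibnizSqBound]
  split_ifs with h
  · subst h
    rw [Finset.sum_range_one]
    have h1 := ha 0 one_pos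
    have h2 := hS rfl
    have h3 := mul_le_mul h2 h1 (ha0 _) hU1
    norm_num at h3 ⊢
    linarith
  · have hle : ∑ t ∈ Finset.range r, ((r + 1).choose (t + 1) : ℝ) * (a (t + 1) * b (r - t)) ≤
        ∑ t ∈ Finset.range r, ((r + 1).choose (t + 1) : ℝ) * (U (t + 1) * U (r - t)) := by
      refine Finset.sum_le_sum fun t ht => ?_
      rw [Finset.mem_range] at ht
      exact mul_le_mul_of_nonneg_left (mul_le_mul (ha t ht) (hb t ht) (hb0 _) (hU _))
        (Nat.cast_nonneg _)
    have hnn : 0 ≤ ∑ t ∈ Finset.range r, ((r + 1).choose (t + 1) : ℝ) * (U (t + 1) * U (r - t)) :=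
      Finset.sum_nonneg fun t _ => mul_nonneg (Nat.cast_nonneg _) (mul_nonneg (hU _) (hU _))
    linarith

section

variable {S : ℝ} {u : RealL2} {r : ℕ}

theorem sobolevNorm_one_iterDx_sq_le (hu : u ∈ sobolevSubmodule (r + 4))
    (hS : sobolevNorm 3 u ≤ S) :
    sobolevNorm 1 (iterDx (r + 1) (mul u u)) ≤ 6 * embConst *
      (S * sobolevNorm 2 (iterDx (r + 1) u) +
        leibnizSqBound S (fun k => sobolevNorm 2 (iterDx k u)) r) := by
  have h := sobolevNorm_one_iterDx_mul_self_le (r := r) (mem_sobolev_of_le (by omega) hu)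
  have hS0 := (sobolevNorm_nonneg 3 u).trans hS
  have h12 : ∀ k ≤ r + 2, sobolevNorm 1 (iterDx k u) ≤ sobolevNorm 2 (iterDx k u) := fun k hk =>
    sobolevNorm_mono one_le_two (iterDx_mem_sobolev k (mem_sobolev_of_le (by omega) hu))
  have hu3 := mem_sobolev_of_le (show 3 ≤ r + 4 by omega) hu
  have b := sum_choose_le_leibnizSqBound (S := S) (U := fun k => sobolevNorm 2 (iterDx k u))
    (a := fun k => sobolevNorm 1 (iterDx k u)) (b := fun k => sobolevNorm 1 (iterDx k u)) (r := r)
    (fun _ => sobolevNorm_nonneg _ _) (fun _ => sobolevNorm_nonneg _ _)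
    (fun t ht => h12 _ (by omega)) (fun _ => sobolevNorm_nonneg _ _) (fun t ht => h12 _ (by omega))
    (fun _ => (sobolevNorm_iterDx_le 1 (mem_sobolev_of_le (by norm_num) hu3)).trans
      ((sobolevNorm_mono (by norm_num) hu3).trans hS)) hS0
  have b2 := mul_le_mul ((sobolevNorm_mono (show 1 ≤ 3 by norm_num) hu3).trans hS)
    (h12 (r + 1) (by omega)) (sobolevNorm_nonneg _ _) hS0
  have b3 := mul_le_mul_of_nonneg_left (add_le_add (mul_le_mul_of_nonneg_left b2 zero_le_two) b)
    (mul_nonneg (by norm_num : (0 : ℝ) ≤ 3) embConst_nonneg)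
  linarith

theorem sobolevNorm_one_iterDx_dx_sq_le (hu : u ∈ sobolevSubmodule (r + 4))
    (hS : sobolevNorm 3 u ≤ S) :
    sobolevNorm 1 (iterDx (r + 1) (mul (dx u) (dx u))) ≤ 6 * embConst *
      (S * sobolevNorm 2 (iterDx (r + 1) u) +
        leibnizSqBound S (fun k => sobolevNorm 2 (iterDx k u)) r) := by
  have h := sobolevNorm_one_iterDx_mul_self_le (r := r) (f := dx u)
    (mem_sobolev_of_le (by omega) (dx_mem_sobolev (s := r + 3) hu))
  have hS0 := (sobolevNorm_nonneg 3 u).trans hS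
  have h12 : ∀ k ≤ r + 2, sobolevNorm 1 (iterDx k (dx u)) ≤ sobolevNorm 2 (iterDx k u) :=
    fun k hk => by
      rw [← iterDx_succ']
      exact sobolevNorm_one_iterDx_succ_le (mem_sobolev_of_le (by omega) hu)
  have hu3 := mem_sobolev_of_le (show 3 ≤ r + 4 by omega) hu
  have hd : sobolevNorm 1 (dx u) ≤ S :=
    (sobolevNorm_mono one_le_two (dx_mem_sobolev (s := 2) hu3)).trans
      ((sobolevNorm_dx_le hu3).trans hS)
  have b := sum_choose_le_leibnizSqBound (S := S) (U := fun k => sobolevNorm 2 (iterDx k u))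
    (a := fun k => sobolevNorm 1 (iterDx k (dx u))) (b := fun k => sobolevNorm 1 (iterDx k (dx u)))
    (r := r)
    (fun _ => sobolevNorm_nonneg _ _) (fun _ => sobolevNorm_nonneg _ _)
    (fun t ht => h12 _ (by omega)) (fun _ => sobolevNorm_nonneg _ _) (fun t ht => h12 _ (by omega))
    (fun _ => by
      -- In the exceptional case for `uₓ²` the factor to be bounded is `u''` in H¹, which costs the
      -- full H³ norm.
      change sobolevNorm 1 (iterDx 2 u) ≤ S
      exact (sobolevNorm_iterDx_le (s := 1) 2 hu3).trans hS) hS0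
  have b2 := mul_le_mul hd (h12 (r + 1) (by omega)) (sobolevNorm_nonneg _ _) hS0
  have b3 := mul_le_mul_of_nonneg_left (add_le_add (mul_le_mul_of_nonneg_left b2 zero_le_two) b)
    (mul_nonneg (by norm_num : (0 : ℝ) ≤ 3) embConst_nonneg)
  linarith

/-- At level `r` the functional controls `v^{(r)}` but `u^{(r+1)}`, so the order of one factor must
be lowered: `v^{(t+1)}` in H¹ is bounded by `v^{(t)}` in H². The orders then add up to `r`, and no
exceptional case arises. -/
theorem sobolevNorm_one_iterDx_sq_le' {v : RealL2} (hv : v ∈ sobolevSubmodule (r + 4))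
    (hS : sobolevNorm 3 v ≤ S) :
    sobolevNorm 1 (iterDx (r + 1) (mul v v)) ≤ 6 * embConst *
      (S * sobolevNorm 2 (iterDx r v) + ∑ t ∈ Finset.range r, ((r + 1).choose (t + 1) : ℝ) *
        (sobolevNorm 2 (iterDx t v) * sobolevNorm 2 (iterDx (r - t) v))) := by
  have h := sobolevNorm_one_iterDx_mul_self_le (r := r) (mem_sobolev_of_le (by omega) hv)
  have hS0 := (sobolevNorm_nonneg 3 v).trans hS
  have h12 : ∀ k ≤ r + 2, sobolevNorm 1 (iterDx k v) ≤ sobolevNorm 2 (iterDx k v) := fun k hk =>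
    sobolevNorm_mono one_le_two (iterDx_mem_sobolev k (mem_sobolev_of_le (by omega) hv))
  have h1 : ∀ k ≤ r, sobolevNorm 1 (iterDx (k + 1) v) ≤ sobolevNorm 2 (iterDx k v) := fun k hk =>
    sobolevNorm_one_iterDx_succ_le (mem_sobolev_of_le (by omega) hv)
  have hv3 := mem_sobolev_of_le (show 3 ≤ r + 4 by omega) hv
  have b : ∑ t ∈ Finset.range r, ((r + 1).choose (t + 1) : ℝ) *
        (sobolevNorm 1 (iterDx (t + 1) v) * sobolevNorm 1 (iterDx (r - t) v)) ≤
      ∑ t ∈ Finset.range r, ((r + 1).choose (t + 1) : ℝ) *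
        (sobolevNorm 2 (iterDx t v) * sobolevNorm 2 (iterDx (r - t) v)) := by
    refine Finset.sum_le_sum fun t ht => ?_
    rw [Finset.mem_range] at ht
    exact mul_le_mul_of_nonneg_left (mul_le_mul (h1 t ht.le) (h12 _ (by omega))
      (sobolevNorm_nonneg _ _) (sobolevNorm_nonneg _ _)) (Nat.cast_nonneg _)
  have hnn : 0 ≤ ∑ t ∈ Finset.range r, ((r + 1).choose (t + 1) : ℝ) *
        (sobolevNorm 2 (iterDx t v) * sobolevNorm 2 (iterDx (r - t) v)) :=
    Finset.sum_nonneg fun t _ => mul_nonneg (Nat.cast_nonneg _)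
      (mul_nonneg (sobolevNorm_nonneg _ _) (sobolevNorm_nonneg _ _))
  have b2 := mul_le_mul ((sobolevNorm_mono (show 1 ≤ 3 by norm_num) hv3).trans hS)
    (h1 r le_rfl) (sobolevNorm_nonneg _ _) hS0
  have b3 := mul_le_mul_of_nonneg_left (add_le_add (mul_le_mul_of_nonneg_left b2 zero_le_two) b)
    (mul_nonneg (by norm_num : (0 : ℝ) ≤ 3) embConst_nonneg)
  have b4 := mul_nonneg (mul_nonneg (by norm_num : (0 : ℝ) ≤ 3) embConst_nonneg) hnn
  linarith

/-- The `H²` norm of the intermediate terms in the Leibniz formula for a product `u w`, in which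
`p k` and `q k` bound the norms of the derivatives of `u` and `w`. -/
theorem sobolevNorm_two_leibniz_sum_le {w : RealL2} {p₁ p₂ q₁ q₂ : ℕ → ℝ}
    (hu : u ∈ sobolevSubmodule (r + 2)) (hw : w ∈ sobolevSubmodule (r + 2))
    (hS0 : sobolevNorm 2 (dx u) ≤ S)
    (hp₁ : ∀ t, t + 2 ≤ r → sobolevNorm 1 (iterDx (t + 2) u) ≤ p₁ t)
    (hp₂ : ∀ t, t + 2 ≤ r → sobolevNorm 2 (iterDx (t + 2) u) ≤ p₂ t)
    (hq₁ : ∀ t, t + 2 ≤ r → sobolevNorm 1 (iterDx (r - 1 - t) w) ≤ q₁ t)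
    (hq₂ : ∀ t, t + 2 ≤ r → sobolevNorm 2 (iterDx (r - 1 - t) w) ≤ q₂ t) :
    sobolevNorm 2 (∑ t ∈ Finset.range r, ((r + 1).choose (t + 1) : ℝ) •
        mul (iterDx (t + 1) u) (iterDx (r - t) w)) ≤ 12 * embConst *
      ((r + 1) * (S * sobolevNorm 2 (iterDx r w)) + ∑ t ∈ Finset.range (r - 1),
        ((r + 1).choose (t + 2) : ℝ) * (p₂ t * q₁ t + p₁ t * q₂ t)) := by
  have hc := embConst_nonneg
  have hS : 0 ≤ S := (sobolevNorm_nonneg _ _).trans hS0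
  have mu : ∀ k ≤ r, iterDx k u ∈ sobolevSubmodule 2 := fun k hk =>
    iterDx_mem_sobolev k (mem_sobolev_of_le (by omega) hu)
  have mw : ∀ k ≤ r, iterDx k w ∈ sobolevSubmodule 2 := fun k hk =>
    iterDx_mem_sobolev k (mem_sobolev_of_le (by omega) hw)
  refine (sobolevNorm_sum_smul_le (a := fun t => ((r + 1).choose (t + 1) : ℝ))
    (fun t => Nat.cast_nonneg _) fun t ht => mul_mem_sobolev one_le_two (mu _ (by omega))
      (mw _ (by omega))).trans ?_
  cases r with
  | zero =>
    rw [Finset.sum_range_zero, Finset.sum_range_zero]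
    have := mul_nonneg hS (sobolevNorm_nonneg 2 (iterDx 0 w))
    norm_num
    positivity
  | succ s =>
    -- The summand `u_x w^{(r)}`, with coefficient `r+1`, is separated and bounded by `S`; only the
    -- others get the tame estimate.
    rw [Finset.sum_range_succ']
    have h0 := sobolevNorm_two_mul_le' (mu 1 (by omega)) (mw (s + 1) le_rfl)
    have h0' := mul_le_mul_of_nonneg_right hS0 (sobolevNorm_nonneg 2 (iterDx (s + 1) w))
    have h0'' := mul_le_mul_of_nonneg_left h0' (mul_nonneg (by norm_num : (0 : ℝ) ≤ 12) hc)
    have h1 : ∑ t ∈ Finset.range s, ((s + 1 + 1).choose (t + 1 + 1) : ℝ) *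
        sobolevNorm 2 (mul (iterDx (t + 1 + 1) u) (iterDx (s + 1 - (t + 1)) w)) ≤
        12 * embConst * ∑ t ∈ Finset.range s,
          ((s + 1 + 1).choose (t + 2) : ℝ) * (p₂ t * q₁ t + p₁ t * q₂ t) := by
      rw [Finset.mul_sum]
      refine Finset.sum_le_sum fun t ht => ?_
      rw [Finset.mem_range] at ht
      have e : s + 1 - (t + 1) = s + 1 - 1 - t := by omega
      rw [e]
      have a1 := sobolevNorm_two_mul_le (mu (t + 2) (by omega)) (mw (s + 1 - 1 - t) (by omega))
      have x1 := mul_le_mul (hp₂ t (by omega)) (hq₁ t (by omega)) (sobolevNorm_nonneg _ _)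
        ((sobolevNorm_nonneg _ _).trans (hp₂ t (by omega)))
      have x2 := mul_le_mul (hp₁ t (by omega)) (hq₂ t (by omega)) (sobolevNorm_nonneg _ _)
        ((sobolevNorm_nonneg _ _).trans (hp₁ t (by omega)))
      have x3 : 0 ≤ p₂ t * q₁ t + p₁ t * q₂ t := (add_nonneg
        (mul_nonneg (sobolevNorm_nonneg _ _) (sobolevNorm_nonneg _ _))
        (mul_nonneg (sobolevNorm_nonneg _ _) (sobolevNorm_nonneg _ _))).trans (add_le_add x1 x2)
      have x4 := mul_le_mul_of_nonneg_left (add_le_add x1 x2)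
        (mul_nonneg (by norm_num : (0 : ℝ) ≤ 6) hc)
      have x5 := mul_nonneg hc x3
      have x6 : sobolevNorm 2 (mul (iterDx (t + 2) u) (iterDx (s + 1 - 1 - t) w)) ≤
          12 * embConst * (p₂ t * q₁ t + p₁ t * q₂ t) := by linarith
      have x7 := mul_le_mul_of_nonneg_left x6
        (Nat.cast_nonneg (α := ℝ) ((s + 1 + 1).choose (t + 2)))
      linarith
    have e0 : ((s + 1 + 1).choose (0 + 1) : ℝ) = (s + 1 : ℕ) + 1 := by
      rw [zero_add, Nat.choose_one_right]
      push_cast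
      ring
    rw [e0, zero_add, Nat.sub_zero, Nat.add_sub_cancel, mul_add]
    have h2 := mul_le_mul_of_nonneg_left (h0.trans h0'')
      (by positivity : (0 : ℝ) ≤ (s + 1 : ℕ) + 1)
    linarith

/-- The extreme terms are the transport of `u^{(r+1)}` by `u`, and `u^{(r+1)} u_x`. In the remaining
sum the orders of the two factors add up to `r+1` rather than `r+2`, by the tame estimate. The
constants add up to `10 + 4·12 + 4·12 ≤ 110`. -/
theorem abs_inner₂_iterDx_mul_dx_le (hu : u ∈ sobolevSubmodule (r + 4))
    (hS : sobolevNorm 3 u ≤ S) :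
    |inner₂ (iterDx (r + 1) u) (iterDx (r + 1) (mul u (dx u)))| ≤ 110 * embConst *
      ((r + 1) * (S * sobolevNorm 2 (iterDx (r + 1) u) ^ 2) + sobolevNorm 2 (iterDx (r + 1) u) *
        ∑ t ∈ Finset.range (r - 1), ((r + 1).choose (t + 2) : ℝ) *
          (sobolevNorm 2 (iterDx (t + 2) u) * sobolevNorm 2 (iterDx (r - 1 - t) u) +
            sobolevNorm 2 (iterDx (t + 1) u) * sobolevNorm 2 (iterDx (r - t) u))) := by
  have hc := embConst_nonneg
  have hS0 := (sobolevNorm_nonneg 3 u).trans hS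
  have hu3 := mem_sobolev_of_le (show 3 ≤ r + 4 by omega) hu
  have hu2 := mem_sobolev_of_le (show 2 ≤ 3 by omega) hu3
  have hd : dx u ∈ sobolevSubmodule (r + 3) := dx_mem_sobolev hu
  have hdS : sobolevNorm 2 (dx u) ≤ S := (sobolevNorm_dx_le hu3).trans hS
  have hw3 : iterDx (r + 1) u ∈ sobolevSubmodule 3 :=
    iterDx_mem_sobolev (r + 1) (mem_sobolev_of_le (by omega) hu)
  have hw2 := mem_sobolev_of_le (show 2 ≤ 3 by omega) hw3
  have hdw : dx (iterDx (r + 1) u) ∈ sobolevSubmodule 2 := dx_mem_sobolev hw3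
  have hd2 := mem_sobolev_of_le (show 2 ≤ r + 3 by omega) hd
  rw [iterDx_succ_mul (mem_sobolev_of_le (by omega) hu) (mem_sobolev_of_le (by omega) hd),
    ← iterDx_succ', iterDx_succ (r + 1)]
  have m1 := mul_mem_sobolev one_le_two hu2 hdw
  have m2 := mul_mem_sobolev one_le_two hw2 hd2
  have m3 : ∑ t ∈ Finset.range r, ((r + 1).choose (t + 1) : ℝ) •
        mul (iterDx (t + 1) u) (iterDx (r - t) (dx u)) ∈ sobolevSubmodule 2 :=
    sum_mem fun t ht => Submodule.smul_mem _ _ (mul_mem_sobolev one_le_two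
      (iterDx_mem_sobolev _ (mem_sobolev_of_le (by rw [Finset.mem_range] at ht; omega) hu))
      (iterDx_mem_sobolev _ (mem_sobolev_of_le (by omega) hd)))
  rw [inner₂_add_right (add_mem m1 m2) m3, inner₂_add_right m1 m2]
  have b1 := abs_inner₂_transport_le hu3 hw3
  have b2 := abs_inner₂_le hw2 m2
  have b3 := abs_inner₂_le hw2 m3
  have b4 := sobolevNorm_two_mul_le' hw2 hd2
  have b5 := sobolevNorm_two_leibniz_sum_le (S := S) (w := dx u) (r := r)
    (p₁ := fun t => sobolevNorm 2 (iterDx (t + 1) u))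
    (p₂ := fun t => sobolevNorm 2 (iterDx (t + 2) u))
    (q₁ := fun t => sobolevNorm 2 (iterDx (r - 1 - t) u))
    (q₂ := fun t => sobolevNorm 2 (iterDx (r - t) u))
    (mem_sobolev_of_le (by omega) hu) (mem_sobolev_of_le (by omega) hd) hdS
    (fun t ht => sobolevNorm_one_iterDx_succ_le (mem_sobolev_of_le (by omega) hu))
    (fun t ht => le_rfl)
    (fun t ht => by
      rw [← iterDx_succ']
      exact sobolevNorm_one_iterDx_succ_le (mem_sobolev_of_le (by omega) hu))
    (fun t ht => by
      rw [← iterDx_succ', show r - 1 - t + 1 = r - t by omega])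
  rw [← iterDx_succ'] at b5
  set U := sobolevNorm 2 (iterDx (r + 1) u)
  set T := ∑ t ∈ Finset.range (r - 1), ((r + 1).choose (t + 2) : ℝ) *
          (sobolevNorm 2 (iterDx (t + 2) u) * sobolevNorm 2 (iterDx (r - 1 - t) u) +
            sobolevNorm 2 (iterDx (t + 1) u) * sobolevNorm 2 (iterDx (r - t) u))
  have hU : 0 ≤ U := sobolevNorm_nonneg _ _
  have hT : 0 ≤ T := Finset.sum_nonneg fun t _ => mul_nonneg (Nat.cast_nonneg _) (add_nonneg
    (mul_nonneg (sobolevNorm_nonneg _ _) (sobolevNorm_nonneg _ _))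
    (mul_nonneg (sobolevNorm_nonneg _ _) (sobolevNorm_nonneg _ _)))
  clear_value T
  have c1 := mul_le_mul_of_nonneg_left (mul_le_mul_of_nonneg_right hS (sq_nonneg U))
    (mul_nonneg (by norm_num : (0 : ℝ) ≤ 10) hc)
  have c0 := mul_le_mul_of_nonneg_left (mul_le_mul_of_nonneg_left hdS hU)
    (mul_nonneg (by norm_num : (0 : ℝ) ≤ 12) hc)
  have c2 := mul_le_mul_of_nonneg_left (b4.trans c0) hU
  have c3 := mul_le_mul_of_nonneg_left b5 hU
  have d1 : 0 ≤ embConst * (S * U ^ 2) := by positivity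
  have d2 : 0 ≤ embConst * (r * (S * U ^ 2)) := by positivity
  have d3 : 0 ≤ embConst * (U * T) := by positivity
  refine (abs_add_le _ _).trans ?_
  have e1 := abs_add_le (inner₂ (iterDx (r + 1) u) (mul u (dx (iterDx (r + 1) u))))
    (inner₂ (iterDx (r + 1) u) (mul (iterDx (r + 1) u) (dx u)))
  linarith

/-- The scheme is that for `u u_x`, but the second extreme term is `u^{(r+1)} v`. It is the source
of the mixed product of the norms of `v^{(r)}` and `u^{(r+1)}`. -/
theorem abs_inner₂_iterDx_mul_le {v : RealL2} (hu : u ∈ sobolevSubmodule (r + 4))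
    (hv : v ∈ sobolevSubmodule (r + 4)) (hS : sobolevNorm 3 u + sobolevNorm 3 v ≤ S) :
    |inner₂ (iterDx r v) (iterDx (r + 1) (mul u v))| ≤ 110 * embConst *
      ((r + 1) * (S * sobolevNorm 2 (iterDx r v) ^ 2) +
        S * (sobolevNorm 2 (iterDx r v) * sobolevNorm 2 (iterDx (r + 1) u)) +
        sobolevNorm 2 (iterDx r v) *
        ∑ t ∈ Finset.range (r - 1), ((r + 1).choose (t + 2) : ℝ) *
          (sobolevNorm 2 (iterDx (t + 2) u) * sobolevNorm 2 (iterDx (r - 2 - t) v) +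
            sobolevNorm 2 (iterDx (t + 1) u) * sobolevNorm 2 (iterDx (r - 1 - t) v))) := by
  have hc := embConst_nonneg
  have hSu : sobolevNorm 3 u ≤ S := by linarith [sobolevNorm_nonneg 3 v]
  have hSv : sobolevNorm 3 v ≤ S := by linarith [sobolevNorm_nonneg 3 u]
  have hS0 := (sobolevNorm_nonneg 3 u).trans hSu
  have hu3 := mem_sobolev_of_le (show 3 ≤ r + 4 by omega) hu
  have hu2 := mem_sobolev_of_le (show 2 ≤ 3 by omega) hu3
  have hv3 := mem_sobolev_of_le (show 3 ≤ r + 4 by omega) hv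
  have hv2 := mem_sobolev_of_le (show 2 ≤ 3 by omega) hv3
  have hdS : sobolevNorm 2 (dx u) ≤ S := (sobolevNorm_dx_le hu3).trans hSu
  have hvS : sobolevNorm 2 v ≤ S := (sobolevNorm_mono (by norm_num) hv3).trans hSv
  have hw3 : iterDx r v ∈ sobolevSubmodule 3 :=
    iterDx_mem_sobolev r (mem_sobolev_of_le (by omega) hv)
  have hw2 := mem_sobolev_of_le (show 2 ≤ 3 by omega) hw3
  have hdw : dx (iterDx r v) ∈ sobolevSubmodule 2 := dx_mem_sobolev hw3
  have hur : iterDx (r + 1) u ∈ sobolevSubmodule 2 :=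
    iterDx_mem_sobolev (r + 1) (mem_sobolev_of_le (by omega) hu)
  rw [iterDx_succ_mul (mem_sobolev_of_le (by omega) hu) (mem_sobolev_of_le (by omega) hv),
    iterDx_succ r v]
  have m1 := mul_mem_sobolev one_le_two hu2 hdw
  have m2 := mul_mem_sobolev one_le_two hur hv2
  have m3 : ∑ t ∈ Finset.range r, ((r + 1).choose (t + 1) : ℝ) •
        mul (iterDx (t + 1) u) (iterDx (r - t) v) ∈ sobolevSubmodule 2 :=
    sum_mem fun t ht => Submodule.smul_mem _ _ (mul_mem_sobolev one_le_two
      (iterDx_mem_sobolev _ (mem_sobolev_of_le (by rw [Finset.mem_range] at ht; omega) hu))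
      (iterDx_mem_sobolev _ (mem_sobolev_of_le (by omega) hv)))
  rw [inner₂_add_right (add_mem m1 m2) m3, inner₂_add_right m1 m2]
  have b1 := abs_inner₂_transport_le hu3 hw3
  have b2 := abs_inner₂_le hw2 m2
  have b3 := abs_inner₂_le hw2 m3
  have b4 := sobolevNorm_two_mul_le' hur hv2
  have b5 := sobolevNorm_two_leibniz_sum_le (S := S) (w := v) (r := r)
    (p₁ := fun t => sobolevNorm 2 (iterDx (t + 1) u))
    (p₂ := fun t => sobolevNorm 2 (iterDx (t + 2) u))
    (q₁ := fun t => sobolevNorm 2 (iterDx (r - 2 - t) v))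
    (q₂ := fun t => sobolevNorm 2 (iterDx (r - 1 - t) v))
    (mem_sobolev_of_le (by omega) hu) (mem_sobolev_of_le (by omega) hv) hdS
    (fun t ht => sobolevNorm_one_iterDx_succ_le (mem_sobolev_of_le (by omega) hu))
    (fun t ht => le_rfl)
    (fun t ht => by
      -- The subtraction is not truncated because `t + 2 ≤ r`, so there is a derivative of `v` to
      -- give up.
      rw [show r - 1 - t = r - 2 - t + 1 by omega]
      exact sobolevNorm_one_iterDx_succ_le (mem_sobolev_of_le (by omega) hv))
    (fun t ht => le_rfl)
  set V := sobolevNorm 2 (iterDx r v)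
  set U := sobolevNorm 2 (iterDx (r + 1) u)
  set T := ∑ t ∈ Finset.range (r - 1), ((r + 1).choose (t + 2) : ℝ) *
          (sobolevNorm 2 (iterDx (t + 2) u) * sobolevNorm 2 (iterDx (r - 2 - t) v) +
            sobolevNorm 2 (iterDx (t + 1) u) * sobolevNorm 2 (iterDx (r - 1 - t) v))
  have hU : 0 ≤ U := sobolevNorm_nonneg _ _
  have hV : 0 ≤ V := sobolevNorm_nonneg _ _
  have hT : 0 ≤ T := Finset.sum_nonneg fun t _ => mul_nonneg (Nat.cast_nonneg _) (add_nonneg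
    (mul_nonneg (sobolevNorm_nonneg _ _) (sobolevNorm_nonneg _ _))
    (mul_nonneg (sobolevNorm_nonneg _ _) (sobolevNorm_nonneg _ _)))
  clear_value T
  have c1 := mul_le_mul_of_nonneg_left (mul_le_mul_of_nonneg_right hSu (sq_nonneg V))
    (mul_nonneg (by norm_num : (0 : ℝ) ≤ 10) hc)
  have c0 := mul_le_mul_of_nonneg_left (mul_le_mul_of_nonneg_left hvS hU)
    (mul_nonneg (by norm_num : (0 : ℝ) ≤ 12) hc)
  have c2 := mul_le_mul_of_nonneg_left (b4.trans c0) hV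
  have c3 := mul_le_mul_of_nonneg_left b5 hV
  have d1 : 0 ≤ embConst * (S * V ^ 2) := by positivity
  have d2 : 0 ≤ embConst * (r * (S * V ^ 2)) := by positivity
  have d3 : 0 ≤ embConst * (V * T) := by positivity
  have d4 : 0 ≤ embConst * (S * (V * U)) := by positivity
  refine (abs_add_le _ _).trans ?_
  have e1 := abs_add_le (inner₂ (iterDx r v) (mul u (dx (iterDx r v))))
    (inner₂ (iterDx r v) (mul (iterDx (r + 1) u) v))
  linarith

end

open scoped Nat

/-! ### Weighted sequences and their convolutions -/

/-- The summands of the convolution of `x` with `√q x_q`, with the gain `1 / (p + 1)`. -/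
def convTerm (x : ℕ → ℝ) (p q : ℕ) : ℝ := x p * (√q * x q) / (p + 1)

/-- The convolution of `x_p / (p + 1)` with `√q x_q`. -/
def conv (x : ℕ → ℝ) (s : ℕ) : ℝ := ∑ t ∈ Finset.range (s + 1), convTerm x t (s - t)

/-- Telescoping: `1/(n+1)² ≤ 2/((n+1)(n+2)) = 2/(n+1) - 2/(n+2)`. -/
theorem sum_range_inv_sq_le (n : ℕ) :
    ∑ t ∈ Finset.range n, (1 / ((t : ℝ) + 1)) ^ 2 ≤ 2 - 2 / ((n : ℝ) + 1) := by
  induction n with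
  | zero => norm_num
  | succ n ih =>
    rw [Finset.sum_range_succ]
    have h : (1 / ((n : ℝ) + 1)) ^ 2 ≤ 2 / ((n : ℝ) + 1) - 2 / ((n + 1 : ℕ) + 1) := by
      push_cast
      rw [div_sub_div _ _ (by positivity) (by positivity), div_pow, div_le_div_iff₀ (by positivity)
        (by positivity)]
      nlinarith [(Nat.cast_nonneg n : (0 : ℝ) ≤ n)]
    linarith

section

variable {x : ℕ → ℝ}

theorem convTerm_nonneg (hx : ∀ r, 0 ≤ x r) (p q : ℕ) : 0 ≤ convTerm x p q := by
  have := hx p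
  have := hx q
  unfold convTerm
  positivity

theorem conv_nonneg (hx : ∀ r, 0 ≤ x r) (s : ℕ) : 0 ≤ conv x s :=
  Finset.sum_nonneg fun _ _ => convTerm_nonneg hx _ _

/-- Young's inequality ℓ¹ * ℓ² ⊂ ℓ². After exchanging the sums, Cauchy–Schwarz in `r` bounds the
inner sum uniformly in `t`. A second Cauchy–Schwarz bounds `∑ x_t/(t+1)` by the ℓ² norm of `x`, with
`√2` rounded up to 2. -/
theorem sum_mul_conv_le (hx : ∀ r, 0 ≤ x r) {z : ℕ → ℝ} (n : ℕ) :
    ∑ r ∈ Finset.range n, z r * conv x r ≤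
      2 * √(∑ r ∈ Finset.range n, x r ^ 2) * √(∑ r ∈ Finset.range n, r * x r ^ 2) *
        √(∑ r ∈ Finset.range n, z r ^ 2) := by
  have e : ∑ r ∈ Finset.range n, z r * conv x r = ∑ t ∈ Finset.range n,
      (x t * (1 / ((t : ℝ) + 1))) *
        ∑ r ∈ Finset.Ico t n, (√(r - t : ℕ) * x (r - t)) * z r := by
    simp only [conv, Finset.mul_sum]
    rw [Finset.sum_comm' (t' := Finset.range n) (s' := fun t => Finset.Ico t n)]
    · refine Finset.sum_congr rfl fun t _ => Finset.sum_congr rfl fun r _ => ?_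
      rw [convTerm]
      ring
    · intro r t
      simp only [Finset.mem_range, Finset.mem_Ico]
      omega
  have hin : ∀ t ∈ Finset.range n, ∑ r ∈ Finset.Ico t n, (√(r - t : ℕ) * x (r - t)) * z r ≤
      √(∑ r ∈ Finset.range n, r * x r ^ 2) * √(∑ r ∈ Finset.range n, z r ^ 2) := by
    intro t _
    refine (Real.sum_mul_le_sqrt_mul_sqrt _ _ _).trans (mul_le_mul (Real.sqrt_le_sqrt ?_)
      (Real.sqrt_le_sqrt ?_) (Real.sqrt_nonneg _) (Real.sqrt_nonneg _))
    · simp only [mul_pow, Real.sq_sqrt (Nat.cast_nonneg _)]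
      rw [Finset.sum_Ico_eq_sum_range]
      simp only [Nat.add_sub_cancel_left]
      exact Finset.sum_le_sum_of_subset_of_nonneg (Finset.range_mono (Nat.sub_le n t))
        fun i _ _ => by positivity
    · exact Finset.sum_le_sum_of_subset_of_nonneg (fun r hr => by
        rw [Finset.mem_Ico] at hr; exact Finset.mem_range.2 hr.2) fun i _ _ => sq_nonneg _
  rw [e]
  refine (Finset.sum_le_sum fun t ht => mul_le_mul_of_nonneg_left (hin t ht)
    (mul_nonneg (hx t) (by positivity))).trans ?_
  rw [← Finset.sum_mul]
  have h2 : ∑ t ∈ Finset.range n, x t * (1 / ((t : ℝ) + 1)) ≤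
      √(∑ r ∈ Finset.range n, x r ^ 2) * 2 := by
    refine (Real.sum_mul_le_sqrt_mul_sqrt _ _ _).trans
      (mul_le_mul_of_nonneg_left ?_ (Real.sqrt_nonneg _))
    rw [Real.sqrt_le_left (by norm_num)]
    have := sum_range_inv_sq_le n
    have h3 : 0 ≤ 2 / ((n : ℝ) + 1) := by positivity
    linarith
  have h3 := mul_le_mul_of_nonneg_right h2 (mul_nonneg
    (Real.sqrt_nonneg (∑ r ∈ Finset.range n, r * x r ^ 2))
    (Real.sqrt_nonneg (∑ r ∈ Finset.range n, z r ^ 2)))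
  linarith

theorem sum_sqrt_mul_conv_le (hx : ∀ r, 0 ≤ x r) (n : ℕ) :
    ∑ r ∈ Finset.range n, √r * x r * conv x r ≤
      2 * √(∑ r ∈ Finset.range n, x r ^ 2) * ∑ r ∈ Finset.range n, r * x r ^ 2 := by
  refine (sum_mul_conv_le hx n).trans (le_of_eq ?_)
  simp only [mul_pow, Real.sq_sqrt (Nat.cast_nonneg _)]
  rw [mul_assoc, Real.mul_self_sqrt (Finset.sum_nonneg fun i _ => by positivity)]

/-- The version for `p + q = r - 1`. The summand `r = 0`, where the predecessor is truncated,
vanishes because of `√r`. -/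
theorem sum_sqrt_mul_conv_pred_le (hx : ∀ r, 0 ≤ x r) (n : ℕ) :
    ∑ r ∈ Finset.range (n + 1), √r * x r * conv x (r - 1) ≤
      2 * √(∑ r ∈ Finset.range (n + 1), x r ^ 2) *
        ∑ r ∈ Finset.range (n + 1), r * x r ^ 2 := by
  rw [Finset.sum_range_succ']
  simp only [Nat.add_sub_cancel, Nat.cast_zero, Real.sqrt_zero, zero_mul, add_zero]
  refine (sum_mul_conv_le hx n).trans ?_
  have h1 : ∑ r ∈ Finset.range n, x r ^ 2 ≤ ∑ r ∈ Finset.range (n + 1), x r ^ 2 := by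
    rw [Finset.sum_range_succ]
    nlinarith [sq_nonneg (x n)]
  have h2 : ∑ r ∈ Finset.range n, r * x r ^ 2 ≤ ∑ r ∈ Finset.range (n + 1), r * x r ^ 2 := by
    rw [Finset.sum_range_succ]
    have : 0 ≤ n * x n ^ 2 := by positivity
    linarith
  have h3 : ∑ r ∈ Finset.range n, (√(r + 1 : ℕ) * x (r + 1)) ^ 2 ≤
      ∑ r ∈ Finset.range (n + 1), r * x r ^ 2 := by
    rw [Finset.sum_range_succ']
    simp only [mul_pow, Real.sq_sqrt (Nat.cast_nonneg _), Nat.cast_zero, zero_mul, add_zero]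
    exact le_rfl
  have h0 : 0 ≤ ∑ r ∈ Finset.range (n + 1), r * x r ^ 2 :=
    Finset.sum_nonneg fun i _ => by positivity
  calc _ ≤ 2 * √(∑ r ∈ Finset.range (n + 1), x r ^ 2) *
        √(∑ r ∈ Finset.range (n + 1), r * x r ^ 2) *
        √(∑ r ∈ Finset.range (n + 1), r * x r ^ 2) := by gcongr
    _ = _ := by rw [mul_assoc, Real.mul_self_sqrt h0]

theorem cast_le_sqrt_mul_sqrt {q r : ℕ} (h : q ≤ r) : (q : ℝ) ≤ √q * √r := by
  have h1 : √(q : ℝ) ≤ √r := Real.sqrt_le_sqrt (by exact_mod_cast h)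
  calc (q : ℝ) = √q * √q := (Real.mul_self_sqrt (Nat.cast_nonneg q)).symm
    _ ≤ _ := mul_le_mul_of_nonneg_left h1 (Real.sqrt_nonneg _)

/-- Here `√q √r ≥ q ≥ (p+1)/2`, so the factor `2√q√r/(p+1)` may be inserted. The weight `√q` goes to
the larger of the two lower indices. -/
theorem mul_mul_le_of_le (hx : ∀ r, 0 ≤ x r) {p q r : ℕ} (hpq : p ≤ q) (hq : 1 ≤ q) (hr : q ≤ r) :
    x r * (x p * x q) ≤ 2 * (√r * x r) * convTerm x p q := by
  have h1 := cast_le_sqrt_mul_sqrt hr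
  have h2 : (p : ℝ) ≤ q := by exact_mod_cast hpq
  have h3 : (1 : ℝ) ≤ q := by exact_mod_cast hq
  have h4 : 1 ≤ 2 * (√q * √r) / ((p : ℝ) + 1) := by
    rw [le_div_iff₀ (by positivity)]
    linarith
  have h5 := mul_le_mul_of_nonneg_left h4 (mul_nonneg (hx r) (mul_nonneg (hx p) (hx q)))
  refine (mul_one (x r * (x p * x q))).symm.le.trans (h5.trans (le_of_eq ?_))
  rw [convTerm]
  ring

/-- The condition `1 ≤ p + q` excludes `p = q = 0`, where both convolution terms vanish and the
bound would fail. -/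
theorem mul_mul_le (hx : ∀ r, 0 ≤ x r) {p q r : ℕ} (h : 1 ≤ p + q) (hp : p ≤ r) (hq : q ≤ r) :
    x r * (x p * x q) ≤ 2 * (√r * x r) * (convTerm x p q + convTerm x q p) := by
  have hy : 0 ≤ 2 * (√r * x r) := mul_nonneg zero_le_two (mul_nonneg (Real.sqrt_nonneg _) (hx r))
  have h1 := mul_nonneg hy (convTerm_nonneg hx p q)
  have h2 := mul_nonneg hy (convTerm_nonneg hx q p)
  rcases le_total p q with hpq | hpq
  · have := mul_mul_le_of_le hx hpq (by omega) hq
    linarith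
  · have := mul_mul_le_of_le hx hpq (by omega) hp
    rw [mul_comm (x q)] at this
    linarith

/-- Write the admissible weight as `1 + (q+1)/(p+1)`. The part 1 is `mul_mul_le`, and in the other
`q + 1 ≤ 2q ≤ 2√q√r` while the denominator is already the one in `convTerm`. -/
theorem mul_mul_mul_le (hx : ∀ r, 0 ≤ x r) {p q r : ℕ} {w : ℝ} (hq1 : 1 ≤ q) (hp : p ≤ r)
    (hq : q ≤ r) (hw : w ≤ ((p : ℝ) + q + 2) / (p + 1)) :
    w * (x r * (x p * x q)) ≤ (√r * x r) * (4 * convTerm x p q + 2 * convTerm x q p) := by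
  have hnn := mul_nonneg (hx r) (mul_nonneg (hx p) (hx q))
  have h1 := mul_mul_le hx (by omega : 1 ≤ p + q) hp hq
  have h2 : ((q : ℝ) + 1) / (p + 1) * (x r * (x p * x q)) ≤
      2 * (√r * x r) * convTerm x p q := by
    have h3 := cast_le_sqrt_mul_sqrt hq
    have h4 : (1 : ℝ) ≤ q := by exact_mod_cast hq1
    have h5 : ((q : ℝ) + 1) / (p + 1) ≤ 2 * (√q * √r) / (p + 1) := by
      gcongr
      linarith
    refine (mul_le_mul_of_nonneg_right h5 hnn).trans (le_of_eq ?_)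
    rw [convTerm]
    ring
  have h3 : ((p : ℝ) + q + 2) / (p + 1) = 1 + ((q : ℝ) + 1) / (p + 1) := by
    field_simp
    ring
  have h4 := mul_le_mul_of_nonneg_right hw hnn
  rw [h3] at h4
  linarith

/-- `convTerm` is not symmetric, but reversing the order of summation shows that both orders of the
arguments give partial sums of the same convolution. -/
theorem sum_convTerm_le (hx : ∀ r, 0 ≤ x r) (s : ℕ) :
    ∑ t ∈ Finset.range s, (4 * convTerm x t (s - t) + 2 * convTerm x (s - t) t) ≤
      6 * conv x s := by
  have h1 : ∑ t ∈ Finset.range s, convTerm x t (s - t) ≤ conv x s := by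
    rw [conv, Finset.sum_range_succ]
    linarith [convTerm_nonneg hx s (s - s)]
  have h2 : ∑ t ∈ Finset.range s, convTerm x (s - t) t ≤ conv x s := by
    have hr : conv x s =
        ∑ t ∈ Finset.range (s + 1), convTerm x (s + 1 - 1 - t) (s - (s + 1 - 1 - t)) :=
      (Finset.sum_range_reflect (fun t => convTerm x t (s - t)) (s + 1)).symm
    rw [hr, Finset.sum_range_succ]
    have := convTerm_nonneg hx (s + 1 - 1 - s) (s - (s + 1 - 1 - s))
    have e : ∑ t ∈ Finset.range s, convTerm x (s - t) t =
        ∑ t ∈ Finset.range s, convTerm x (s + 1 - 1 - t) (s - (s + 1 - 1 - t)) := by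
      refine Finset.sum_congr rfl fun t ht => ?_
      rw [Finset.mem_range] at ht
      rw [show s + 1 - 1 - t = s - t by omega, show s - (s - t) = t by omega]
    linarith
  rw [Finset.sum_add_distrib, ← Finset.mul_sum, ← Finset.mul_sum]
  linarith

theorem sum_convTerm_reflect_le (hx : ∀ r, 0 ≤ x r) (s : ℕ) :
    ∑ t ∈ Finset.range s, (4 * convTerm x (s - 1 - t) (t + 1) +
      2 * convTerm x (t + 1) (s - 1 - t)) ≤ 6 * conv x s := by
  refine le_trans (le_of_eq ?_) (sum_convTerm_le hx s)
  rw [← Finset.sum_range_reflect]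
  refine Finset.sum_congr rfl fun t ht => ?_
  rw [Finset.mem_range] at ht
  rw [show s - 1 - (s - 1 - t) = t by omega, show s - 1 - t + 1 = s - t by omega]

end

/-! ### Leibniz sums in terms of normalized sequences -/

/-- The normalized norm `e^{rσ} / (r+1)! ‖u^{(r+1)}‖`, with `θ = e^σ`. -/
def seqU (θ : ℝ) (U : ℕ → ℝ) (r : ℕ) : ℝ := θ ^ r / (r + 1)! * U (r + 1)

/-- The normalized norm `e^{rσ} / r! ‖v^{(r)}‖`, with `θ = e^σ`. -/
def seqV (θ : ℝ) (V : ℕ → ℝ) (r : ℕ) : ℝ := θ ^ r / r ! * V r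

/-- The sum of the normalized norms. -/
def seqUV (θ : ℝ) (U V : ℕ → ℝ) (r : ℕ) : ℝ := seqU θ U r + seqV θ V r

section

variable {θ : ℝ} {U V : ℕ → ℝ}

theorem eq_seqU (hθ : 0 < θ) (i : ℕ) : U (i + 1) = (i + 1)! / θ ^ i * seqU θ U i := by
  rw [seqU]
  have := Nat.factorial_pos (i + 1)
  field_simp

theorem eq_seqV (hθ : 0 < θ) (i : ℕ) : V i = i ! / θ ^ i * seqV θ V i := by
  rw [seqV]
  have := Nat.factorial_pos i
  field_simp

theorem seqU_nonneg (hθ : 0 < θ) (hU : ∀ k, 0 ≤ U k) (r : ℕ) : 0 ≤ seqU θ U r := by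
  have := hU (r + 1)
  unfold seqU
  positivity

theorem seqV_nonneg (hθ : 0 < θ) (hV : ∀ k, 0 ≤ V k) (r : ℕ) : 0 ≤ seqV θ V r := by
  have := hV r
  unfold seqV
  positivity

theorem seqUV_nonneg (hθ : 0 < θ) (hU : ∀ k, 0 ≤ U k) (hV : ∀ k, 0 ≤ V k) (r : ℕ) :
    0 ≤ seqUV θ U V r := add_nonneg (seqU_nonneg hθ hU r) (seqV_nonneg hθ hV r)

theorem seqU_le (hθ : 0 < θ) (hV : ∀ k, 0 ≤ V k) (r : ℕ) : seqU θ U r ≤ seqUV θ U V r :=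
  le_add_of_nonneg_right (seqV_nonneg hθ hV r)

theorem seqV_le (hθ : 0 < θ) (hU : ∀ k, 0 ≤ U k) (r : ℕ) : seqV θ V r ≤ seqUV θ U V r :=
  le_add_of_nonneg_left (seqU_nonneg hθ hU r)

theorem mul_mul_mono {a b c x y z : ℝ} (ha : 0 ≤ a) (hb : 0 ≤ b) (hc : 0 ≤ c) (hax : a ≤ x)
    (hby : b ≤ y) (hcz : c ≤ z) : a * (b * c) ≤ x * (y * z) :=
  mul_le_mul hax (mul_le_mul hby hcz hc (hb.trans hby)) (mul_nonneg hb hc) (ha.trans hax)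

theorem cast_choose_eq {n i j : ℕ} (h : n = i + j) : (n.choose i : ℝ) = n ! / (i ! * j !) := by
  subst h
  exact Nat.cast_add_choose ℝ

/-- The factorials cancel the binomial coefficient exactly. The lower indices add up to one less
than the top one, which leaves one factor `θ`. -/
theorem leibniz_uuu (hθ : 0 < θ) (hU : ∀ k, 0 ≤ U k) (hV : ∀ k, 0 ≤ V k) (i j : ℕ) :
    θ ^ (2 * (i + j + 1)) / ((i + j + 2)! : ℝ) ^ 2 * U (i + j + 2) *
        (((i + j + 2).choose (i + 1) : ℝ) * (U (i + 1) * U (j + 1))) ≤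
      θ * (seqUV θ U V (i + j + 1) * (seqUV θ U V i * seqUV θ U V j)) := by
  have h := mul_mul_mono (seqU_nonneg hθ hU (i + j + 1)) (seqU_nonneg hθ hU i)
    (seqU_nonneg hθ hU j) (seqU_le (U := U) hθ hV (i + j + 1)) (seqU_le (U := U) hθ hV i)
    (seqU_le (U := U) hθ hV j)
  refine le_trans (le_of_eq ?_) (mul_le_mul_of_nonneg_left h hθ.le)
  rw [cast_choose_eq (show i + j + 2 = (i + 1) + (j + 1) by omega), eq_seqU (U := U) hθ i, eq_seqU (U := U) hθ j,
    eq_seqU (U := U) hθ (i + j + 1)]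
  have h1 := Nat.factorial_pos (i + 1)
  have h2 := Nat.factorial_pos (j + 1)
  have h3 := Nat.factorial_pos (i + j + 2)
  field_simp
  ring

/-- Here the order of the first factor has been lowered, so its factorial no longer matches the
binomial coefficient. The mismatch is the ratio `(q+1)/(p+2)`. -/
theorem leibniz_uuu' (hθ : 0 < θ) (hU : ∀ k, 0 ≤ U k) (hV : ∀ k, 0 ≤ V k) (p q : ℕ) :
    θ ^ (2 * (p + q + 1)) / ((p + q + 2)! : ℝ) ^ 2 * U (p + q + 2) *
        (((p + q + 2).choose (p + 2) : ℝ) * (U (p + 1) * U (q + 1))) ≤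
      θ * (((q : ℝ) + 1) / (p + 2) *
        (seqUV θ U V (p + q + 1) * (seqUV θ U V p * seqUV θ U V q))) := by
  have h := mul_mul_mono (seqU_nonneg hθ hU (p + q + 1)) (seqU_nonneg hθ hU p)
    (seqU_nonneg hθ hU q) (seqU_le (U := U) hθ hV (p + q + 1)) (seqU_le (U := U) hθ hV p)
    (seqU_le (U := U) hθ hV q)
  refine le_trans (le_of_eq ?_) (mul_le_mul_of_nonneg_left (mul_le_mul_of_nonneg_left h
    (by positivity : 0 ≤ ((q : ℝ) + 1) / (p + 2))) hθ.le)
  rw [cast_choose_eq (show p + q + 2 = (p + 2) + q by omega), eq_seqU (U := U) hθ p, eq_seqU (U := U) hθ q,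
    eq_seqU (U := U) hθ (p + q + 1), Nat.factorial_succ (p + 1), Nat.factorial_succ q]
  have h1 := Nat.factorial_pos (p + 1)
  have h2 := Nat.factorial_pos q
  have h3 := Nat.factorial_pos (p + q + 2)
  push_cast
  field_simp
  ring

/-- Since `v` is normalized by `p!` and not `(p+1)!`, a gain `1/(p+1)` remains. The lower indices
add up to the top one, so there is no factor `θ`. -/
theorem leibniz_uvv (hθ : 0 < θ) (hU : ∀ k, 0 ≤ U k) (hV : ∀ k, 0 ≤ V k) (p q : ℕ) :
    θ ^ (2 * (p + q)) / ((p + q + 1)! : ℝ) ^ 2 * U (p + q + 1) *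
        (((p + q + 1).choose (p + 1) : ℝ) * (V p * V q)) ≤
      seqUV θ U V (p + q) * (seqUV θ U V p * seqUV θ U V q) / (p + 1) := by
  have h := mul_mul_mono (seqU_nonneg hθ hU (p + q)) (seqV_nonneg hθ hV p)
    (seqV_nonneg hθ hV q) (seqU_le (U := U) hθ hV (p + q)) (seqV_le (V := V) hθ hU p)
    (seqV_le (V := V) hθ hU q)
  refine le_trans (le_of_eq ?_) (div_le_div_of_nonneg_right h
    (by positivity : 0 ≤ (p : ℝ) + 1))
  rw [cast_choose_eq (show p + q + 1 = (p + 1) + q by omega), eq_seqV (V := V) hθ p, eq_seqV (V := V) hθ q,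
    eq_seqU (U := U) hθ (p + q), Nat.factorial_succ p]
  have h1 := Nat.factorial_pos p
  have h2 := Nat.factorial_pos q
  have h3 := Nat.factorial_pos (p + q + 1)
  push_cast
  field_simp
  ring

/-- The top factor is now normalized by a factorial one order lower, which costs the numerator
`p+q+2`. The denominator comes from the lowered order of `u`, or from that of `v` in the companion
estimate. -/
theorem leibniz_vuv (hθ : 0 < θ) (hU : ∀ k, 0 ≤ U k) (hV : ∀ k, 0 ≤ V k) (p q : ℕ) :
    θ ^ (2 * (p + q + 1)) / ((p + q + 1)! : ℝ) ^ 2 * V (p + q + 1) *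
        (((p + q + 2).choose (p + 2) : ℝ) * (U (p + 1) * V q)) ≤
      θ * (((p : ℝ) + q + 2) / (p + 2) *
        (seqUV θ U V (p + q + 1) * (seqUV θ U V p * seqUV θ U V q))) := by
  have h := mul_mul_mono (seqV_nonneg hθ hV (p + q + 1)) (seqU_nonneg hθ hU p)
    (seqV_nonneg hθ hV q) (seqV_le (V := V) hθ hU (p + q + 1)) (seqU_le (U := U) hθ hV p)
    (seqV_le (V := V) hθ hU q)
  refine le_trans (le_of_eq ?_) (mul_le_mul_of_nonneg_left (mul_le_mul_of_nonneg_left h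
    (by positivity : 0 ≤ ((p : ℝ) + q + 2) / (p + 2))) hθ.le)
  rw [cast_choose_eq (show p + q + 2 = (p + 2) + q by omega), eq_seqU (U := U) hθ p, eq_seqV (V := V) hθ q,
    eq_seqV (V := V) hθ (p + q + 1), Nat.factorial_succ (p + 1), Nat.factorial_succ (p + q + 1)]
  have h1 := Nat.factorial_pos (p + 1)
  have h2 := Nat.factorial_pos q
  have h3 := Nat.factorial_pos (p + q + 1)
  push_cast
  field_simp
  ring

theorem leibniz_vuv' (hθ : 0 < θ) (hU : ∀ k, 0 ≤ U k) (hV : ∀ k, 0 ≤ V k) (p q : ℕ) :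
    θ ^ (2 * (p + q + 1)) / ((p + q + 1)! : ℝ) ^ 2 * V (p + q + 1) *
        (((p + q + 2).choose (q + 1) : ℝ) * (U (q + 1) * V p)) ≤
      θ * (((p : ℝ) + q + 2) / (p + 1) *
        (seqUV θ U V (p + q + 1) * (seqUV θ U V p * seqUV θ U V q))) := by
  have h := mul_mul_mono (seqV_nonneg hθ hV (p + q + 1)) (seqV_nonneg hθ hV p)
    (seqU_nonneg hθ hU q) (seqV_le (V := V) hθ hU (p + q + 1)) (seqV_le (V := V) hθ hU p)
    (seqU_le (U := U) hθ hV q)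
  refine le_trans (le_of_eq ?_) (mul_le_mul_of_nonneg_left (mul_le_mul_of_nonneg_left h
    (by positivity : 0 ≤ ((p : ℝ) + q + 2) / (p + 1))) hθ.le)
  rw [cast_choose_eq (show p + q + 2 = (q + 1) + (p + 1) by omega), eq_seqU (U := U) hθ q, eq_seqV (V := V) hθ p,
    eq_seqV (V := V) hθ (p + q + 1), Nat.factorial_succ p, Nat.factorial_succ (p + q + 1)]
  have h1 := Nat.factorial_pos p
  have h2 := Nat.factorial_pos (q + 1)
  have h3 := Nat.factorial_pos (p + q + 1)
  push_cast
  field_simp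
  ring

theorem leibniz_sum_uuu_le (hθ : 0 < θ) (hU : ∀ k, 0 ≤ U k) (hV : ∀ k, 0 ≤ V k) (r : ℕ) :
    θ ^ (2 * r) / ((r + 1)! : ℝ) ^ 2 * (U (r + 1) * ∑ t ∈ Finset.range (r - 1),
        ((r + 1).choose (t + 2) : ℝ) * (U (t + 2) * U (r - 1 - t) + U (t + 1) * U (r - t))) ≤
      12 * θ * (√r * seqUV θ U V r * conv (seqUV θ U V) (r - 1)) := by
  have hx := seqUV_nonneg hθ hU hV
  have hy : 0 ≤ √r * seqUV θ U V r := mul_nonneg (Real.sqrt_nonneg _) (hx r)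
  cases r with
  | zero => simp
  | succ s =>
    simp only [Nat.add_sub_cancel]
    rw [← mul_assoc, Finset.mul_sum]
    have h1 : ∀ t ∈ Finset.range s, θ ^ (2 * (s + 1)) / ((s + 1 + 1)! : ℝ) ^ 2 * U (s + 1 + 1) *
        (((s + 1 + 1).choose (t + 2) : ℝ) * (U (t + 2) * U (s - t) + U (t + 1) * U (s + 1 - t))) ≤
        θ * (√(s + 1 : ℕ) * seqUV θ U V (s + 1)) *
          ((4 * convTerm (seqUV θ U V) (s - 1 - t) (t + 1) +
            2 * convTerm (seqUV θ U V) (t + 1) (s - 1 - t)) +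
          (4 * convTerm (seqUV θ U V) t (s - t) + 2 * convTerm (seqUV θ U V) (s - t) t)) := by
      intro t ht
      rw [Finset.mem_range] at ht
      obtain ⟨q, rfl⟩ : ∃ q, s = t + 1 + q := ⟨s - t - 1, by omega⟩
      have e1 := leibniz_uuu hθ hU hV (t + 1) q
      have e2 := leibniz_uuu' hθ hU hV t (q + 1)
      -- The weight `√` must sit on a positive index, so it is given to `t + 1` here and to `q + 1`
      -- in the next bound.
      have f1 := mul_mul_mul_le hx (p := q) (q := t + 1) (r := t + 1 + q + 1) (w := 1) (by omega)
        (by omega) (by omega) (by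
          rw [le_div_iff₀ (by positivity)]
          push_cast
          linarith [(Nat.cast_nonneg t : (0 : ℝ) ≤ t)])
      have f2 := mul_mul_mul_le hx (p := t) (q := q + 1) (r := t + 1 + q + 1)
        (w := (((q + 1 : ℕ) : ℝ) + 1) / (t + 2)) (by omega) (by omega) (by omega) (by
          rw [div_le_div_iff₀ (by positivity) (by positivity)]
          push_cast
          have ht0 : (0 : ℝ) ≤ t := Nat.cast_nonneg t
          have hq0 : (0 : ℝ) ≤ q := Nat.cast_nonneg q
          nlinarith [mul_nonneg ht0 hq0])
      rw [one_mul, mul_comm (seqUV θ U V q)] at f1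
      rw [show t + (q + 1) + 1 = t + 1 + q + 1 by omega,
        show t + (q + 1) + 2 = t + 1 + q + 2 by omega] at e2
      have g1 := mul_le_mul_of_nonneg_left f1 hθ.le
      have g2 := mul_le_mul_of_nonneg_left f2 hθ.le
      have k1 := e1.trans g1
      have k2 := e2.trans g2
      rw [show t + 1 + q - 1 - t = q by omega, show t + 1 + q - t = q + 1 by omega,
        show t + 1 + q + 1 - t = q + 1 + 1 by omega, show t + 1 + q + 1 + 1 = t + 1 + q + 2 by omega]
      linarith
    refine (Finset.sum_le_sum h1).trans ?_
    rw [← Finset.mul_sum, Finset.sum_add_distrib]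
    have h2 := add_le_add (sum_convTerm_reflect_le hx s) (sum_convTerm_le hx s)
    have h3 := mul_le_mul_of_nonneg_left h2 (mul_nonneg hθ.le hy)
    linarith

theorem leibniz_sum_vuv_le (hθ : 0 < θ) (hU : ∀ k, 0 ≤ U k) (hV : ∀ k, 0 ≤ V k) (r : ℕ) :
    θ ^ (2 * r) / (r ! : ℝ) ^ 2 * (V r * ∑ t ∈ Finset.range (r - 1),
        ((r + 1).choose (t + 2) : ℝ) * (U (t + 2) * V (r - 2 - t) + U (t + 1) * V (r - 1 - t))) ≤
      12 * θ * (√r * seqUV θ U V r * conv (seqUV θ U V) (r - 1)) := by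
  have hx := seqUV_nonneg hθ hU hV
  have hy : 0 ≤ √r * seqUV θ U V r := mul_nonneg (Real.sqrt_nonneg _) (hx r)
  cases r with
  | zero => simp
  | succ s =>
    simp only [Nat.add_sub_cancel]
    rw [← mul_assoc, Finset.mul_sum]
    have h1 : ∀ t ∈ Finset.range s, θ ^ (2 * (s + 1)) / ((s + 1)! : ℝ) ^ 2 * V (s + 1) *
        (((s + 1 + 1).choose (t + 2) : ℝ) *
          (U (t + 2) * V (s + 1 - 2 - t) + U (t + 1) * V (s - t))) ≤
        θ * (√(s + 1 : ℕ) * seqUV θ U V (s + 1)) *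
          ((4 * convTerm (seqUV θ U V) (s - 1 - t) (t + 1) +
            2 * convTerm (seqUV θ U V) (t + 1) (s - 1 - t)) +
          (4 * convTerm (seqUV θ U V) t (s - t) + 2 * convTerm (seqUV θ U V) (s - t) t)) := by
      intro t ht
      rw [Finset.mem_range] at ht
      obtain ⟨q, rfl⟩ : ∃ q, s = t + 1 + q := ⟨s - t - 1, by omega⟩
      have e1 := leibniz_vuv' hθ hU hV q (t + 1)
      have e2 := leibniz_vuv hθ hU hV t (q + 1)
      have f1 := mul_mul_mul_le hx (p := q) (q := t + 1) (r := t + 1 + q + 1)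
        (w := ((q : ℝ) + (t + 1 : ℕ) + 2) / (q + 1)) (by omega) (by omega) (by omega) le_rfl
      have f2 := mul_mul_mul_le hx (p := t) (q := q + 1) (r := t + 1 + q + 1)
        (w := ((t : ℝ) + (q + 1 : ℕ) + 2) / (t + 2)) (by omega) (by omega) (by omega) (by
          gcongr
          norm_num)
      rw [show t + (q + 1) + 1 = t + 1 + q + 1 by omega,
        show t + (q + 1) + 2 = t + 1 + q + 2 by omega] at e2
      rw [show q + (t + 1) + 1 = t + 1 + q + 1 by omega,
        show q + (t + 1) + 2 = t + 1 + q + 2 by omega] at e1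
      have g1 := mul_le_mul_of_nonneg_left f1 hθ.le
      have g2 := mul_le_mul_of_nonneg_left f2 hθ.le
      have k1 := e1.trans g1
      have k2 := e2.trans g2
      rw [show t + 1 + q - 1 - t = q by omega, show t + 1 + q - t = q + 1 by omega,
        show t + 1 + q + 1 - 2 - t = q by omega, show t + 1 + q + 1 + 1 = t + 1 + q + 2 by omega]
      linarith
    refine (Finset.sum_le_sum h1).trans ?_
    rw [← Finset.mul_sum, Finset.sum_add_distrib]
    have h2 := add_le_add (sum_convTerm_reflect_le hx s) (sum_convTerm_le hx s)
    have h3 := mul_le_mul_of_nonneg_left h2 (mul_nonneg hθ.le hy)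
    linarith

/-- The gain `1/(t+1)` is already present, and `√(r-t) √r ≥ 1` because `t < r`. -/
theorem leibniz_sum_uvv_le (hθ : 0 < θ) (hU : ∀ k, 0 ≤ U k) (hV : ∀ k, 0 ≤ V k) (r : ℕ) :
    θ ^ (2 * r) / ((r + 1)! : ℝ) ^ 2 * (U (r + 1) * ∑ t ∈ Finset.range r,
        ((r + 1).choose (t + 1) : ℝ) * (V t * V (r - t))) ≤
      √r * seqUV θ U V r * conv (seqUV θ U V) r := by
  have hx := seqUV_nonneg hθ hU hV
  have hy : 0 ≤ √r * seqUV θ U V r := mul_nonneg (Real.sqrt_nonneg _) (hx r)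
  rw [← mul_assoc, Finset.mul_sum, conv, Finset.sum_range_succ, mul_add, Finset.mul_sum]
  refine le_add_of_le_of_nonneg (Finset.sum_le_sum fun t ht => ?_)
    (mul_nonneg hy (convTerm_nonneg hx _ _))
  rw [Finset.mem_range] at ht
  obtain ⟨q, rfl⟩ : ∃ q, r = t + q := ⟨r - t, by omega⟩
  rw [Nat.add_sub_cancel_left]
  refine (leibniz_uvv hθ hU hV t q).trans ?_
  have hq : (1 : ℝ) ≤ q := by exact_mod_cast (by omega : 1 ≤ q)
  have h1 : (1 : ℝ) ≤ √q * √(t + q : ℕ) := hq.trans (cast_le_sqrt_mul_sqrt (by omega))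
  have h2 : 0 ≤ seqUV θ U V (t + q) * (seqUV θ U V t * seqUV θ U V q) / (t + 1) :=
    div_nonneg (mul_nonneg (hx _) (mul_nonneg (hx _) (hx _))) (by positivity)
  have h3 := mul_le_mul_of_nonneg_right h1 h2
  rw [one_mul] at h3
  refine h3.trans (le_of_eq ?_)
  rw [convTerm]
  ring

/-- For `r ≥ 2` the lower indices add up to `r - 1 ≥ 1` and the convolution bound applies. For `r =
1` the product `S θ x₀ x₁` is split by the inequality between arithmetic and geometric means, whence
`θ²`. -/
theorem leibnizSqBound_le (hθ : 0 < θ) (hU : ∀ k, 0 ≤ U k) (hV : ∀ k, 0 ≤ V k) {S : ℝ}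
    (hS : 0 ≤ S) (r : ℕ) :
    θ ^ (2 * r) / ((r + 1)! : ℝ) ^ 2 * (U (r + 1) * leibnizSqBound S U r) ≤
      (if r = 1 then S * (seqUV θ U V 0 ^ 2 + θ ^ 2 * seqUV θ U V 1 ^ 2) else 0) +
        12 * θ * (√r * seqUV θ U V r * conv (seqUV θ U V) (r - 1)) := by
  have hx := seqUV_nonneg hθ hU hV
  have hy : 0 ≤ √r * seqUV θ U V r := mul_nonneg (Real.sqrt_nonneg _) (hx r)
  have hc := mul_nonneg (mul_nonneg (by norm_num : (0 : ℝ) ≤ 12) hθ.le)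
    (mul_nonneg hy (conv_nonneg hx (r - 1)))
  rw [leibnizSqBound]
  split_ifs with h
  · subst h
    refine le_add_of_le_of_nonneg ?_ hc
    have h1 := mul_le_mul (seqU_le (U := U) hθ hV 1) (seqU_le (U := U) hθ hV 0)
      (seqU_nonneg hθ hU 0) (hx 1)
    have e : θ ^ (2 * 1) / ((1 + 1)! : ℝ) ^ 2 * (U (1 + 1) * (S * U 1)) =
        S * (θ / 2 * (seqU θ U 1 * seqU θ U 0)) := by
      simp only [seqU, Nat.factorial]
      push_cast
      ring
    rw [e]
    refine mul_le_mul_of_nonneg_left ?_ hS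
    have h2 := mul_le_mul_of_nonneg_left h1 (by positivity : 0 ≤ θ / 2)
    nlinarith [sq_nonneg (seqUV θ U V 0 - θ * seqUV θ U V 1), sq_nonneg (seqUV θ U V 0),
      sq_nonneg (θ * seqUV θ U V 1)]
  · rw [zero_add]
    cases r with
    | zero => simp
    | succ s =>
      rw [← mul_assoc, Finset.mul_sum]
      have h1 : ∀ t ∈ Finset.range (s + 1),
          θ ^ (2 * (s + 1)) / ((s + 1 + 1)! : ℝ) ^ 2 * U (s + 1 + 1) *
            (((s + 1 + 1).choose (t + 1) : ℝ) * (U (t + 1) * U (s + 1 - t))) ≤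
          θ * (2 * (√(s + 1 : ℕ) * seqUV θ U V (s + 1))) *
            (convTerm (seqUV θ U V) t (s - t) + convTerm (seqUV θ U V) (s - t) t) := by
        intro t ht
        rw [Finset.mem_range] at ht
        obtain ⟨q, rfl⟩ : ∃ q, s = t + q := ⟨s - t, by omega⟩
        have e1 := leibniz_uuu hθ hU hV t q
        have f1 := mul_mul_le hx (p := t) (q := q) (r := t + q + 1) (by omega) (by omega) (by omega)
        have g1 := e1.trans (mul_le_mul_of_nonneg_left f1 hθ.le)
        rw [Nat.add_sub_cancel_left, show t + q + 1 - t = q + 1 by omega]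
        linarith
      refine (Finset.sum_le_sum h1).trans ?_
      rw [← Finset.mul_sum, Finset.sum_add_distrib]
      have h2 : ∑ t ∈ Finset.range (s + 1), convTerm (seqUV θ U V) (s - t) t =
          conv (seqUV θ U V) s := by
        rw [conv, ← Finset.sum_range_reflect]
        refine Finset.sum_congr rfl fun t ht => ?_
        rw [Finset.mem_range] at ht
        rw [show s + 1 - 1 - t = s - t by omega, show s - (s - t) = t by omega]
      have h3 : ∑ t ∈ Finset.range (s + 1), convTerm (seqUV θ U V) t (s - t) =
          conv (seqUV θ U V) s := rfl
      rw [h2, h3, Nat.add_sub_cancel]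
      have h4 := mul_nonneg hθ.le (mul_nonneg hy (conv_nonneg hx s))
      linarith

end

/-! ### The functional `Φ` in terms of the normalized sequences -/

/-- The sequence `‖f^{(k)}‖₂`. -/
def normSeq (f : RealL2) (k : ℕ) : ℝ := sobolevNorm 2 (iterDx k f)

theorem normSeq_nonneg (f : RealL2) (k : ℕ) : 0 ≤ normSeq f k := sobolevNorm_nonneg _ _

theorem Phi₁_eq (σ : ℝ) (m : ℕ) (u : RealL2) :
    Phi₁ σ m u = (1 / 2) * ∑ r ∈ Finset.range (m + 1),
      Real.exp (2 * r * σ) / ((r + 1)! : ℝ) ^ 2 * normSeq u (r + 1) ^ 2 := by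
  rw [Phi₁]
  congr 1
  refine Finset.sum_nbij' (fun j => j - 1) (fun r => r + 1) ?_ ?_ ?_ ?_ ?_
  · intro j hj
    rw [Finset.mem_Icc] at hj
    rw [Finset.mem_range]
    omega
  · intro r hr
    rw [Finset.mem_range] at hr
    rw [Finset.mem_Icc]
    omega
  · intro j hj
    rw [Finset.mem_Icc] at hj
    exact Nat.sub_add_cancel hj.1
  · intro r _
    exact Nat.add_sub_cancel r 1
  · intro j hj
    rw [Finset.mem_Icc] at hj
    rw [Nat.sub_add_cancel hj.1, Nat.cast_sub hj.1, Nat.cast_one, normSeq]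

theorem exp_two_mul (σ : ℝ) (r : ℕ) : Real.exp (2 * r * σ) = Real.exp σ ^ (2 * r) := by
  rw [← Real.exp_nat_mul]
  push_cast
  ring_nf

theorem seqU_sq (θ : ℝ) (U : ℕ → ℝ) (r : ℕ) :
    seqU θ U r ^ 2 = θ ^ (2 * r) / ((r + 1)! : ℝ) ^ 2 * U (r + 1) ^ 2 := by
  rw [seqU, mul_pow, div_pow, ← pow_mul, mul_comm r 2]

theorem seqV_sq (θ : ℝ) (V : ℕ → ℝ) (r : ℕ) :
    seqV θ V r ^ 2 = θ ^ (2 * r) / (r ! : ℝ) ^ 2 * V r ^ 2 := by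
  rw [seqV, mul_pow, div_pow, ← pow_mul, mul_comm r 2]

theorem Phi_eq (σ : ℝ) (m : ℕ) (u v : RealL2) :
    Phi σ m u v = (1 / 2) * ∑ r ∈ Finset.range (m + 1),
      (seqU (Real.exp σ) (normSeq u) r ^ 2 + seqV (Real.exp σ) (normSeq v) r ^ 2) := by
  rw [Phi, Phi₁_eq, Phi₂, ← mul_add, ← Finset.sum_add_distrib]
  simp only [seqU_sq, seqV_sq, exp_two_mul, normSeq]

/-- Only the exponential `e^{2rτ}` depends on `τ`; the factor `2r` cancels the `½`. Hence a factor
`r` in a sum of squares is paid for by `∂_σ Φ`. -/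
theorem dσPhi_eq (σ : ℝ) (m : ℕ) (u v : RealL2) :
    dσPhi σ m u v = ∑ r ∈ Finset.range (m + 1),
      r * (seqU (Real.exp σ) (normSeq u) r ^ 2 + seqV (Real.exp σ) (normSeq v) r ^ 2) := by
  have h : ∀ r ∈ Finset.range (m + 1), HasDerivAt
      (fun τ => seqU (Real.exp τ) (normSeq u) r ^ 2 + seqV (Real.exp τ) (normSeq v) r ^ 2)
      (2 * r * (seqU (Real.exp σ) (normSeq u) r ^ 2 + seqV (Real.exp σ) (normSeq v) r ^ 2))
      σ := by
    intro r _
    simp only [seqU_sq, seqV_sq, ← exp_two_mul]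
    have he : HasDerivAt (fun τ : ℝ => Real.exp (2 * r * τ)) (Real.exp (2 * r * σ) * (2 * r)) σ := by
      simpa using ((hasDerivAt_id σ).const_mul (2 * r : ℝ)).exp
    have := ((he.div_const (((r + 1)! : ℝ) ^ 2)).mul_const (normSeq u (r + 1) ^ 2)).add
      ((he.div_const ((r ! : ℝ) ^ 2)).mul_const (normSeq v r ^ 2))
    convert! this using 1
    ring
  rw [dσPhi]
  simp only [Phi_eq]
  rw [((HasDerivAt.fun_sum h).const_mul (1 / 2 : ℝ)).deriv, Finset.mul_sum]
  refine Finset.sum_congr rfl fun r _ => ?_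
  ring

section

variable (σ : ℝ) (m : ℕ) (u v : RealL2)

/-- The sequence of the sums of the normalized norms of the derivatives of `u` and `v`. -/
def normUV : ℕ → ℝ := seqUV (Real.exp σ) (normSeq u) (normSeq v)

theorem normUV_nonneg (r : ℕ) : 0 ≤ normUV σ u v r :=
  seqUV_nonneg (Real.exp_pos σ) (normSeq_nonneg u) (normSeq_nonneg v) r

theorem normUV_sq_le (r : ℕ) : normUV σ u v r ^ 2 ≤
    2 * (seqU (Real.exp σ) (normSeq u) r ^ 2 + seqV (Real.exp σ) (normSeq v) r ^ 2) := by
  rw [normUV, seqUV]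
  nlinarith [sq_nonneg (seqU (Real.exp σ) (normSeq u) r - seqV (Real.exp σ) (normSeq v) r)]

theorem Phi_nonneg : 0 ≤ Phi σ m u v := by
  rw [Phi_eq]
  exact mul_nonneg (by norm_num) (Finset.sum_nonneg fun _ _ => by positivity)

theorem dσPhi_nonneg : 0 ≤ dσPhi σ m u v := by
  rw [dσPhi_eq]
  exact Finset.sum_nonneg fun _ _ => by positivity

theorem sum_normUV_sq_le :
    ∑ r ∈ Finset.range (m + 1), normUV σ u v r ^ 2 ≤ 4 * Phi σ m u v := by
  refine (Finset.sum_le_sum fun r _ => normUV_sq_le σ u v r).trans (le_of_eq ?_)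
  rw [← Finset.mul_sum, Phi_eq]
  ring

theorem sum_mul_normUV_sq_le :
    ∑ r ∈ Finset.range (m + 1), r * normUV σ u v r ^ 2 ≤ 2 * dσPhi σ m u v := by
  refine (Finset.sum_le_sum fun r _ => mul_le_mul_of_nonneg_left (normUV_sq_le σ u v r)
    (Nat.cast_nonneg r)).trans (le_of_eq ?_)
  rw [dσPhi_eq, Finset.mul_sum]
  refine Finset.sum_congr rfl fun r _ => ?_
  ring

theorem sqrt_sum_normUV_sq_le :
    √(∑ r ∈ Finset.range (m + 1), normUV σ u v r ^ 2) ≤ 2 * √(Phi σ m u v) := by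
  refine (Real.sqrt_le_sqrt (sum_normUV_sq_le σ m u v)).trans (le_of_eq ?_)
  rw [Real.sqrt_mul (by norm_num), show (4 : ℝ) = 2 ^ 2 by norm_num, Real.sqrt_sq (by norm_num)]

/-- The bound of the summands of order `r` in `⟨F, DΦ⟩`. -/
def levelBound (S : ℝ) (r : ℕ) : ℝ :=
  (1 + S) * ((r + 1) * normUV σ u v r ^ 2) +
    (if r = 1 then S * (normUV σ u v 0 ^ 2 + Real.exp σ ^ 2 * normUV σ u v 1 ^ 2) else 0) +
    Real.exp σ * (√r * normUV σ u v r * conv (normUV σ u v) (r - 1)) +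
    √r * normUV σ u v r * conv (normUV σ u v) r

/-- The factor `r + 1` gives `Φ` and `∂_σ Φ`, the exceptional summand gives `S Φ` and `S e^{2σ} ∂_σ
Φ`, and the two convolutions give `Φ^{1/2} ∂_σ Φ` with and without `e^σ`. -/
theorem sum_levelBound_le (hm : 1 ≤ m) {S : ℝ} (hS : 0 ≤ S) :
    ∑ r ∈ Finset.range (m + 1), levelBound σ u v S r ≤
      (4 + 8 * S) * Phi σ m u v + (8 + 8 * Real.exp σ) * √(Phi σ m u v) * dσPhi σ m u v +
        (2 + (2 + 2 * Real.exp (2 * σ)) * S) * dσPhi σ m u v := by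
  have hx := normUV_nonneg σ u v
  have hθ := Real.exp_pos σ
  have hΦ := Phi_nonneg σ m u v
  have hd := dσPhi_nonneg σ m u v
  have hX := sum_normUV_sq_le σ m u v
  have hY := sum_mul_normUV_sq_le σ m u v
  have hsX := sqrt_sum_normUV_sq_le σ m u v
  have hexp : Real.exp (2 * σ) = Real.exp σ ^ 2 := by
    have := exp_two_mul σ 1
    simpa using this
  -- The coefficient 8 is `2 · 2 · 2`: the constant of the convolution estimate, `√4` from the bound
  -- by `4Φ`, and 2 from the bound by `2 ∂_σ Φ`.
  have c0 : 2 * √(∑ r ∈ Finset.range (m + 1), normUV σ u v r ^ 2) *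
      ∑ r ∈ Finset.range (m + 1), r * normUV σ u v r ^ 2 ≤
      8 * (√(Phi σ m u v) * dσPhi σ m u v) := by
    have := mul_le_mul hsX hY (Finset.sum_nonneg fun _ _ => by positivity) (by positivity)
    linarith
  have c1 := (sum_sqrt_mul_conv_pred_le hx m).trans c0
  have c2 := (sum_sqrt_mul_conv_le hx (m + 1)).trans c0
  have c3 := mul_le_mul_of_nonneg_left c1 hθ.le
  have hind : ∑ r ∈ Finset.range (m + 1),
      (if r = 1 then S * (normUV σ u v 0 ^ 2 + Real.exp σ ^ 2 * normUV σ u v 1 ^ 2) else 0) ≤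
      S * (4 * Phi σ m u v + Real.exp σ ^ 2 * (2 * dσPhi σ m u v)) := by
    rw [Finset.sum_ite_eq' (Finset.range (m + 1)) 1
      (fun _ => S * (normUV σ u v 0 ^ 2 + Real.exp σ ^ 2 * normUV σ u v 1 ^ 2)),
      if_pos (Finset.mem_range.2 (by omega))]
    have h0 := (Finset.single_le_sum (f := fun r => normUV σ u v r ^ 2)
      (fun r _ => sq_nonneg _) (Finset.mem_range.2 (Nat.succ_pos m))).trans hX
    have h1 := (Finset.single_le_sum (f := fun r : ℕ => (r : ℝ) * normUV σ u v r ^ 2)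
      (fun r _ => by positivity) (Finset.mem_range.2 (by omega : 1 < m + 1))).trans hY
    rw [Nat.cast_one, one_mul] at h1
    gcongr
  have hmain : ∑ r ∈ Finset.range (m + 1), (1 + S) * (((r : ℝ) + 1) * normUV σ u v r ^ 2) ≤
      (1 + S) * (4 * Phi σ m u v + 2 * dσPhi σ m u v) := by
    rw [← Finset.mul_sum]
    refine mul_le_mul_of_nonneg_left ?_ (by positivity)
    simp only [add_mul, one_mul, Finset.sum_add_distrib]
    linarith
  simp only [levelBound, Finset.sum_add_distrib, ← Finset.mul_sum] at *
  rw [hexp]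
  linarith

end

/-! ### The vector field `F` and the estimate of the summands of order `r` -/

/-- The nonlocal term `-α u + (3-β)/2 u² + β/2 uₓ² + v + 1/2 v²`. -/
def pressure (α β : ℝ) (u v : RealL2) : RealL2 :=
  -(α • u) + ((3 - β) / 2) • mul u u + (β / 2) • mul (dx u) (dx u) + v + (1 / 2 : ℝ) • mul v v

theorem F₁_eq (α β : ℝ) (u v : RealL2) :
    F₁ α β u v = -(β • mul u (dx u)) - lambdaInv (dx (pressure α β u v)) := rfl

section

variable {α β : ℝ} {u v : RealL2} {s : ℕ}

theorem pressure_mem_sobolev (hs : 1 ≤ s) (hu : u ∈ sobolevSubmodule (s + 1))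
    (hv : v ∈ sobolevSubmodule s) : pressure α β u v ∈ sobolevSubmodule s := by
  have hu' := mem_sobolev_of_le (Nat.le_succ s) hu
  have hd := dx_mem_sobolev hu
  exact add_mem (add_mem (add_mem (add_mem (neg_mem (Submodule.smul_mem _ _ hu'))
    (Submodule.smul_mem _ _ (mul_mem_sobolev hs hu' hu')))
    (Submodule.smul_mem _ _ (mul_mem_sobolev hs hd hd))) hv)
    (Submodule.smul_mem _ _ (mul_mem_sobolev hs hv hv))

theorem F₁_mem_sobolev (hu : u ∈ sobolevSubmodule (s + 2))
    (hv : v ∈ sobolevSubmodule (s + 1)) : F₁ α β u v ∈ sobolevSubmodule (s + 1) := by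
  have hu' := mem_sobolev_of_le (Nat.le_succ (s + 1)) hu
  have hp : pressure α β u v ∈ sobolevSubmodule (s + 1) :=
    pressure_mem_sobolev (by omega) hu hv
  exact sub_mem (neg_mem (Submodule.smul_mem _ _
    (mul_mem_sobolev (by omega) hu' (dx_mem_sobolev hu))))
    (mem_sobolev_of_le (by omega) (lambdaInv_mem_sobolev (dx_mem_sobolev hp)))

theorem F₂_mem_sobolev (hu : u ∈ sobolevSubmodule (s + 1))
    (hv : v ∈ sobolevSubmodule (s + 1)) : F₂ u v ∈ sobolevSubmodule s :=
  sub_mem (neg_mem (dx_mem_sobolev hu)) (dx_mem_sobolev (mul_mem_sobolev (by omega) hu hv))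

end

section

variable {α β S : ℝ} {u v : RealL2} {r : ℕ}

theorem sobolevNorm_one_iterDx_pressure_le (hu : u ∈ sobolevSubmodule (r + 4))
    (hv : v ∈ sobolevSubmodule (r + 4)) (hS : norm₃ u v ≤ S) :
    sobolevNorm 1 (iterDx (r + 1) (pressure α β u v)) ≤ |α| * normSeq u (r + 1) +
      (|(3 - β) / 2| + |β / 2|) * (6 * embConst *
        (S * normSeq u (r + 1) + leibnizSqBound S (normSeq u) r)) + normSeq v r +
      3 * embConst * (S * normSeq v r + ∑ t ∈ Finset.range r, ((r + 1).choose (t + 1) : ℝ) *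
        (normSeq v t * normSeq v (r - t))) := by
  have hu3 : sobolevNorm 3 u ≤ S := (le_add_of_nonneg_right (sobolevNorm_nonneg 3 v)).trans hS
  have hv3 : sobolevNorm 3 v ≤ S := (le_add_of_nonneg_left (sobolevNorm_nonneg 3 u)).trans hS
  have mu : u ∈ sobolevSubmodule (r + 2) := mem_sobolev_of_le (by omega) hu
  have mv : v ∈ sobolevSubmodule (r + 2) := mem_sobolev_of_le (by omega) hv
  have md : dx u ∈ sobolevSubmodule (r + 2) :=
    mem_sobolev_of_le (by omega) (dx_mem_sobolev (s := r + 3) hu)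
  have down : ∀ {f : RealL2}, f ∈ sobolevSubmodule (r + 2) → f ∈ sobolevSubmodule (r + 1) :=
    fun h => mem_sobolev_of_le (by omega) h
  have it : ∀ {f : RealL2}, f ∈ sobolevSubmodule (r + 2) →
      iterDx (r + 1) f ∈ sobolevSubmodule 1 :=
    fun h => iterDx_mem_sobolev (r + 1) (mem_sobolev_of_le (by omega) h)
  have m2 := mul_mem_sobolev (by omega) mu mu
  have m3 := mul_mem_sobolev (by omega) md md
  have m5 := mul_mem_sobolev (by omega) mv mv
  have sm : ∀ (a : ℝ) {f : RealL2}, f ∈ sobolevSubmodule (r + 2) →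
      a • f ∈ sobolevSubmodule (r + 2) := fun a _ h => Submodule.smul_mem _ a h
  have step : ∀ {f g : RealL2}, f ∈ sobolevSubmodule (r + 2) → g ∈ sobolevSubmodule (r + 2) →
      sobolevNorm 1 (iterDx (r + 1) (f + g)) ≤
        sobolevNorm 1 (iterDx (r + 1) f) + sobolevNorm 1 (iterDx (r + 1) g) := fun hf hg => by
    rw [iterDx_add (down hf) (down hg)]
    exact sobolevNorm_add_le (it hf) (it hg)
  have scale : ∀ (a : ℝ) {f : RealL2}, f ∈ sobolevSubmodule (r + 2) →
      sobolevNorm 1 (iterDx (r + 1) (a • f)) = |a| * sobolevNorm 1 (iterDx (r + 1) f) :=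
    fun a _ hf => by rw [iterDx_smul a (down hf), sobolevNorm_smul a (it hf)]
  have n1 : sobolevNorm 1 (iterDx (r + 1) u) ≤ normSeq u (r + 1) := sobolevNorm_mono one_le_two
    (iterDx_mem_sobolev (r + 1) (mem_sobolev_of_le (by omega) hu))
  have n4 : sobolevNorm 1 (iterDx (r + 1) v) ≤ normSeq v r := sobolevNorm_one_iterDx_succ_le mv
  have n2 := sobolevNorm_one_iterDx_sq_le hu hu3
  have n3 := sobolevNorm_one_iterDx_dx_sq_le hu hu3
  have n5 := sobolevNorm_one_iterDx_sq_le' hv hv3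
  have k1 := mul_le_mul_of_nonneg_left n1 (abs_nonneg α)
  have k2 := mul_le_mul_of_nonneg_left n2 (abs_nonneg ((3 - β) / 2))
  have k3 := mul_le_mul_of_nonneg_left n3 (abs_nonneg (β / 2))
  have e1 := scale (-α) mu
  have e2 := scale ((3 - β) / 2) m2
  have e3 := scale (β / 2) m3
  have e5 := scale (1 / 2) m5
  rw [abs_neg, neg_smul] at e1
  rw [abs_of_pos (by norm_num : (0 : ℝ) < 1 / 2)] at e5
  have p1 : -(α • u) ∈ sobolevSubmodule (r + 2) := neg_mem (sm α mu)
  have p2 := add_mem p1 (sm ((3 - β) / 2) m2)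
  have p3 := add_mem p2 (sm (β / 2) m3)
  have p4 := add_mem p3 mv
  have s1 := step p4 (sm (1 / 2) m5)
  have s2 := step p3 mv
  have s3 := step p2 (sm (β / 2) m3)
  have s4 := step p1 (sm ((3 - β) / 2) m2)
  unfold normSeq at *
  unfold pressure
  linarith

/-- `Λ⁻²∂ₓ` commutes with derivatives, so the H² norm of the nonlocal term is controlled by the H¹
norm of the differentiated pressure; no integration by parts is needed there. -/
theorem abs_inner₂_iterDx_F₁_le (hu : u ∈ sobolevSubmodule (r + 4))
    (hv : v ∈ sobolevSubmodule (r + 4)) (hS : norm₃ u v ≤ S) :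
    |inner₂ (iterDx (r + 1) u) (iterDx (r + 1) (F₁ α β u v))| ≤
      |β| * (110 * embConst * ((r + 1) * (S * normSeq u (r + 1) ^ 2) + normSeq u (r + 1) *
        ∑ t ∈ Finset.range (r - 1), ((r + 1).choose (t + 2) : ℝ) *
          (normSeq u (t + 2) * normSeq u (r - 1 - t) +
            normSeq u (t + 1) * normSeq u (r - t)))) +
      4 * (normSeq u (r + 1) * (|α| * normSeq u (r + 1) +
        (|(3 - β) / 2| + |β / 2|) * (6 * embConst *
          (S * normSeq u (r + 1) + leibnizSqBound S (normSeq u) r)) + normSeq v r +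
        3 * embConst * (S * normSeq v r + ∑ t ∈ Finset.range r, ((r + 1).choose (t + 1) : ℝ) *
          (normSeq v t * normSeq v (r - t))))) := by
  have hu3 : sobolevNorm 3 u ≤ S := (le_add_of_nonneg_right (sobolevNorm_nonneg 3 v)).trans hS
  have md : dx u ∈ sobolevSubmodule (r + 3) := dx_mem_sobolev hu
  have mu := mem_sobolev_of_le (show r + 3 ≤ r + 4 by omega) hu
  have mm := mul_mem_sobolev (by omega) mu md
  have mp : pressure α β u v ∈ sobolevSubmodule (r + 3) :=
    pressure_mem_sobolev (by omega) hu (mem_sobolev_of_le (by omega) hv)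
  have mpr := mem_sobolev_of_le (show r + 2 ≤ r + 3 by omega) mp
  have mdp : dx (pressure α β u v) ∈ sobolevSubmodule (r + 2) := dx_mem_sobolev mp
  have ml : lambdaInv (dx (pressure α β u v)) ∈ sobolevSubmodule (r + 3) :=
    mem_sobolev_of_le (by omega) (lambdaInv_mem_sobolev mdp)
  have dn : ∀ {f : RealL2}, f ∈ sobolevSubmodule (r + 3) → f ∈ sobolevSubmodule (r + 1) :=
    fun h => mem_sobolev_of_le (by omega) h
  have it : ∀ {f : RealL2}, f ∈ sobolevSubmodule (r + 3) →
      iterDx (r + 1) f ∈ sobolevSubmodule 2 :=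
    fun h => iterDx_mem_sobolev (r + 1) (mem_sobolev_of_le (by omega) h)
  have e : F₁ α β u v = (-β) • mul u (dx u) + (-1 : ℝ) • lambdaInv (dx (pressure α β u v)) := by
    rw [F₁_eq, neg_smul, neg_smul, one_smul, sub_eq_add_neg]
  have el : iterDx (r + 1) (lambdaInv (dx (pressure α β u v))) =
      lambdaInv (dx (iterDx (r + 1) (pressure α β u v))) := by
    rw [iterDx_lambdaInv (mem_sobolev_of_le (by omega) mdp), ← iterDx_succ', iterDx_succ]
  have e' : inner₂ (iterDx (r + 1) u) (iterDx (r + 1) (F₁ α β u v)) =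
      -β * inner₂ (iterDx (r + 1) u) (iterDx (r + 1) (mul u (dx u))) +
      -1 * inner₂ (iterDx (r + 1) u) (lambdaInv (dx (iterDx (r + 1) (pressure α β u v)))) := by
    rw [← el, e, iterDx_add (Submodule.smul_mem _ _ (dn mm)) (Submodule.smul_mem _ _ (dn ml)),
      iterDx_smul _ (dn mm), iterDx_smul _ (dn ml), inner₂_add_right
        (Submodule.smul_mem _ _ (it mm)) (Submodule.smul_mem _ _ (it ml)),
      inner₂_smul_right _ (it mm), inner₂_smul_right _ (it ml)]
  have b1 := abs_inner₂_iterDx_mul_dx_le hu hu3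
  have b2 := abs_inner₂_le (it mu) (el ▸ it ml)
  have b3 := (sobolevNorm_lambdaInv_dx_le (iterDx_mem_sobolev (s := 1) (r + 1)
    (mem_sobolev_of_le (by omega) mp))).trans
    (sobolevNorm_one_iterDx_pressure_le (α := α) (β := β) hu hv hS)
  have b4 := mul_le_mul_of_nonneg_left b3 (normSeq_nonneg u (r + 1))
  have b5 := mul_le_mul_of_nonneg_left b1 (abs_nonneg β)
  rw [e']
  refine (abs_add_le _ _).trans ?_
  rw [abs_mul, abs_mul, abs_neg, abs_neg, abs_one, one_mul]
  refine add_le_add b5 (b2.trans ?_)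
  exact mul_le_mul_of_nonneg_left b4 (by norm_num)

theorem abs_inner₂_iterDx_F₂_le (hu : u ∈ sobolevSubmodule (r + 4))
    (hv : v ∈ sobolevSubmodule (r + 4)) (hS : norm₃ u v ≤ S) :
    |inner₂ (iterDx r v) (iterDx r (F₂ u v))| ≤
      4 * (normSeq v r * normSeq u (r + 1)) + 110 * embConst *
      ((r + 1) * (S * normSeq v r ^ 2) + S * (normSeq v r * normSeq u (r + 1)) +
        normSeq v r * ∑ t ∈ Finset.range (r - 1), ((r + 1).choose (t + 2) : ℝ) *
          (normSeq u (t + 2) * normSeq v (r - 2 - t) +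
            normSeq u (t + 1) * normSeq v (r - 1 - t))) := by
  have mm := mul_mem_sobolev (by omega) hu hv
  have md : dx u ∈ sobolevSubmodule (r + 3) := dx_mem_sobolev hu
  have mdm : dx (mul u v) ∈ sobolevSubmodule (r + 3) := dx_mem_sobolev mm
  have dn : ∀ {f : RealL2}, f ∈ sobolevSubmodule (r + 3) → f ∈ sobolevSubmodule r :=
    fun h => mem_sobolev_of_le (by omega) h
  have it : ∀ {f : RealL2}, f ∈ sobolevSubmodule (r + 3) → iterDx r f ∈ sobolevSubmodule 2 :=
    fun h => iterDx_mem_sobolev r (mem_sobolev_of_le (by omega) h)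
  have e : F₂ u v = (-1 : ℝ) • dx u + (-1 : ℝ) • dx (mul u v) := by
    rw [F₂, neg_one_smul, neg_one_smul, sub_eq_add_neg]
  have e' : inner₂ (iterDx r v) (iterDx r (F₂ u v)) =
      -1 * inner₂ (iterDx r v) (iterDx (r + 1) u) +
      -1 * inner₂ (iterDx r v) (iterDx (r + 1) (mul u v)) := by
    rw [iterDx_succ', iterDx_succ', e, iterDx_add (Submodule.smul_mem _ _ (dn md))
        (Submodule.smul_mem _ _ (dn mdm)),
      iterDx_smul _ (dn md), iterDx_smul _ (dn mdm), inner₂_add_right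
        (Submodule.smul_mem _ _ (it md)) (Submodule.smul_mem _ _ (it mdm)),
      inner₂_smul_right _ (it md), inner₂_smul_right _ (it mdm)]
  have b1 := abs_inner₂_iterDx_mul_le hu hv hS
  have b2 := abs_inner₂_le (f := iterDx r v) (g := iterDx (r + 1) u)
    (it (mem_sobolev_of_le (by omega) hv)) (iterDx_succ' r u ▸ it md)
  rw [e']
  refine (abs_add_le _ _).trans ?_
  rw [abs_mul, abs_mul, abs_neg, abs_one, one_mul, one_mul]
  exact add_le_add b2 b1

end

/-- The constant in the estimate of the summands of order `r`. -/
def levelConst (α β : ℝ) : ℝ :=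
  8 + 4 * |α| + embConst * (1320 * |β| + 288 * (|(3 - β) / 2| + |β / 2|) + 1332)

theorem levelConst_pos (α β : ℝ) : 0 < levelConst α β := by
  have := embConst_nonneg
  unfold levelConst
  positivity

/-- Each Leibniz sum is inserted in its normalized form. The linear coupling `u_x` in `F₂`
contributes as well: its weight `1/r!²` against the normalizations of `u` and `v` leaves `r + 1`, so
it needs `∂_σ Φ` besides `Φ`. -/
theorem level_le (α β σ : ℝ) {u v : RealL2} {r : ℕ} (hu : u ∈ sobolevSubmodule (r + 4))
    (hv : v ∈ sobolevSubmodule (r + 4)) :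
    |Real.exp σ ^ (2 * r) / ((r + 1)! : ℝ) ^ 2 *
        inner₂ (iterDx (r + 1) u) (iterDx (r + 1) (F₁ α β u v))| +
      |Real.exp σ ^ (2 * r) / (r ! : ℝ) ^ 2 * inner₂ (iterDx r v) (iterDx r (F₂ u v))| ≤
      levelConst α β * levelBound σ u v (norm₃ u v) r := by
  have hc := embConst_nonneg
  have hS : 0 ≤ norm₃ u v := add_nonneg (sobolevNorm_nonneg _ _) (sobolevNorm_nonneg _ _)
  have b1 := abs_inner₂_iterDx_F₁_le (α := α) (β := β) hu hv le_rfl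
  have b2 := abs_inner₂_iterDx_F₂_le hu hv le_rfl
  have hθ := Real.exp_pos σ
  have hU := normSeq_nonneg u
  have hV := normSeq_nonneg v
  have hx := normUV_nonneg σ u v
  have l1 := leibniz_sum_uuu_le hθ hU hV r
  have l2 := leibniz_sum_vuv_le hθ hU hV r
  have l3 := leibniz_sum_uvv_le hθ hU hV r
  have l4 := leibnizSqBound_le hθ hU hV hS r
  have hLB : levelBound σ u v (norm₃ u v) r = (1 + norm₃ u v) * ((r + 1) * normUV σ u v r ^ 2) +
    (if r = 1 then norm₃ u v * (normUV σ u v 0 ^ 2 + Real.exp σ ^ 2 * normUV σ u v 1 ^ 2) else 0) +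
    Real.exp σ * (√r * normUV σ u v r * conv (normUV σ u v) (r - 1)) +
    √r * normUV σ u v r * conv (normUV σ u v) r := rfl
  have n2 : 0 ≤ if r = 1 then
      norm₃ u v * (normUV σ u v 0 ^ 2 + Real.exp σ ^ 2 * normUV σ u v 1 ^ 2) else 0 := by
    split_ifs <;> positivity
  have n3 : 0 ≤ Real.exp σ * (√r * normUV σ u v r * conv (normUV σ u v) (r - 1)) :=
    mul_nonneg hθ.le (mul_nonneg (mul_nonneg (Real.sqrt_nonneg _) (hx r)) (conv_nonneg hx _))
  have n4 : 0 ≤ √r * normUV σ u v r * conv (normUV σ u v) r :=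
    mul_nonneg (mul_nonneg (Real.sqrt_nonneg _) (hx r)) (conv_nonneg hx _)
  have hsu := seqU_nonneg hθ hU r
  have hsv := seqV_nonneg hθ hV r
  have hux : seqU (Real.exp σ) (normSeq u) r ≤ normUV σ u v r := seqU_le hθ hV r
  have hvx : seqV (Real.exp σ) (normSeq v) r ≤ normUV σ u v r := seqV_le hθ hU r
  have hr : (0 : ℝ) ≤ r := Nat.cast_nonneg r
  have q1 : Real.exp σ ^ (2 * r) / ((r + 1)! : ℝ) ^ 2 * normSeq u (r + 1) ^ 2 ≤
      normUV σ u v r ^ 2 := by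
    rw [← seqU_sq]
    exact pow_le_pow_left₀ hsu hux 2
  have q2 : Real.exp σ ^ (2 * r) / (r ! : ℝ) ^ 2 * normSeq v r ^ 2 ≤ normUV σ u v r ^ 2 := by
    rw [← seqV_sq]
    exact pow_le_pow_left₀ hsv hvx 2
  have hUV : seqV (Real.exp σ) (normSeq v) r * seqU (Real.exp σ) (normSeq u) r ≤
      normUV σ u v r ^ 2 := by
    rw [sq]
    exact mul_le_mul hvx hux hsu (hx r)
  have hf : ((r + 1)! : ℝ) = (r + 1) * r ! := by
    rw [Nat.factorial_succ]
    push_cast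
    ring
  have hf0 : (0 : ℝ) < r ! := by exact_mod_cast Nat.factorial_pos r
  have q4 : Real.exp σ ^ (2 * r) / (r ! : ℝ) ^ 2 * (normSeq v r * normSeq u (r + 1)) ≤
      (r + 1) * normUV σ u v r ^ 2 := by
    refine le_trans (le_of_eq ?_) (mul_le_mul_of_nonneg_left hUV (by positivity))
    rw [seqU, seqV, hf]
    field_simp
    ring
  have q3 : Real.exp σ ^ (2 * r) / ((r + 1)! : ℝ) ^ 2 * (normSeq u (r + 1) * normSeq v r) ≤
      normUV σ u v r ^ 2 := by
    have hUVn : 0 ≤ seqV (Real.exp σ) (normSeq v) r * seqU (Real.exp σ) (normSeq u) r :=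
      mul_nonneg hsv hsu
    refine le_trans (le_of_eq ?_) ((div_le_self hUVn (by linarith : (1 : ℝ) ≤ r + 1)).trans hUV)
    rw [seqU, seqV, hf]
    field_simp
    ring
  have hd1 : 0 ≤ Real.exp σ ^ (2 * r) / ((r + 1)! : ℝ) ^ 2 := by positivity
  have hd2 : 0 ≤ Real.exp σ ^ (2 * r) / (r ! : ℝ) ^ 2 := by positivity
  rw [abs_mul, abs_mul, abs_of_nonneg hd1, abs_of_nonneg hd2]
  have b1' := mul_le_mul_of_nonneg_left b1 hd1
  have b2' := mul_le_mul_of_nonneg_left b2 hd2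
  refine (add_le_add b1' b2').trans ?_
  clear b1 b2 b1' b2' hUV hux hvx hsu hsv
  change _ ≤ 12 * Real.exp σ * (√r * normUV σ u v r * conv (normUV σ u v) (r - 1)) at l1
  change _ ≤ 12 * Real.exp σ * (√r * normUV σ u v r * conv (normUV σ u v) (r - 1)) at l2
  change _ ≤ √r * normUV σ u v r * conv (normUV σ u v) r at l3
  change _ ≤ (if r = 1 then norm₃ u v * (normUV σ u v 0 ^ 2 + Real.exp σ ^ 2 * normUV σ u v 1 ^ 2)
    else 0) + 12 * Real.exp σ * (√r * normUV σ u v r * conv (normUV σ u v) (r - 1)) at l4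
  have hx2 := sq_nonneg (normUV σ u v r)
  have hrx := mul_nonneg hr hx2
  have hSx := mul_nonneg hS hx2
  have hrSx := mul_nonneg hS hrx
  have r0 : (0 : ℝ) ≤ r + 1 := by positivity
  have t1 := mul_le_mul_of_nonneg_left (mul_le_mul_of_nonneg_left q1 hS) r0
  have t2 := mul_le_mul_of_nonneg_left (mul_le_mul_of_nonneg_left q2 hS) r0
  have t3 := mul_le_mul_of_nonneg_left q1 hS
  have t4 := mul_le_mul_of_nonneg_left q3 hS
  have t5 := mul_le_mul_of_nonneg_left q4 hS
  set B := levelBound σ u v (norm₃ u v) r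
  set cU := Real.exp σ ^ (2 * r) / ((r + 1)! : ℝ) ^ 2
  set dV := Real.exp σ ^ (2 * r) / (r ! : ℝ) ^ 2
  set K := |(3 - β) / 2| + |β / 2| with hK
  have hK0 : 0 ≤ K := by positivity
  clear_value B cU dV K
  -- The terms are grouped by their coefficients in `α`, `β` and `embConst`. The constants are `1320
  -- = 110·12`, `288 = 4·6·12`, `12 = 4·3`, and 4 for each of `α u`, `v` and `u_x`.
  have z1 := mul_le_mul_of_nonneg_left (a := |β| * embConst)
    (show cU * (110 * ((r + 1) * (norm₃ u v * normSeq u (r + 1) ^ 2) + normSeq u (r + 1) *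
        ∑ t ∈ Finset.range (r - 1), ((r + 1).choose (t + 2) : ℝ) *
          (normSeq u (t + 2) * normSeq u (r - 1 - t) +
            normSeq u (t + 1) * normSeq u (r - t)))) ≤ 1320 * B by linarith) (by positivity)
  have z2 := mul_le_mul_of_nonneg_left (a := |α|)
    (show cU * (4 * normSeq u (r + 1) ^ 2) ≤ 4 * B by linarith) (by positivity)
  have z3 := mul_le_mul_of_nonneg_left (a := K * embConst)
    (show cU * (24 * (norm₃ u v * normSeq u (r + 1) ^ 2 + normSeq u (r + 1) *
      leibnizSqBound (norm₃ u v) (normSeq u) r)) ≤ 288 * B by linarith) (by positivity)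
  have z4 : cU * (4 * (normSeq u (r + 1) * normSeq v r)) ≤ 4 * B := by linarith
  have z5 := mul_le_mul_of_nonneg_left (a := embConst)
    (show cU * (12 * (norm₃ u v * (normSeq u (r + 1) * normSeq v r) + normSeq u (r + 1) *
      ∑ t ∈ Finset.range r, ((r + 1).choose (t + 1) : ℝ) * (normSeq v t * normSeq v (r - t)))) ≤
      12 * B by linarith) (by positivity)
  have z6 : dV * (4 * (normSeq v r * normSeq u (r + 1))) ≤ 4 * B := by linarith
  have z7 := mul_le_mul_of_nonneg_left (a := embConst)
    (show dV * (110 * ((r + 1) * (norm₃ u v * normSeq v r ^ 2) +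
      norm₃ u v * (normSeq v r * normSeq u (r + 1)) +
        normSeq v r * ∑ t ∈ Finset.range (r - 1), ((r + 1).choose (t + 2) : ℝ) *
          (normSeq u (t + 2) * normSeq v (r - 2 - t) +
            normSeq u (t + 1) * normSeq v (r - 1 - t)))) ≤ 1320 * B by linarith) (by positivity)
  rw [levelConst, ← hK]
  linarith

/-! ### The derivative of `Φ` -/

section

variable {s : ℕ}

/-- The map `f ↦ f^{(j)}` from `H^s` to `L²` for `j ≤ s`. -/
def iterDxL (s j : ℕ) : Sobolev s →L[ℝ] RealL2 :=
  if h : j ≤ s then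
    LinearMap.mkContinuous
      { toFun := fun f => iterDx j f.val
        map_add' := fun f g => iterDx_add (Sobolev.mem_of_le h f) (Sobolev.mem_of_le h g)
        map_smul' := fun c f => iterDx_smul c (Sobolev.mem_of_le h f) } 1 fun f => by
      have hf : f.val ∈ sobolevSubmodule (0 + j) := Sobolev.mem_of_le (by omega) f
      rw [one_mul, Sobolev.norm_eq, ← sobolevNorm_zero]
      exact (sobolevNorm_iterDx_le j hf).trans (sobolevNorm_mono (by omega) f.memLp)
  else 0

theorem iterDxL_apply {j : ℕ} (h : j ≤ s) (f : Sobolev s) : iterDxL s j f = iterDx j f.val := by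
  rw [iterDxL, dif_pos h]
  rfl

/-- The extension of the functional `g ↦ ⟨f, g^{(j)}⟩` with the inner product of `H²` to
`g ∈ H^{j+1}`, for `f ∈ H³`. -/
def pairing (s : ℕ) (f : RealL2) (j : ℕ) : Sobolev s →L[ℝ] ℝ :=
  (innerSL ℝ f).comp (iterDxL s j) +
    (innerSL ℝ ((2 : ℝ) • dx f - dx (dx (dx f)))).comp (iterDxL s (j + 1))

/-- The top part `⟨f'', g^{(j+2)}⟩` equals `-⟨f''', g^{(j+1)}⟩`; the right side of this identity is
what `pairing` uses when `g` is only in H^{j+1}. -/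
theorem pairing_apply {j : ℕ} (h : j + 1 ≤ s) {f : RealL2} (hf : f ∈ sobolevSubmodule 3)
    (g : Sobolev s) (hg : g.val ∈ sobolevSubmodule (j + 2)) :
    pairing s f j g = inner₂ f (iterDx j g.val) := by
  have hg2 : iterDx j g.val ∈ sobolevSubmodule 2 :=
    iterDx_mem_sobolev j (mem_sobolev_of_le (by omega) hg)
  have hd : dx (dx f) ∈ sobolevSubmodule 1 := dx_mem_sobolev (dx_mem_sobolev hf)
  have e := inner_dx_left hd (dx_mem_sobolev hg2)
  simp only [pairing, add_apply, ContinuousLinearMap.comp_apply, innerSL_apply_apply,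
    iterDxL_apply h, iterDxL_apply (Nat.le_of_succ_le h), inner_sub_left, inner_smul_left,
    iterDx_succ, e, inner₂, conj_trivial]
  ring

theorem sobolevNorm_two_sq {f : RealL2} (hf : f ∈ sobolevSubmodule 2) :
    sobolevNorm 2 f ^ 2 = ‖f‖ ^ 2 + 2 * ‖dx f‖ ^ 2 + ‖dx (dx f)‖ ^ 2 := by
  rw [← inner₂_self hf, inner₂, real_inner_self_eq_norm_sq, real_inner_self_eq_norm_sq,
    real_inner_self_eq_norm_sq]

theorem hasFDerivAt_sobolevNorm_iterDx_sq {j : ℕ} (h : j + 3 ≤ s) (f : Sobolev s) :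
    HasFDerivAt (fun g : Sobolev s => sobolevNorm 2 (iterDx j g.val) ^ 2)
      ((2 : ℝ) • pairing s (iterDx j f.val) j) f := by
  -- The square of the H² norm is a combination of squared L² norms of bounded linear maps, which
  -- are differentiable by the chain rule.
  have e : (fun g : Sobolev s => sobolevNorm 2 (iterDx j g.val) ^ 2) = fun g =>
      ‖iterDxL s j g‖ ^ 2 + 2 * ‖iterDxL s (j + 1) g‖ ^ 2 + ‖iterDxL s (j + 2) g‖ ^ 2 := by
    funext g
    rw [sobolevNorm_two_sq (iterDx_mem_sobolev j (Sobolev.mem_of_le (by omega) g)),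
      iterDxL_apply (by omega), iterDxL_apply (by omega), iterDxL_apply (by omega),
      iterDx_succ (j + 1), iterDx_succ]
  rw [e]
  have d := (((iterDxL s j).hasFDerivAt (x := f)).norm_sq.add
    (((iterDxL s (j + 1)).hasFDerivAt (x := f)).norm_sq.const_mul 2)).add
    ((iterDxL s (j + 2)).hasFDerivAt (x := f)).norm_sq
  refine d.congr_fderiv (ContinuousLinearMap.ext fun g => ?_)
  rw [smul_apply, pairing_apply (by omega)
    (iterDx_mem_sobolev j (Sobolev.mem_of_le (by omega) f)) g (Sobolev.mem_of_le (by omega) g)]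
  simp only [add_apply, smul_apply, ContinuousLinearMap.comp_apply, innerSL_apply_apply,
    iterDxL_apply (show j ≤ s by omega), iterDxL_apply (show j + 1 ≤ s by omega),
    iterDxL_apply (show j + 2 ≤ s by omega), iterDx_succ, inner₂, smul_eq_mul, nsmul_eq_mul]
  push_cast
  ring

theorem pairing_comp_inclusion {t : ℕ} (h : s ≤ t) {j : ℕ} (hj : j + 1 ≤ s) (f : RealL2) :
    (pairing s f j).comp (Sobolev.inclusion h) = pairing t f j := by
  ext g
  simp only [pairing, add_apply, ContinuousLinearMap.comp_apply, iterDxL_apply hj,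
    iterDxL_apply (Nat.le_of_succ_le hj), iterDxL_apply (hj.trans h),
    iterDxL_apply ((Nat.le_of_succ_le hj).trans h)]
  rfl

end

/-- The derivative of `Φ_{σ,m}` at `(u, v)` as a functional on `H^s ⊕ H^s`, for `s ≥ m + 2`. -/
def derivPhi (s : ℕ) (σ : ℝ) (m : ℕ) (u v : RealL2) : (Sobolev s × Sobolev s) →L[ℝ] ℝ :=
  ∑ r ∈ Finset.range (m + 1),
    ((Real.exp σ ^ (2 * r) / ((r + 1)! : ℝ) ^ 2) •
        (pairing s (iterDx (r + 1) u) (r + 1)).comp (ContinuousLinearMap.fst ℝ _ _) +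
      (Real.exp σ ^ (2 * r) / (r ! : ℝ) ^ 2) •
        (pairing s (iterDx r v) r).comp (ContinuousLinearMap.snd ℝ _ _))

theorem hasFDerivAt_Phi (σ : ℝ) (m : ℕ) (U : Sobolev (m + 4) × Sobolev (m + 4)) :
    HasFDerivAt (fun W : Sobolev (m + 4) × Sobolev (m + 4) => Phi σ m W.1.val W.2.val)
      (derivPhi (m + 4) σ m U.1.val U.2.val) U := by
  simp only [Phi_eq, seqU_sq, seqV_sq, normSeq]
  have h : ∀ r ∈ Finset.range (m + 1), HasFDerivAt
      (fun W : Sobolev (m + 4) × Sobolev (m + 4) =>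
        Real.exp σ ^ (2 * r) / ((r + 1)! : ℝ) ^ 2 * sobolevNorm 2 (iterDx (r + 1) W.1.val) ^ 2 +
        Real.exp σ ^ (2 * r) / (r ! : ℝ) ^ 2 * sobolevNorm 2 (iterDx r W.2.val) ^ 2)
      ((2 : ℝ) • ((Real.exp σ ^ (2 * r) / ((r + 1)! : ℝ) ^ 2) •
        (pairing (m + 4) (iterDx (r + 1) U.1.val) (r + 1)).comp (ContinuousLinearMap.fst ℝ _ _) +
      (Real.exp σ ^ (2 * r) / (r ! : ℝ) ^ 2) •
        (pairing (m + 4) (iterDx r U.2.val) r).comp (ContinuousLinearMap.snd ℝ _ _))) U := by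
    intro r hr
    rw [Finset.mem_range] at hr
    have a := ((hasFDerivAt_sobolevNorm_iterDx_sq (show r + 1 + 3 ≤ m + 4 by omega) U.1).comp U
      hasFDerivAt_fst).const_mul (Real.exp σ ^ (2 * r) / ((r + 1)! : ℝ) ^ 2)
    have b := ((hasFDerivAt_sobolevNorm_iterDx_sq (show r + 3 ≤ m + 4 by omega) U.2).comp U
      hasFDerivAt_snd).const_mul (Real.exp σ ^ (2 * r) / (r ! : ℝ) ^ 2)
    refine (a.add b).congr_fderiv (ContinuousLinearMap.ext fun W => ?_)
    simp only [add_apply, smul_apply, ContinuousLinearMap.comp_apply, smul_eq_mul]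
    ring
  refine ((HasFDerivAt.fun_sum h).const_mul (1 / 2 : ℝ)).congr_fderiv ?_
  rw [← Finset.smul_sum, smul_smul, derivPhi]
  norm_num

theorem derivPhi_comp_inclusion₂ {s t : ℕ} (h : s ≤ t) (σ : ℝ) {m : ℕ} (hm : m + 2 ≤ s)
    (u v : RealL2) :
    (derivPhi s σ m u v).comp (Sobolev.inclusion₂ h) = derivPhi t σ m u v := by
  ext W
  all_goals
    simp only [derivPhi, ContinuousLinearMap.comp_apply, sum_apply,
      ContinuousLinearMap.inl_apply, ContinuousLinearMap.inr_apply]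
    refine Finset.sum_congr rfl fun r hr => ?_
    rw [Finset.mem_range] at hr
    rw [← pairing_comp_inclusion h (show r + 1 + 1 ≤ s by omega),
      ← pairing_comp_inclusion h (show r + 1 ≤ s by omega)]
    rfl

/-- The highest order of a derivative of the direction is `m + 1`, so undoing the integration by
parts needs directions in `H^{m+3}`. The vector field `F(u,v)` has this regularity. -/
theorem derivPhi_apply {s : ℕ} (σ : ℝ) {m : ℕ} (hm : m + 2 ≤ s) {u v : RealL2}
    (hu : u ∈ sobolevSubmodule (m + 4)) (hv : v ∈ sobolevSubmodule (m + 4))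
    (W : Sobolev s × Sobolev s) (hW₁ : W.1.val ∈ sobolevSubmodule (m + 3))
    (hW₂ : W.2.val ∈ sobolevSubmodule (m + 3)) :
    derivPhi s σ m u v W = ∑ r ∈ Finset.range (m + 1),
      (Real.exp σ ^ (2 * r) / ((r + 1)! : ℝ) ^ 2 *
          inner₂ (iterDx (r + 1) u) (iterDx (r + 1) W.1.val) +
        Real.exp σ ^ (2 * r) / (r ! : ℝ) ^ 2 * inner₂ (iterDx r v) (iterDx r W.2.val)) := by
  rw [derivPhi, sum_apply]
  refine Finset.sum_congr rfl fun r hr => ?_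
  rw [Finset.mem_range] at hr
  simp only [add_apply, smul_apply, ContinuousLinearMap.comp_apply, smul_eq_mul,
    ContinuousLinearMap.coe_fst', ContinuousLinearMap.coe_snd']
  rw [pairing_apply (by omega) (iterDx_mem_sobolev (r + 1) (mem_sobolev_of_le (by omega) hu)) _
      (mem_sobolev_of_le (by omega) hW₁),
    pairing_apply (by omega) (iterDx_mem_sobolev r (mem_sobolev_of_le (by omega) hv)) _
      (mem_sobolev_of_le (by omega) hW₂)]

/-! ### Density of `H^t` in `H^s` -/

/-- The frequency cut-off is symmetric about 0, so the truncated function is again real-valued. -/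
theorem exists_fourierL2_eq_indicator (f : RealL2) (n : ℕ) : ∃ g, fourierL2 g =ᵐ[volume]
    (Set.Icc (-n : ℝ) n).indicator (fourierL2 f) := by
  have e : (fun ξ => (Set.Icc (-n : ℝ) n).indicator (1 : ℝ → ℂ) ξ * fourierL2 f ξ) =
      (Set.Icc (-n : ℝ) n).indicator (fourierL2 f) := by
    funext ξ
    by_cases h : ξ ∈ Set.Icc (-n : ℝ) n <;> simp [h]
  have := exists_fourierL2_eq_mul f (M := (Set.Icc (-n : ℝ) n).indicator 1) (fun ξ => by
    have hiff : -ξ ∈ Set.Icc (-n : ℝ) n ↔ ξ ∈ Set.Icc (-n : ℝ) n := by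
      simp only [Set.mem_Icc]
      constructor <;> intro h <;> constructor <;> linarith [h.1, h.2]
    by_cases h : ξ ∈ Set.Icc (-n : ℝ) n
    · rw [Set.indicator_of_mem h, Set.indicator_of_mem (hiff.2 h)]
      simp
    · rw [Set.indicator_of_notMem h, Set.indicator_of_notMem (fun h' => h (hiff.1 h'))]
      simp) (by
    rw [e]
    exact (Lp.memLp (fourierL2 f)).indicator measurableSet_Icc)
  rwa [e] at this

theorem mem_sobolev_of_fourierL2_eq_indicator (t : ℕ) {f g : RealL2} {n : ℕ}
    (h : fourierL2 g =ᵐ[volume] (Set.Icc (-n : ℝ) n).indicator (fourierL2 f)) :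
    g ∈ sobolevSubmodule t := by
  have hi := mem_sobolev_iff.1 (mem_sobolev_zero g)
  rw [mem_sobolev_iff]
  have hc : ContinuousOn (fun ξ : ℝ => (1 + (2 * Real.pi * ξ) ^ 2) ^ t) (Set.Icc (-n : ℝ) n) := by
    fun_prop
  have hi' : IntegrableOn (fun ξ => ‖fourierL2 g ξ‖ ^ 2) (Set.Icc (-n : ℝ) n) := by
    simpa using hi.integrableOn
  have := (hi'.continuousOn_mul hc isCompact_Icc).integrable_indicator measurableSet_Icc
  refine this.congr ?_
  filter_upwards [h] with ξ hξ
  by_cases hm : ξ ∈ Set.Icc (-n : ℝ) n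
  · rw [Set.indicator_of_mem hm]
  · rw [Set.indicator_of_notMem hm, hξ, Set.indicator_of_notMem hm]
    simp

/-- Frequency truncations lie in every H^t, and the squared H^s error is the integral of a fixed
integrable function over the complement of `[-n, n]`, which tends to 0 by dominated convergence. -/
theorem denseRange_inclusion {s t : ℕ} (h : s ≤ t) : DenseRange (Sobolev.inclusion h) := by
  intro f
  choose g hg using exists_fourierL2_eq_indicator f.val
  have hgt : ∀ n, g n ∈ sobolevSubmodule t := fun n =>
    mem_sobolev_of_fourierL2_eq_indicator t (hg n)
  have hfi := mem_sobolev_iff.1 f.memLp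
  have key : Filter.Tendsto (fun n => sobolevNorm s (f.val - g n) ^ 2) Filter.atTop (nhds 0) := by
    have e : ∀ n, sobolevNorm s (f.val - g n) ^ 2 = ∫ ξ, (Set.Icc (-n : ℝ) n)ᶜ.indicator
        (fun ξ => (1 + (2 * Real.pi * ξ) ^ 2) ^ s * ‖fourierL2 f.val ξ‖ ^ 2) ξ := by
      intro n
      rw [sobolevNorm_sq (sub_mem f.memLp (mem_sobolev_of_le h (hgt n)))]
      refine integral_congr_ae ?_
      rw [fourierL2_sub]
      filter_upwards [hg n, Lp.coeFn_sub (fourierL2 f.val) (fourierL2 (g n))] with ξ h1 h2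
      rw [h2, Pi.sub_apply, h1]
      by_cases hm : ξ ∈ Set.Icc (-n : ℝ) n <;> simp [hm]
    simp only [e]
    have h0 : (0 : ℝ) = ∫ ξ : ℝ, (0 : ℝ) := by simp
    rw [h0]
    refine tendsto_integral_of_dominated_convergence
      (fun ξ => (1 + (2 * Real.pi * ξ) ^ 2) ^ s * ‖fourierL2 f.val ξ‖ ^ 2)
      (fun n => hfi.aestronglyMeasurable.indicator measurableSet_Icc.compl) hfi
      (fun n => Filter.Eventually.of_forall fun ξ => ?_) (Filter.Eventually.of_forall fun ξ => ?_)
    · refine (norm_indicator_le_norm_self _ _).trans (le_of_eq (Real.norm_of_nonneg ?_))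
      positivity
    · obtain ⟨N, hN⟩ := exists_nat_ge |ξ|
      refine tendsto_const_nhds.congr' ?_
      filter_upwards [Filter.eventually_ge_atTop N] with n hn
      have hn' : |ξ| ≤ n := hN.trans (by exact_mod_cast hn)
      rw [Set.indicator_of_notMem]
      exact fun hmem => hmem (abs_le.1 hn')
  refine mem_closure_of_tendsto (f := fun n => Sobolev.inclusion h (Sobolev.mk (hgt n)))
    (b := Filter.atTop) ?_ (Filter.Eventually.of_forall fun n => Set.mem_range_self _)
  rw [tendsto_iff_norm_sub_tendsto_zero]
  have := key.sqrt
  rw [Real.sqrt_zero] at this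
  refine this.congr fun n => ?_
  rw [Real.sqrt_sq (sobolevNorm_nonneg _ _), norm_sub_rev, Sobolev.norm_eq]
  rfl

theorem denseRange_inclusion₂ {s t : ℕ} (h : s ≤ t) : DenseRange (Sobolev.inclusion₂ h) :=
  (denseRange_inclusion h).prodMap (denseRange_inclusion h)

/-! ### The extended derivative, its uniqueness, and the final estimate -/

theorem isFrechetDerivPhi_derivPhi (σ : ℝ) (m : ℕ) (U : Sobolev (m + 4) × Sobolev (m + 4)) :
    IsFrechetDerivPhi σ m U (derivPhi (m + 2) σ m U.1.val U.2.val) := by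
  rw [IsFrechetDerivPhi, derivPhi_comp_inclusion₂ _ _ le_rfl]
  exact hasFDerivAt_Phi σ m U

theorem IsFrechetDerivPhi.unique {σ : ℝ} {m : ℕ} {U : Sobolev (m + 4) × Sobolev (m + 4)}
    {D D' : (Sobolev (m + 2) × Sobolev (m + 2)) →L[ℝ] ℝ} (hD : IsFrechetDerivPhi σ m U D)
    (hD' : IsFrechetDerivPhi σ m U D') : D = D' := by
  have h := HasFDerivAt.unique hD hD'
  refine ContinuousLinearMap.coeFn_injective ((denseRange_inclusion₂ (Nat.add_le_add_left
    (by norm_num : 2 ≤ 4) m)).equalizer D.continuous D'.continuous ?_)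
  funext W
  exact DFunLike.congr_fun h W

theorem abs_derivPhi_le (α β σ : ℝ) {m : ℕ} (hm : 1 ≤ m) {u v : RealL2}
    (hu : u ∈ sobolevSubmodule (m + 4)) (hv : v ∈ sobolevSubmodule (m + 4))
    (W : Sobolev (m + 2) × Sobolev (m + 2)) (hW₁ : W.1.val = F₁ α β u v)
    (hW₂ : W.2.val = F₂ u v) :
    |derivPhi (m + 2) σ m u v W| ≤ levelConst α β *
      ((4 + 8 * norm₃ u v) * Phi σ m u v +
        (8 + 8 * Real.exp σ) * √(Phi σ m u v) * dσPhi σ m u v +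
        (2 + (2 + 2 * Real.exp (2 * σ)) * norm₃ u v) * dσPhi σ m u v) := by
  have hS : 0 ≤ norm₃ u v := add_nonneg (sobolevNorm_nonneg _ _) (sobolevNorm_nonneg _ _)
  rw [derivPhi_apply σ le_rfl hu hv W (hW₁ ▸ F₁_mem_sobolev hu (mem_sobolev_of_le (by omega) hv))
    (hW₂ ▸ F₂_mem_sobolev hu hv), hW₁, hW₂]
  refine (Finset.abs_sum_le_sum_abs _ _).trans ((Finset.sum_le_sum fun r hr => ?_).trans
    ((Finset.mul_sum _ _ _).symm.le.trans
      (mul_le_mul_of_nonneg_left (sum_levelBound_le σ m u v hm hS) (levelConst_pos α β).le)))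
  rw [Finset.mem_range] at hr
  exact (abs_add_le _ _).trans (level_le α β σ (mem_sobolev_of_le (by omega) hu)
    (mem_sobolev_of_le (by omega) hv))

end CamassaHolm

end

theorem proposition3p6 (α β : ℝ) :
    ∃ K₁ K₂ L₁ L₂ M₁ M₂ M₃ : ℝ,
      (0 < K₁ ∧ 0 < K₂ ∧ 0 < L₁ ∧ 0 < L₂ ∧ 0 < M₁ ∧ 0 < M₂ ∧ 0 < M₃) ∧
      ∀ (m : ℕ), 1 ≤ m → ∀ (σ : ℝ) (u v : CamassaHolm.Sobolev (m + 4)),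
        ∃ F : CamassaHolm.Sobolev (m + 2) × CamassaHolm.Sobolev (m + 2),
          F.1.val = CamassaHolm.F₁ α β u.val v.val ∧
          F.2.val = CamassaHolm.F₂ u.val v.val ∧
          ∃ D : (CamassaHolm.Sobolev (m + 2) × CamassaHolm.Sobolev (m + 2)) →L[ℝ] ℝ,
            CamassaHolm.IsFrechetDerivPhi σ m (u, v) D ∧
            (∀ D', CamassaHolm.IsFrechetDerivPhi σ m (u, v) D' → D' = D) ∧
            |D F| ≤
              (K₁ + K₂ * CamassaHolm.norm₃ u.val v.val) * CamassaHolm.Phi σ m u.val v.val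
              + (L₁ + L₂ * Real.exp σ) * Real.sqrt (CamassaHolm.Phi σ m u.val v.val)
                  * CamassaHolm.dσPhi σ m u.val v.val
              + (M₁ + (M₂ + M₃ * Real.exp (2 * σ)) * CamassaHolm.norm₃ u.val v.val)
                  * CamassaHolm.dσPhi σ m u.val v.val := by
  have hC := CamassaHolm.levelConst_pos α β
  set C := CamassaHolm.levelConst α β
  -- These are the numerical coefficients of `sum_levelBound_le` times `levelConst`, which depends
  -- on `α` and `β` only.
  refine ⟨4 * C, 8 * C, 8 * C, 8 * C, 2 * C, 2 * C, 2 * C, by refine ⟨?_, ?_, ?_, ?_, ?_, ?_, ?_⟩ <;>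
    positivity, fun m hm σ u v => ?_⟩
  have hu : u.val ∈ CamassaHolm.sobolevSubmodule (m + 4) := u.memLp
  have hv : v.val ∈ CamassaHolm.sobolevSubmodule (m + 4) := v.memLp
  have h₁ : CamassaHolm.F₁ α β u.val v.val ∈ CamassaHolm.sobolevSubmodule (m + 2) :=
    CamassaHolm.F₁_mem_sobolev (CamassaHolm.mem_sobolev_of_le (by omega) hu)
      (CamassaHolm.mem_sobolev_of_le (by omega) hv)
  have h₂ : CamassaHolm.F₂ u.val v.val ∈ CamassaHolm.sobolevSubmodule (m + 2) :=
    CamassaHolm.F₂_mem_sobolev (CamassaHolm.mem_sobolev_of_le (by omega) hu)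
      (CamassaHolm.mem_sobolev_of_le (by omega) hv)
  refine ⟨(CamassaHolm.Sobolev.mk h₁, CamassaHolm.Sobolev.mk h₂), rfl, rfl,
    CamassaHolm.derivPhi (m + 2) σ m u.val v.val,
    CamassaHolm.isFrechetDerivPhi_derivPhi σ m (u, v),
    fun D' hD' => hD'.unique (CamassaHolm.isFrechetDerivPhi_derivPhi σ m (u, v)), ?_⟩
  refine (CamassaHolm.abs_derivPhi_le α β σ hm hu hv _ rfl rfl).trans (le_of_eq ?_)
  ring
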